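/- Let $M$ be a smooth $N$-dimensional manifold (Hausdorff, second countable), let $\omega^{ij}(u)$ be an arbitrary, possibly degenerate, smooth Poisson structure on $M$, and let $T_{ijk}(u)$ be an arbitrary smooth closed 3-form on $M$. Let $\Omega M$ be the loop space of smooth maps $\gamma:S^1=\mathbb R/\mathbb Z\to M$, $\gamma(x)=\{u^i(x)\}$, and call $V\subseteq\Omega M$ open if it is open along every smooth finite-dimensional family of loops. A functional $I:V\to\mathbb R$ is said to have a smooth variational derivative $\delta I/\delta u$ if $\delta I/\delta u(x)$ is, for every loop in $V$, a covector field along the loop, depends smoothly on $x$ and on the parameters along every smooth finite-dimensional family of loops in $V$, and satisfies $dI=\int_{S^1}\frac{\delta I}{\delta u^i(x)}\,\delta u^i(x)\,dx$ along all such families. A matrix operator $A^{ij}(u,u_x)$ is a Poisson structure on a subset $U\subseteq\Omega M$ if for every open $V\subseteq U$ the bracket $$\{I,J\}=\int_{S^1}\frac{\delta I}{\delta u^i(x)}\,A^{ij}(u,u_x)\,\frac{\delta J}{\delta u^j(x)}\,dx$$ of functionals on $V$ with smooth variational derivatives is again a functional with a smooth variational derivative, is skew-symmetric, and satisfies the Jacobi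 identity. For $\varepsilon\in\mathbb R$ put $$A^{ij}(\varepsilon,u,u_x)=B^i_s(\varepsilon,u,u_x)\,\omega^{sj}(u),\qquad B^i_s(\varepsilon,u,u_x)\bigl(\delta^s_j+\varepsilon\,\omega^{sp}(u)\,T_{pjk}(u)\,u^k_x\bigr)=\delta^i_j ,$$ wherever the matrix in parentheses is invertible, and let $\mathcal U_\varepsilon\subseteq\Omega M$ be the set of loops along which it is invertible at every $x\in S^1$. Then: 1. For every $\varepsilon\in\mathbb R$ the set $\mathcal U_\varepsilon$ is open and $A^{ij}(\varepsilon,u,u_x)$ is a Poisson structure on $\mathcal U_\varepsilon$. Every loop belongs to $\mathcal U_\varepsilon$ for all sufficiently small $|\varepsilon|$. 2. There are matrix operators $A_n^{ij}(u,u_x)$, $n\ge 0$, such that for every point $u$ and tangent vector $u_x$ at $u$, and for all sufficiently small $|\varepsilon|$ (depending on $u,u_x$), the matrix $\delta^s_j+\varepsilon\,\omega^{sp}T_{pjk}u^k_x$ is invertible and $$A^{ij}(\varepsilon,u,u_x)=\sum_{n\ge 0}\varepsilon^nA_n^{ij}(u,u_x)=\omega^{ij}(u)-\varepsilon\,\omega^{is}(u)\,T_{srk}(u)\,\omega^{rj}(u)\,u^k_x+\cdots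 .$$ 3. The formal series $\sum_{n\ge0}\varepsilon^nA_n^{ij}$ is a graded $\varepsilon$-deformation of $\omega$: $A_0^{ij}=\omega^{ij}$; for every $n$ the entries of $A_n^{ij}(u,u_x)$ are homogeneous polynomials of degree $n$ in $u_x$ depending smoothly on $u$; and, for functionals with smooth variational derivatives on any open subset of $\Omega M$, each bracket $\{I,J\}_n$ defined by $A_n^{ij}$ is again a functional with a smooth variational derivative, and the formal bracket $\sum_n\varepsilon^n\{I,J\}_n$ is skew-symmetric and satisfies the Jacobi identity in every order of $\varepsilon$. -/

import Mathlib

open Filter Topology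
open scoped Manifold ContDiff

namespace LoopPoisson

noncomputable section

/-- The space of coordinates `(u¹, …, uᴺ)`. -/
abbrev Coord (N : ℕ) : Type := EuclideanSpace ℝ (Fin N)

/-- The tangent space at `p` of an `N`-dimensional manifold. -/
abbrev Tan (N : ℕ) {M : Type*} [TopologicalSpace M] [ChartedSpace (Coord N) M] (p : M) : Type :=
  TangentSpace (𝓡 N) p

/-- The cotangent space at `p`. -/
abbrev Cotan (N : ℕ) {M : Type*} [TopologicalSpace M] [ChartedSpace (Coord N) M] (p : M) : Type :=
  Module.Dual ℝ (Tan N p)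

/-! ### Local coordinates -/

section Coordinates

variable {N : ℕ} {M : Type*} [TopologicalSpace M] [ChartedSpace (Coord N) M]

/-- The differential at `p` of the chart around `c`: it sends a tangent vector to its components
in these local coordinates. -/
def coframe (c p : M) : Tan N p →L[ℝ] Coord N :=
  mfderiv (𝓡 N) 𝓘(ℝ, Coord N) (chartAt (Coord N) c) p

/-- The inverse of the differential of the chart around `c` at a point `p` of its domain: it sends
components in these local coordinates to the tangent vector with these components. -/
def frame (c p : M) : Coord N →L[ℝ] Tan N p :=
  (coframe c p).inverse

/-- The covector at `p` with components `a` in the chart around `c`. -/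
def coordCovector (c p : M) (a : Module.Dual ℝ (Coord N)) : Cotan N p :=
  a ∘ₗ (coframe (N := N) c p).toLinearMap

end Coordinates

/-! ### Poisson structures and closed 3-forms on a manifold -/

section Tensors

/-- Contravariant 2-tensor fields, `ω₀ p α` being the vector `ω^{ij}(p) α_j`. -/
abbrev TwoTensor (N : ℕ) (M : Type*) [TopologicalSpace M] [ChartedSpace (Coord N) M] : Type _ :=
  ∀ p : M, Cotan N p →ₗ[ℝ] Tan N p

/-- Fields of alternating trilinear forms. -/
abbrev ThreeForm (N : ℕ) (M : Type*) [TopologicalSpace M] [ChartedSpace (Coord N) M] : Type _ :=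
  ∀ p : M, (Tan N p) [⋀^Fin 3]→L[ℝ] ℝ

variable {N : ℕ} {M : Type*} [TopologicalSpace M] [ChartedSpace (Coord N) M]

/-- The vector `ω^{ij} a_j` at the point with coordinates `y`, in components. -/
def TwoTensor.inChart (ω₀ : TwoTensor N M) (c : M) (a : Module.Dual ℝ (Coord N)) (y : Coord N) :
    Coord N :=
  let p := (chartAt (Coord N) c).symm y
  coframe c p (ω₀ p (coordCovector c p a))

/-- `ω` is a (smooth) Poisson structure on `M`: it is skew-symmetric, and in local coordinates its
components are smooth and satisfy the Jacobi identity
`∂_s ω^{ij} ω^{sk} + ∂_s ω^{jk} ω^{si} + ∂_s ω^{ki} ω^{sj} = 0`. -/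
structure IsPoissonStructure (ω₀ : TwoTensor N M) : Prop where
  skew : ∀ (p : M) (α β : Cotan N p), α (ω₀ p β) = -β (ω₀ p α)
  smooth : ∀ (c : M) (a : Module.Dual ℝ (Coord N)),
    ContDiffOn ℝ ∞ (ω₀.inChart c a) (chartAt (Coord N) c).target
  jacobi : ∀ (c : M) (a b d : Module.Dual ℝ (Coord N)), ∀ y ∈ (chartAt (Coord N) c).target,
    fderiv ℝ (fun z => a (ω₀.inChart c b z)) y (ω₀.inChart c d y)
      + fderiv ℝ (fun z => b (ω₀.inChart c d z)) y (ω₀.inChart c a y)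
      + fderiv ℝ (fun z => d (ω₀.inChart c a z)) y (ω₀.inChart c b y) = 0

/-- The 3-form in the local coordinates given by the chart around `c`. -/
def ThreeForm.inChart (T : ThreeForm N M) (c : M) (y : Coord N) : (Coord N) [⋀^Fin 3]→L[ℝ] ℝ :=
  let p := (chartAt (Coord N) c).symm y
  (T p).compContinuousLinearMap (frame c p)

/-- `T` is a smooth closed differential 3-form. -/
structure IsClosedThreeForm (T : ThreeForm N M) : Prop where
  smooth : ∀ c : M, ContDiffOn ℝ ∞ (T.inChart c) (chartAt (Coord N) c).target
  closed : ∀ c : M, ∀ y ∈ (chartAt (Coord N) c).target, extDeriv (T.inChart c) y = 0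

end Tensors

/-! ### The loop space and its functionals -/

section Loops

/-- The loop space: smooth parametrized maps from the circle `ℝ / ℤ` to `M`. -/
structure Loop (N : ℕ) (M : Type*) [TopologicalSpace M] [ChartedSpace (Coord N) M] where
  toFun : UnitAddCircle → M
  smooth : ContMDiff 𝓘(ℝ, ℝ) (𝓡 N) ∞ (fun x : ℝ => toFun (x : UnitAddCircle))

instance (N : ℕ) (M : Type*) [TopologicalSpace M] [ChartedSpace (Coord N) M] :
    CoeFun (Loop N M) (fun _ => UnitAddCircle → M) := ⟨Loop.toFun⟩

/-- Fields that assign to every loop `γ` a covector field along `γ`. -/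
abbrev CovectorField (N : ℕ) (M : Type*) [TopologicalSpace M] [ChartedSpace (Coord N) M] :
    Type _ :=
  ∀ (γ : Loop N M) (x : UnitAddCircle), Cotan N (γ x)

/-- Matrix operators `P^{ij}(u, u_x)`: `P p v α` is the vector `P^{ij}(p, v) α_j`. -/
abbrev MatrixOperator (N : ℕ) (M : Type*) [TopologicalSpace M] [ChartedSpace (Coord N) M] :
    Type _ :=
  ∀ p : M, Tan N p → (Cotan N p →ₗ[ℝ] Tan N p)

variable {N : ℕ} {M : Type*} [TopologicalSpace M] [ChartedSpace (Coord N) M]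

/-- The velocity `u_x` of a loop. -/
def Loop.velocity (γ : Loop N M) (x : ℝ) : Tan N (γ x) :=
  mfderiv 𝓘(ℝ, ℝ) (𝓡 N) (fun y : ℝ => γ (y : UnitAddCircle)) x (1 : ℝ)

/-- `Γ` is, over the open set `W` of parameters, a smooth finite-dimensional family of loops that
belong to `V`. The values of `Γ` outside `W` play no role. -/
structure IsSmoothFamily (V : Set (Loop N M)) {k : ℕ} (W : Set (Fin k → ℝ))
    (Γ : (Fin k → ℝ) → Loop N M) : Prop where
  isOpen : IsOpen W
  mem : ∀ t ∈ W, Γ t ∈ V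
  smooth : ContMDiffOn 𝓘(ℝ, (Fin k → ℝ) × ℝ) (𝓡 N) ∞
    (fun q : (Fin k → ℝ) × ℝ => Γ q.1 (q.2 : UnitAddCircle)) (W ×ˢ Set.univ)

/-- Open subsets of the loop space, for the final topology of all smooth finite-dimensional
families of loops. -/
def IsLoopOpen (V : Set (Loop N M)) : Prop :=
  ∀ (k : ℕ) (W : Set (Fin k → ℝ)) (Γ : (Fin k → ℝ) → Loop N M),
    IsSmoothFamily Set.univ W Γ → IsOpen {t ∈ W | Γ t ∈ V}

/-- The functional `F` is smooth on `V` with variational derivative `f = δF / δu`: along every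
smooth family `Γ` of loops in `V` the components of `f` in local coordinates are smooth in the
parameter and `x`, and `dF = ∫ f_i δu^i dx`. -/
structure HasVariationalDeriv (V : Set (Loop N M)) (F : Loop N M → ℝ) (f : CovectorField N M) :
    Prop where
  smooth : ∀ (k : ℕ) (W : Set (Fin k → ℝ)) (Γ : (Fin k → ℝ) → Loop N M), IsSmoothFamily V W Γ →
    ∀ (c : M) (w : Coord N), ContDiffOn ℝ ∞
      (fun q : (Fin k → ℝ) × ℝ => f (Γ q.1) q.2 (frame c (Γ q.1 q.2) w))
      {q | q.1 ∈ W ∧ Γ q.1 q.2 ∈ (chartAt (Coord N) c).source}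
  deriv : ∀ (k : ℕ) (W : Set (Fin k → ℝ)) (Γ : (Fin k → ℝ) → Loop N M), IsSmoothFamily V W Γ →
    ∀ t ∈ W, ∀ s : Fin k → ℝ,
      HasDerivAt (fun τ : ℝ => F (Γ (t + τ • s)))
        (∫ x in (0 : ℝ)..1,
          f (Γ t) x (mfderiv 𝓘(ℝ, Fin k → ℝ) (𝓡 N) (fun t' => Γ t' (x : UnitAddCircle)) t s)) 0

/-- The bracket `∫ f_i P^{ij}(u, u_x) g_j dx`; with `f = δI / δu` and `g = δJ / δu` it is the
bracket `{I, J}` of the functionals `I` and `J` defined by the matrix operator `P`. -/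
def bracket (P : MatrixOperator N M) (f g : CovectorField N M) (γ : Loop N M) : ℝ :=
  ∫ x in (0 : ℝ)..1, f γ x (P (γ x) (γ.velocity x) (g γ x))

/-- The matrix operator `P` is a Poisson structure on the subset `U` of the loop space: on the
smooth functionals with a variational derivative on any open `V ⊆ U`, the bracket takes values in
such functionals, is skew-symmetric, and satisfies the Jacobi identity. -/
structure IsLoopPoisson (U : Set (Loop N M)) (P : MatrixOperator N M) : Prop where
  skew : ∀ V ⊆ U, IsLoopOpen V → ∀ (I J : Loop N M → ℝ) (dI dJ : CovectorField N M),
    HasVariationalDeriv V I dI → HasVariationalDeriv V J dJ →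
    ∀ γ ∈ V, bracket P dI dJ γ = -bracket P dJ dI γ
  closed : ∀ V ⊆ U, IsLoopOpen V → ∀ (I J : Loop N M → ℝ) (dI dJ : CovectorField N M),
    HasVariationalDeriv V I dI → HasVariationalDeriv V J dJ →
    ∃ dIJ : CovectorField N M, HasVariationalDeriv V (bracket P dI dJ) dIJ
  jacobi : ∀ V ⊆ U, IsLoopOpen V →
    ∀ (I J K : Loop N M → ℝ) (dI dJ dK dIJ dJK dKI : CovectorField N M),
    HasVariationalDeriv V I dI → HasVariationalDeriv V J dJ → HasVariationalDeriv V K dK →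
    HasVariationalDeriv V (bracket P dI dJ) dIJ →
    HasVariationalDeriv V (bracket P dJ dK) dJK →
    HasVariationalDeriv V (bracket P dK dI) dKI →
    ∀ γ ∈ V, bracket P dIJ dK γ + bracket P dJK dI γ + bracket P dKI dJ γ = 0

/-- The formal power series `∑ εⁿ Pₙ` of matrix operators is a Poisson structure on the loop space:
its bracket `{I, J} = ∑ εⁿ {I, J}ₙ` is skew-symmetric and satisfies the Jacobi identity in every
order of `ε`. -/
structure IsFormalLoopPoisson (P : ℕ → MatrixOperator N M) : Prop where
  skew : ∀ V, IsLoopOpen V → ∀ (I J : Loop N M → ℝ) (dI dJ : CovectorField N M),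
    HasVariationalDeriv V I dI → HasVariationalDeriv V J dJ →
    ∀ n, ∀ γ ∈ V, bracket (P n) dI dJ γ = -bracket (P n) dJ dI γ
  closed : ∀ V, IsLoopOpen V → ∀ (I J : Loop N M → ℝ) (dI dJ : CovectorField N M),
    HasVariationalDeriv V I dI → HasVariationalDeriv V J dJ →
    ∀ n, ∃ dIJ : CovectorField N M, HasVariationalDeriv V (bracket (P n) dI dJ) dIJ
  jacobi : ∀ V, IsLoopOpen V → ∀ (I J K : Loop N M → ℝ) (dI dJ dK : CovectorField N M)
    (dIJ dJK dKI : ℕ → CovectorField N M),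
    HasVariationalDeriv V I dI → HasVariationalDeriv V J dJ → HasVariationalDeriv V K dK →
    (∀ m, HasVariationalDeriv V (bracket (P m) dI dJ) (dIJ m)) →
    (∀ m, HasVariationalDeriv V (bracket (P m) dJ dK) (dJK m)) →
    (∀ m, HasVariationalDeriv V (bracket (P m) dK dI) (dKI m)) →
    ∀ n, ∀ γ ∈ V, ∑ m ∈ Finset.HasAntidiagonal.antidiagonal n,
      (bracket (P m.1) (dIJ m.2) dK γ + bracket (P m.1) (dJK m.2) dI γ
        + bracket (P m.1) (dKI m.2) dJ γ) = 0

/-- The formal series `∑ εⁿ Pₙ` is a graded `ε`-deformation of `ω`: it starts with `ω`, the entries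
of `Pₙ(u, u_x)` are homogeneous polynomials of degree `n` in `u_x` that depend smoothly on `u`, and
it is a Poisson structure. -/
structure IsGradedDeformation (ω₀ : TwoTensor N M) (P : ℕ → MatrixOperator N M) : Prop where
  zero : ∀ (p : M) (v : Tan N p), P 0 p v = ω₀ p
  homogeneous : ∀ (n : ℕ) (p : M) (α β : Cotan N p),
    ∃ L : MultilinearMap ℝ (fun _ : Fin n => Tan N p) ℝ, ∀ v, α (P n p v β) = L (fun _ => v)
  smooth : ∀ (n : ℕ) (c : M) (a : Module.Dual ℝ (Coord N)), ContDiffOn ℝ ∞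
    (fun q : Coord N × Coord N =>
      let p := (chartAt (Coord N) c).symm q.1
      coframe c p (P n p (frame c p q.2) (coordCovector c p a)))
    ((chartAt (Coord N) c).target ×ˢ Set.univ)
  poisson : IsFormalLoopPoisson P

end Loops

/-! ### The deformation of a Poisson structure by a 3-form -/

section Deformation

variable {N : ℕ} {M : Type*} [TopologicalSpace M] [ChartedSpace (Coord N) M]

/-- The matrix `T_{pjk} v^k`: it sends a vector `ξ` to the covector `T_{pjk} ξ^j v^k`. -/
def contract (T : ThreeForm N M) (p : M) (v : Tan N p) : Tan N p →ₗ[ℝ] Cotan N p :=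
  LinearMap.mk₂ ℝ (fun ξ η => T p ![η, ξ, v])
    (fun ξ ξ' η => by
      have h (z : Tan N p) : ![η, z, v] = Function.update ![η, 0, v] 1 z := by
        ext i; fin_cases i <;> rfl
      rw [h (ξ + ξ'), h ξ, h ξ', (T p).map_update_add])
    (fun r ξ η => by
      have h (z : Tan N p) : ![η, z, v] = Function.update ![η, 0, v] 1 z := by
        ext i; fin_cases i <;> rfl
      rw [h (r • ξ), h ξ, (T p).map_update_smul])
    (fun ξ η η' => by
      have h (z : Tan N p) : ![z, ξ, v] = Function.update ![0, ξ, v] 0 z := by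
        ext i; fin_cases i <;> rfl
      rw [h (η + η'), h η, h η', (T p).map_update_add])
    (fun r ξ η => by
      have h (z : Tan N p) : ![z, ξ, v] = Function.update ![0, ξ, v] 0 z := by
        ext i; fin_cases i <;> rfl
      rw [h (r • η), h η, (T p).map_update_smul])

/-- The matrix `M^s_j = δ^s_j + ε ω^{sp} T_{pjk} v^k`. -/
def deformationMatrix (ω₀ : TwoTensor N M) (T : ThreeForm N M) (ε : ℝ) (p : M) (v : Tan N p) :
    Module.End ℝ (Tan N p) :=
  1 + ε • (ω₀ p ∘ₗ contract T p v)

/-- The operator `A^{ij} = B^i_s ω^{sj}`, where `B` is the inverse of the matrix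
`δ^s_j + ε ω^{sp} T_{pjk} u^k_x` wherever the latter is invertible. -/
def deformedOperator (ω₀ : TwoTensor N M) (T : ThreeForm N M) (ε : ℝ) : MatrixOperator N M :=
  fun p v => Ring.inverse (deformationMatrix ω₀ T ε p v) ∘ₗ ω₀ p

/-- The loops on which the operator `A` is defined: the matrix `δ^s_j + ε ω^{sp} T_{pjk} u^k_x` is
invertible at every point of the loop. -/
def deformationDomain (ω₀ : TwoTensor N M) (T : ThreeForm N M) (ε : ℝ) : Set (Loop N M) :=
  {γ | ∀ x : ℝ, IsUnit (deformationMatrix ω₀ T ε (γ x) (γ.velocity x))}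

end Deformation

end

end LoopPoisson

open Filter Topology
open scoped Manifold ContDiff

namespace LoopPoisson

noncomputable section

/-! ### Differentials of charts and of maps into the manifold -/

section Charts

variable {N : ℕ} {M : Type*} [TopologicalSpace M] [ChartedSpace (Coord N) M]
  [IsManifold (𝓡 N) ∞ M]

/-! Write τ for the matrix `T_{ijk} u^k_x`, so that `A = (1 + ε ω τ)⁻¹ ω`. If ω is invertible, then
`A⁻¹ = ω⁻¹ + ε τ`: the symplectic form of the loop space is changed by the transgression of T, a
2-form that is closed because T is. For degenerate ω the inverse is not available, but the same
mechanism survives in the identity `A = ω (1 - ε τ A)`. It says that the Hamiltonian vector field `A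
f` is also the ω-Hamiltonian field of the shifted covector `f - ε τ A f`.

Locally, differentiate this identity and use that ω and τ are skew (`fderiv_deformed_apply`). The
cyclic sum of the terms `f (∂A[Z]) g`, with `X = A f`, `Y = A g`, `Z = A h`, splits into the Jacobi
expression of ω at the shifted covectors, which vanishes, and ε times a cyclic sum of derivatives of
τ. Since `dT = 0`, the latter is the total x-derivative of `T(X, Y, Z)`
(`IsClosedThreeForm.fderiv_contractCoord_cyclic`), and its integral over the circle is zero.

Globally, functionals need not be local, and their derivatives are known only along
finite-dimensional families of loops. The Hamiltonian vector fields are therefore realized as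
parameter derivatives of a family, glued from chart perturbations with a partition of unity
(`IsFamily.exists_extension`). Along such a family a double bracket is the derivative of the
integral of a bracket density. The derivatives of the variational derivatives that occur there
cancel because the second variation is symmetric (`HasVariationalDeriv.second_variation_symm`); what
remains is the local computation (`sum_bracket_bracket_eq_zero`).

That a bracket again has a smooth variational derivative follows by the same device. Its derivative
in a direction δu is rewritten, by symmetry of the second variation and one integration by parts in
x, as the integral of an expression linear in the values of δu (`fderiv_bracket_density`,
`hasDerivAt_bracket_defect`). This gives a gradient near each parameter of each family. Gradients
are unique (`IsGradientAt.unique`), so these local ones define one covector field on the loop space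
(`exists_hasVariationalDeriv_bracket`).

The coefficients of the expansion are `Pₙ = ω (-τ ω)ⁿ`. Their Jacobi identity in order n is the same
argument with sums over the orders; `IsJacobiTriple` states the local input in a form that covers
both the operator at a fixed ε and the formal series. Convergence for small ε is the Neumann series.
-/

theorem exists_coframe_equiv {c p : M} (hp : p ∈ (chartAt (Coord N) c).source) :
    ∃ e : Tan N p ≃L[ℝ] Coord N, coframe (N := N) c p = e ∧ frame (N := N) c p = e.symm := by
  have : IsManifold (𝓡 N) 1 M := .of_le (n := ∞) (by simp)
  have h := (mdifferentiable_chart (I := 𝓡 N) c).mfderiv hp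
  refine ⟨(mdifferentiable_chart (I := 𝓡 N) c).mfderiv hp, rfl, ?_⟩
  exact ContinuousLinearMap.inverse_equiv ((mdifferentiable_chart (I := 𝓡 N) c).mfderiv hp)

theorem coframe_frame {c p : M} (hp : p ∈ (chartAt (Coord N) c).source) (w : Coord N) :
    coframe c p (frame c p w) = w := by
  obtain ⟨e, h, h'⟩ := exists_coframe_equiv (N := N) hp
  rw [h, h']; exact e.apply_symm_apply w

theorem frame_coframe {c p : M} (hp : p ∈ (chartAt (Coord N) c).source) (v : Tan N p) :
    frame c p (coframe c p v) = v := by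
  obtain ⟨e, h, h'⟩ := exists_coframe_equiv (N := N) hp
  rw [h, h']; exact e.symm_apply_apply v

theorem coframe_injective {c p : M} (hp : p ∈ (chartAt (Coord N) c).source) {v w : Tan N p}
    (h : coframe c p v = coframe c p w) : v = w := by
  rw [← frame_coframe hp v, h, frame_coframe hp w]

/-- The composition of a smooth map into `M` with a chart. -/
theorem coframe_mfderiv {F : Type*} [NormedAddCommGroup F] [NormedSpace ℝ F] {u : F → M} {e : F}
    (c : M) (hu : MDifferentiableAt 𝓘(ℝ, F) (𝓡 N) u e) (he : u e ∈ (chartAt (Coord N) c).source)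
    (v : F) :
    coframe c (u e) (mfderiv 𝓘(ℝ, F) (𝓡 N) u e v)
      = fderiv ℝ (fun z => chartAt (Coord N) c (u z)) e v := by
  have : IsManifold (𝓡 N) 1 M := .of_le (n := ∞) (by simp)
  have hc : MDifferentiableAt (𝓡 N) 𝓘(ℝ, Coord N) (chartAt (Coord N) c) (u e) :=
    mdifferentiableAt_atlas (chart_mem_atlas _ c) he
  have := mfderiv_comp e hc hu
  rw [mfderiv_eq_fderiv] at this
  exact (DFunLike.congr_fun this v).symm

end Charts

/-! ### Families of loops over normed parameter spaces, read in charts -/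

section Families

variable {N : ℕ} {M : Type*} [TopologicalSpace M] [ChartedSpace (Coord N) M]
variable {E : Type*} [NormedAddCommGroup E] [NormedSpace ℝ E]

/-- Smooth families of loops over an open subset of an arbitrary normed space. -/
structure IsFamily (W : Set E) (Θ : E → Loop N M) : Prop where
  isOpen : IsOpen W
  smooth : ContMDiffOn 𝓘(ℝ, E × ℝ) (𝓡 N) ∞
    (fun q : E × ℝ => Θ q.1 (q.2 : UnitAddCircle)) (W ×ˢ Set.univ)

/-- The part of the parameter space on which a family of loops stays in the chart around `c`. -/
def chartDom (W : Set E) (Θ : E → Loop N M) (c : M) : Set (E × ℝ) :=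
  {q | q.1 ∈ W ∧ Θ q.1 (q.2 : UnitAddCircle) ∈ (chartAt (Coord N) c).source}

/-- A family of loops in the chart around `c`. -/
def inCoord (Θ : E → Loop N M) (c : M) (q : E × ℝ) : Coord N :=
  chartAt (Coord N) c (Θ q.1 (q.2 : UnitAddCircle))

theorem IsFamily.isOpen_prod {W : Set E} {Θ : E → Loop N M} (h : IsFamily W Θ) :
    IsOpen (W ×ˢ (Set.univ : Set ℝ)) := h.isOpen.prod isOpen_univ

theorem IsFamily.isOpen_chartDom {W : Set E} {Θ : E → Loop N M} (h : IsFamily W Θ) (c : M) :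
    IsOpen (chartDom W Θ c) := by
  have := h.smooth.continuousOn.isOpen_inter_preimage h.isOpen_prod
    (chartAt (Coord N) c).open_source
  convert this using 1
  ext q; simp [chartDom]

theorem IsFamily.contMDiffAt {W : Set E} {Θ : E → Loop N M} (h : IsFamily W Θ) {q : E × ℝ}
    (hq : q.1 ∈ W) : ContMDiffAt 𝓘(ℝ, E × ℝ) (𝓡 N) ∞
      (fun q : E × ℝ => Θ q.1 (q.2 : UnitAddCircle)) q :=
  h.smooth.contMDiffAt (h.isOpen_prod.mem_nhds ⟨hq, trivial⟩)

theorem IsFamily.mono {W W' : Set E} {Θ : E → Loop N M} (h : IsFamily W Θ) (hW : IsOpen W')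
    (hs : W' ⊆ W) : IsFamily W' Θ :=
  ⟨hW, h.smooth.mono (Set.prod_mono hs subset_rfl)⟩

theorem IsFamily.comp {F : Type*} [NormedAddCommGroup F] [NormedSpace ℝ F]
    {W : Set E} {Θ : E → Loop N M} (h : IsFamily W Θ) {W' : Set F} (hW : IsOpen W') {L : F → E}
    (hL : ContDiff ℝ ∞ L) (hs : Set.MapsTo L W' W) : IsFamily W' (Θ ∘ L) := by
  refine ⟨hW, ?_⟩
  have h1 : ContMDiff 𝓘(ℝ, F × ℝ) 𝓘(ℝ, E × ℝ) ∞ (fun q : F × ℝ => (L q.1, q.2)) := by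
    rw [contMDiff_iff_contDiff]
    fun_prop
  exact h.smooth.comp h1.contMDiffOn (fun q hq => ⟨hs hq.1, trivial⟩)

theorem isFamily_const (γ : Loop N M) : IsFamily (Set.univ : Set E) (fun _ => γ) := by
  refine ⟨isOpen_univ, ?_⟩
  have h1 : ContMDiff 𝓘(ℝ, E × ℝ) 𝓘(ℝ, ℝ) ∞ (fun q : E × ℝ => q.2) := by
    rw [contMDiff_iff_contDiff]
    fun_prop
  exact (γ.smooth.comp h1).contMDiffOn

theorem isSmoothFamily_iff {V : Set (Loop N M)} {k : ℕ} {W : Set (Fin k → ℝ)}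
    {Γ : (Fin k → ℝ) → Loop N M} : IsSmoothFamily V W Γ ↔ IsFamily W Γ ∧ ∀ t ∈ W, Γ t ∈ V :=
  ⟨fun h => ⟨⟨h.isOpen, h.smooth⟩, h.mem⟩, fun h => ⟨h.1.isOpen, h.2, h.1.smooth⟩⟩

variable [IsManifold (𝓡 N) ∞ M]

theorem IsFamily.contDiffAt_inCoord {W : Set E} {Θ : E → Loop N M} (h : IsFamily W Θ) {c : M}
    {q : E × ℝ} (hq : q ∈ chartDom W Θ c) : ContDiffAt ℝ ∞ (inCoord Θ c) q := by
  rw [← contMDiffAt_iff_contDiffAt]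
  exact (contMDiffOn_chart.contMDiffAt
    ((chartAt (Coord N) c).open_source.mem_nhds hq.2)).comp q (h.contMDiffAt hq.1)

theorem IsFamily.coframe_velocity {W : Set E} {Θ : E → Loop N M} (h : IsFamily W Θ) {c : M}
    {q : E × ℝ} (hq : q ∈ chartDom W Θ c) :
    coframe c (Θ q.1 (q.2 : UnitAddCircle)) ((Θ q.1).velocity q.2)
      = fderiv ℝ (inCoord Θ c) q (0, 1) := by
  rw [Loop.velocity, coframe_mfderiv c ((Θ q.1).smooth.mdifferentiable (by simp) q.2) hq.2]
  have h1 := ((h.contDiffAt_inCoord hq).differentiableAt (by simp)).hasFDerivAt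
  have h2 : HasFDerivAt (fun y : ℝ => (q.1, y)) (ContinuousLinearMap.inr ℝ E ℝ) q.2 :=
    hasFDerivAt_prodMk_right q.1 q.2
  exact congrArg (fun L : ℝ →L[ℝ] Coord N => L 1) (h1.comp q.2 h2).fderiv

theorem IsFamily.coframe_mfderiv_param {W : Set E} {Θ : E → Loop N M} (h : IsFamily W Θ) {c : M}
    {q : E × ℝ} (hq : q ∈ chartDom W Θ c) (v : E) :
    coframe c (Θ q.1 (q.2 : UnitAddCircle))
        (mfderiv 𝓘(ℝ, E) (𝓡 N) (fun e => Θ e (q.2 : UnitAddCircle)) q.1 v)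
      = fderiv ℝ (inCoord Θ c) q (v, 0) := by
  have h0 : ContMDiffAt 𝓘(ℝ, E) 𝓘(ℝ, E × ℝ) ∞ (fun e : E => (e, q.2)) q.1 := by
    rw [contMDiffAt_iff_contDiffAt]
    fun_prop
  have hm : ContMDiffAt 𝓘(ℝ, E) (𝓡 N) ∞ (fun e => Θ e (q.2 : UnitAddCircle)) q.1 :=
    ContMDiffAt.comp (x := q.1) (g := fun q : E × ℝ => Θ q.1 (q.2 : UnitAddCircle))
      (f := fun e : E => (e, q.2)) (h.contMDiffAt hq.1) h0
  rw [coframe_mfderiv (u := fun e => Θ e (q.2 : UnitAddCircle)) c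
    (hm.mdifferentiableAt (by simp)) hq.2]
  have h1 := ((h.contDiffAt_inCoord hq).differentiableAt (by simp)).hasFDerivAt
  have h2 : HasFDerivAt (fun y : E => (y, q.2)) (ContinuousLinearMap.inl ℝ E ℝ) q.1 :=
    hasFDerivAt_prodMk_left q.1 q.2
  exact congrArg (fun L : E →L[ℝ] Coord N => L v) (h1.comp q.1 h2).fderiv

end Families

/-! ### The velocity as a function on the circle -/

section Velocity

variable {N : ℕ} {M : Type*} [TopologicalSpace M] [ChartedSpace (Coord N) M]

/-- The velocity as a function on the circle. -/
def Loop.vel (γ : Loop N M) (z : UnitAddCircle) : Tan N (γ z) :=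
  (γ.velocity (Function.surjInv QuotientAddGroup.mk_surjective z) : Coord N)

/-- The right-hand side involves only the point of the circle below x and the germ of the loop at x.
This removes the dependent type of the velocity and makes velocities at different lifts comparable.
-/
theorem Loop.velocity_eq_fderiv (γ : Loop N M) (x : ℝ) :
    (γ.velocity x : Coord N) = fderiv ℝ
      (fun y : ℝ => extChartAt (𝓡 N) (γ (x : UnitAddCircle)) (γ (y : UnitAddCircle))) x 1 := by
  have h : MDifferentiableAt 𝓘(ℝ, ℝ) (𝓡 N) (fun y : ℝ => γ (y : UnitAddCircle)) x :=
    γ.smooth.mdifferentiable (by simp) x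
  refine (congrArg (fun L : ℝ →L[ℝ] Coord N => L 1) h.mfderiv).trans ?_
  simp only [writtenInExtChartAt, mfld_simps, fderivWithin_univ]
  rfl

/-- Two lifts of a point of the circle differ by a period, and the lifted loop is invariant under
that translation. -/
theorem Loop.velocity_eq_of_coe_eq (γ : Loop N M) {x y : ℝ}
    (h : (x : UnitAddCircle) = (y : UnitAddCircle)) :
    (γ.velocity x : Coord N) = (γ.velocity y : Coord N) := by
  rw [γ.velocity_eq_fderiv x, γ.velocity_eq_fderiv y, h]
  have hx : x = y + (x - y) := by ring
  have hp (z : ℝ) : ((z + (x - y) : ℝ) : UnitAddCircle) = (z : UnitAddCircle) := by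
    rw [AddCircle.coe_add, AddCircle.coe_sub, h, sub_self, add_zero]
  conv_lhs => rw [hx]
  rw [← fderiv_comp_add_right]
  simp only [hp]
  rfl

theorem Loop.vel_coe (γ : Loop N M) (x : ℝ) : γ.vel (x : UnitAddCircle) = γ.velocity x :=
  γ.velocity_eq_of_coe_eq
    (Function.surjInv_eq QuotientAddGroup.mk_surjective (x : UnitAddCircle))

end Velocity

/-! ### Perturbing a family inside one chart -/

section Perturbation

variable {N : ℕ} {M : Type*} [TopologicalSpace M] [ChartedSpace (Coord N) M]
variable {E : Type*} [NormedAddCommGroup E] [NormedSpace ℝ E]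

theorem Loop.ext {γ γ' : Loop N M} (h : ∀ x, γ x = γ' x) : γ = γ' := by
  cases γ; cases γ'
  congr
  exact funext h

theorem Loop.continuous (γ : Loop N M) : Continuous γ.toFun :=
  (QuotientAddGroup.isOpenQuotientMap_mk (N := AddSubgroup.zmultiples (1 : ℝ))).isQuotientMap.continuous_iff.mpr
    γ.smooth.continuous

theorem exists_mem_Icc_coe (x : UnitAddCircle) : ∃ y ∈ Set.Icc (0 : ℝ) 1, (y : UnitAddCircle) = x :=
  ⟨AddCircle.equivIco 1 0 x, ⟨(AddCircle.equivIco 1 0 x).2.1, by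
    simpa using (AddCircle.equivIco (1 : ℝ) 0 x).2.2.le⟩, (AddCircle.equivIco 1 0).symm_apply_apply x⟩

/-- The tube lemma for the circle, in terms of a real coordinate. -/
theorem exists_open_tube {E : Type*} [TopologicalSpace E] {G : Set (E × ℝ)} (hG : IsOpen G)
    {K : Set UnitAddCircle} (hK : IsClosed K)
    {e₀ : E} (h : ∀ x : ℝ, (x : UnitAddCircle) ∈ K → (e₀, x) ∈ G) :
    ∃ u : Set E, IsOpen u ∧ e₀ ∈ u ∧
      ∀ e ∈ u, ∀ x ∈ K, ∃ y : ℝ, (y : UnitAddCircle) = x ∧ (e, y) ∈ G := by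
  have hc : IsCompact (Set.Icc (0 : ℝ) 1 ∩ (fun x : ℝ => (x : UnitAddCircle)) ⁻¹' K) :=
    isCompact_Icc.inter_right (hK.preimage (AddCircle.continuous_mk' 1))
  obtain ⟨u, v, hu, -, h1, h2, h3⟩ := generalized_tube_lemma isCompact_singleton hc hG
    (by rintro ⟨e, x⟩ ⟨he, hx⟩
        rw [Set.mem_singleton_iff] at he
        simp only at he
        subst he
        exact h x hx.2)
  refine ⟨u, hu, h1 rfl, fun e he x hx => ?_⟩
  obtain ⟨y, hy, rfl⟩ := exists_mem_Icc_coe x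
  exact ⟨y, rfl, h3 ⟨he, h2 ⟨hy, hx⟩⟩⟩

variable [IsManifold (𝓡 N) ∞ M]

open Classical in
/-- A family of loops can be perturbed, in a chart and for nearby parameters, by an arbitrary small
family of vectors which is supported where the loop stays in the chart. -/
theorem IsFamily.exists_perturbation {W : Set E} {Γ : E → Loop N M} (h : IsFamily W Γ) {e₀ : E}
    (he₀ : e₀ ∈ W) (c : M) {K : Set UnitAddCircle} (hK : IsClosed K)
    (hKc : ∀ x ∈ K, Γ e₀ x ∈ (chartAt (Coord N) c).source) {B : E → UnitAddCircle → Coord N}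
    (hB : ContDiffOn ℝ ∞ (fun q : E × ℝ => B q.1 (q.2 : UnitAddCircle)) (W ×ˢ Set.univ))
    (hB0 : B e₀ = 0) (hBK : ∀ e ∈ W, ∀ x ∉ K, B e x = 0) :
    ∃ (W' : Set E) (Γ' : E → Loop N M), W' ⊆ W ∧ e₀ ∈ W' ∧ IsFamily W' Γ' ∧
      (∀ e, B e = 0 → Γ' e = Γ e) ∧ (∀ e ∈ W', ∀ x ∉ K, Γ' e x = Γ e x) ∧
      ∀ e ∈ W', ∀ x ∈ K, Γ e x ∈ (chartAt (Coord N) c).source ∧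
        Γ' e x ∈ (chartAt (Coord N) c).source ∧
        chartAt (Coord N) c (Γ' e x) = chartAt (Coord N) c (Γ e x) + B e x := by
  set φ := chartAt (Coord N) c with hφ
  have hcd : ContDiffOn ℝ ∞ (fun q : E × ℝ => inCoord Γ c q + B q.1 (q.2 : UnitAddCircle))
      (chartDom W Γ c) := by
    refine ContDiffOn.add (fun q hq => (h.contDiffAt_inCoord hq).contDiffWithinAt) (hB.mono ?_)
    exact fun q hq => ⟨hq.1, trivial⟩
  have hG : IsOpen (chartDom W Γ c ∩
      (fun q : E × ℝ => inCoord Γ c q + B q.1 (q.2 : UnitAddCircle)) ⁻¹' φ.target) :=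
    hcd.continuousOn.isOpen_inter_preimage (h.isOpen_chartDom c) φ.open_target
  set G := chartDom W Γ c ∩
      (fun q : E × ℝ => inCoord Γ c q + B q.1 (q.2 : UnitAddCircle)) ⁻¹' φ.target with hGd
  -- At `e₀` the perturbation vanishes, so the perturbed coordinates lie in the chart over the
  -- compact set K. The tube lemma keeps them there, uniformly over K, for parameters near `e₀`.
  obtain ⟨u, hu, heu, hG'⟩ := exists_open_tube hG hK (e₀ := e₀) (by
    intro x hx
    refine ⟨⟨he₀, hKc _ hx⟩, ?_⟩
    simp only [Set.mem_preimage, hB0, Pi.zero_apply, add_zero]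
    exact φ.map_source (hKc _ hx))
  have hKG : ∀ e ∈ u, ∀ x ∈ K, Γ e x ∈ φ.source ∧ φ (Γ e x) + B e x ∈ φ.target := by
    intro e he x hx
    obtain ⟨y, rfl, hy⟩ := hG' e he x hx
    exact ⟨hy.1.2, hy.2⟩
  let F : E → UnitAddCircle → M := fun e x =>
    if x ∈ K then φ.symm (φ (Γ e x) + B e x) else Γ e x
  have hF : ContMDiffOn 𝓘(ℝ, E × ℝ) (𝓡 N) ∞ (fun q : E × ℝ => F q.1 (q.2 : UnitAddCircle))
      ((u ∩ W) ×ˢ Set.univ) := by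
    rintro ⟨e, x⟩ ⟨⟨heu, heW⟩, -⟩
    refine ContMDiffAt.contMDiffWithinAt ?_
    -- Near points over K the chart formula is valid on both sides of the boundary of K, because the
    -- perturbation is zero off K; over the open complement of K nothing has changed.
    by_cases hx : (x : UnitAddCircle) ∈ K
    · have hq : ((e, x) : E × ℝ) ∈ G := ⟨⟨heW, (hKG e heu x hx).1⟩, (hKG e heu x hx).2⟩
      have h1 := (hcd.contDiffAt ((h.isOpen_chartDom c).mem_nhds hq.1))
      rw [← contMDiffAt_iff_contDiffAt] at h1
      have hs : ContMDiffAt 𝓘(ℝ, Coord N) (𝓡 N) ∞ φ.symm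
          (inCoord Γ c (e, x) + B e (x : UnitAddCircle)) :=
        contMDiffOn_chart_symm.contMDiffAt (φ.open_target.mem_nhds hq.2)
      refine (hs.comp (e, x) h1).congr_of_eventuallyEq ?_
      filter_upwards [hG.mem_nhds hq] with q' hq'
      by_cases hx' : (q'.2 : UnitAddCircle) ∈ K
      · simp only [F, if_pos hx']; rfl
      · simp only [F, if_neg hx', Function.comp, hBK q'.1 hq'.1.1 _ hx', add_zero, inCoord]
        exact (φ.left_inv hq'.1.2).symm
    · refine (h.contMDiffAt (q := (e, x)) heW).congr_of_eventuallyEq ?_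
      have : ∀ᶠ q' : E × ℝ in 𝓝 (e, x), (q'.2 : UnitAddCircle) ∉ K :=
        (hK.isOpen_compl.preimage ((AddCircle.continuous_mk' 1).comp continuous_snd)).mem_nhds hx
      filter_upwards [this] with q' hq'
      simp only [F, if_neg hq']
  have hL : ∀ e ∈ u ∩ W, ContMDiff 𝓘(ℝ, ℝ) (𝓡 N) ∞ (fun x : ℝ => F e (x : UnitAddCircle)) := by
    intro e he
    have h1 : ContMDiff 𝓘(ℝ, ℝ) 𝓘(ℝ, E × ℝ) ∞ (fun x : ℝ => (e, x)) := by
      rw [contMDiff_iff_contDiff]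
      fun_prop
    rw [← contMDiffOn_univ] at h1 ⊢
    exact hF.comp h1 (fun x _ => ⟨he, trivial⟩)
  -- Outside the good parameters the old family is kept. The clause that `Γ' e = Γ e` whenever `B e
  -- = 0` then holds for every parameter.
  let Γ' : E → Loop N M := fun e => if he : e ∈ u ∩ W then ⟨F e, hL e he⟩ else Γ e
  have hΓ' : ∀ e ∈ u ∩ W, ∀ x, Γ' e x = F e x := by
    intro e he x
    simp only [Γ', dif_pos he]
  refine ⟨u ∩ W, Γ', Set.inter_subset_right, ⟨heu, he₀⟩, ⟨hu.inter h.isOpen, hF.congr ?_⟩,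
    ?_, ?_, ?_⟩
  · rintro q ⟨hq, -⟩
    exact hΓ' _ hq _
  · intro e hBe
    by_cases he : e ∈ u ∩ W
    · refine Loop.ext fun x => ?_
      rw [hΓ' e he]
      by_cases hx : x ∈ K
      · simp only [F, if_pos hx, hBe, Pi.zero_apply, add_zero]
        exact φ.left_inv (hKG e he.1 x hx).1
      · simp only [F, if_neg hx]
    · simp only [Γ', dif_neg he]
  · intro e he x hx
    rw [hΓ' e he]
    simp only [F, if_neg hx]
  · intro e he x hx
    obtain ⟨h1, h2⟩ := hKG e he.1 x hx
    rw [hΓ' e he]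
    simp only [F, if_pos hx]
    exact ⟨h1, φ.map_target h2, φ.right_inv h2⟩

end Perturbation

/-! ### Realizing vector fields along loops as parameter derivatives -/

section Extension

variable {N : ℕ} {M : Type*} [TopologicalSpace M] [ChartedSpace (Coord N) M]
  [IsManifold (𝓡 N) ∞ M]
variable {E : Type*} [NormedAddCommGroup E] [NormedSpace ℝ E]

theorem IsFamily.hasDerivAt_inCoord {W : Set E} {Θ : E → Loop N M} (h : IsFamily W Θ) {c : M}
    {e : E} {x : ℝ} (hq : (e, x) ∈ chartDom W Θ c) (v : E) :
    HasDerivAt (fun σ : ℝ => inCoord Θ c (e + σ • v, x))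
      (fderiv ℝ (inCoord Θ c) (e, x) (v, 0)) 0 := by
  have h1 := ((h.contDiffAt_inCoord hq).differentiableAt (by simp)).hasFDerivAt
  have h2 : HasDerivAt (fun σ : ℝ => (e + σ • v, x)) ((1 : ℝ) • v, (0 : ℝ)) 0 :=
    HasDerivAt.prodMk (((hasDerivAt_id (0 : ℝ)).smul_const v).const_add e) (hasDerivAt_const 0 x)
  rw [one_smul] at h2
  exact HasFDerivAt.comp_hasDerivAt_of_eq (0 : ℝ) h1 h2 (by simp)

theorem IsFamily.fderiv_inCoord_of_chart {W : Set E} {Θ : E → Loop N M} (h : IsFamily W Θ)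
    {c c' : M} {q : E × ℝ} (hq : q ∈ chartDom W Θ c) (hq' : q ∈ chartDom W Θ c') {p : M}
    (hp : Θ q.1 (q.2 : UnitAddCircle) = p) (ξ : Tan N p) {v : E}
    (hξ : fderiv ℝ (inCoord Θ c) q (v, 0) = coframe c p ξ) :
    fderiv ℝ (inCoord Θ c') q (v, 0) = coframe c' p ξ := by
  subst hp
  rw [← h.coframe_mfderiv_param hq] at hξ
  rw [← h.coframe_mfderiv_param hq', coframe_injective hq.2 hξ]

variable [T2Space M] [SecondCountableTopology M]

/-- Given vector fields along the loops of a family, the family can be extended by one more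
parameter for each of the fields, in such a way that the fields are the derivatives of the extended
family in the directions of the new parameters. -/
theorem IsFamily.exists_extension {ι : Type*} [Fintype ι] [DecidableEq ι] {W : Set E}
    {Γ : E → Loop N M} (h : IsFamily W Γ) {e₀ : E} (he₀ : e₀ ∈ W)
    (X : ι → ∀ (e : E) (x : UnitAddCircle), Tan N (Γ e x))
    (hX : ∀ (i : ι) (c : M), ContDiffOn ℝ ∞ (fun q : E × ℝ =>
      coframe c (Γ q.1 (q.2 : UnitAddCircle)) (X i q.1 (q.2 : UnitAddCircle))) (chartDom W Γ c)) :
    ∃ (W' : Set (E × (ι → ℝ))) (Θ : E × (ι → ℝ) → Loop N M), IsFamily W' Θ ∧ (e₀, 0) ∈ W' ∧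
      (∀ p ∈ W', p.1 ∈ W) ∧ (∀ e, Θ (e, 0) = Γ e) ∧
      ∀ (e : E) (x : ℝ) (c : M) (i : ι), (e, 0) ∈ W' →
        Γ e (x : UnitAddCircle) ∈ (chartAt (Coord N) c).source →
        fderiv ℝ (inCoord Θ c) ((e, 0), x) ((0, Pi.single i 1), 0)
          = coframe c (Γ e (x : UnitAddCircle)) (X i e (x : UnitAddCircle)) := by
  have : LocallyCompactSpace M := ChartedSpace.locallyCompactSpace (Coord N) M
  obtain ⟨ρ, hρ⟩ := SmoothPartitionOfUnity.exists_isSubordinate_chartAt_source (𝓡 N) M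
  classical
  -- Induction over the functions of the partition of unity. Each step perturbs in one chart and
  -- adds `ρ j • X i` to the derivative at the zero value of the new parameters.
  have key : ∀ s : Finset M, ∃ (W' : Set (E × (ι → ℝ))) (Θ : E × (ι → ℝ) → Loop N M),
      IsFamily W' Θ ∧ (e₀, 0) ∈ W' ∧
      (∀ p ∈ W', p.1 ∈ W) ∧ (∀ e, Θ (e, 0) = Γ e) ∧
      ∀ (e : E) (x : ℝ) (c : M) (i : ι), (e, 0) ∈ W' →
        Γ e (x : UnitAddCircle) ∈ (chartAt (Coord N) c).source →
        fderiv ℝ (inCoord Θ c) ((e, 0), x) ((0, Pi.single i 1), 0)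
          = coframe c (Γ e (x : UnitAddCircle))
              ((∑ j ∈ s, ρ j (Γ e₀ (x : UnitAddCircle))) • X i e (x : UnitAddCircle)) := by
    intro s
    induction s using Finset.induction_on with
    | empty =>
      refine ⟨Prod.fst ⁻¹' W, Γ ∘ Prod.fst, h.comp (h.isOpen.preimage continuous_fst)
        contDiff_fst (fun _ hp => hp), he₀, fun p hp => hp, fun e => rfl, ?_⟩
      intro e x c i he hx
      have hfam : IsFamily (Prod.fst ⁻¹' W) (Γ ∘ (Prod.fst : E × (ι → ℝ) → E)) :=
        h.comp (h.isOpen.preimage continuous_fst) contDiff_fst (fun _ hp => hp)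
      have h1 := hfam.hasDerivAt_inCoord (e := (e, 0)) (x := x) (c := c) ⟨he, hx⟩
        (0, Pi.single i 1)
      simp only [inCoord, Function.comp, Prod.smul_mk, smul_zero, Prod.mk_add_mk, add_zero] at h1
      have h2 := h1.unique (hasDerivAt_const _ _)
      simpa using h2
    | insert j s hj ih =>
      obtain ⟨W₁, Θ, hΘ, h0, hW₁, hΘ0, hd⟩ := ih
      set K : Set UnitAddCircle := (Γ e₀).toFun ⁻¹' tsupport (ρ j) with hKdef
      have hK : IsClosed K := (isClosed_tsupport _).preimage (Γ e₀).continuous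
      obtain ⟨u, hu, heu, hu'⟩ := exists_open_tube (h.isOpen_chartDom j) hK (e₀ := e₀)
        (fun x hx => ⟨he₀, hρ j hx⟩)
      have hu1 : ∀ e ∈ u, ∀ x ∈ K, Γ e x ∈ (chartAt (Coord N) j).source := by
        intro e he x hx
        obtain ⟨y, rfl, hy⟩ := hu' e he x hx
        exact hy.2
      have hW₂ : IsOpen (W₁ ∩ Prod.fst ⁻¹' u) := hΘ.isOpen.inter (hu.preimage continuous_fst)
      -- The cut-off is frozen at the loop `Γ e₀`, so its support K in the circle does not move with
      -- the parameter. The fields are taken along the original family, with which the perturbed one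
      -- agrees at `t = 0`; that is enough for the first derivative there.
      let B : E × (ι → ℝ) → UnitAddCircle → Coord N := fun p x =>
        ρ j (Γ e₀ x) • ∑ i, p.2 i • coframe j (Γ p.1 x) (X i p.1 x)
      have hρs : ContDiff ℝ ∞ (fun x : ℝ => ρ j (Γ e₀ (x : UnitAddCircle))) := by
        rw [← contMDiff_iff_contDiff]
        exact (ρ j).contMDiff.comp (Γ e₀).smooth
      have hχ0 : ∀ x ∉ K, ρ j (Γ e₀ x) = 0 := fun x hx =>
        image_eq_zero_of_notMem_tsupport (f := fun p => ρ j p) hx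
      have hB : ContDiffOn ℝ ∞ (fun q : (E × (ι → ℝ)) × ℝ => B q.1 (q.2 : UnitAddCircle))
          ((W₁ ∩ Prod.fst ⁻¹' u) ×ˢ Set.univ) := by
        rintro ⟨⟨e, t⟩, x⟩ ⟨⟨hp1, hp2⟩, -⟩
        refine ContDiffAt.contDiffWithinAt ?_
        by_cases hx : (x : UnitAddCircle) ∈ K
        · refine ContDiffAt.smul (hρs.contDiffAt.comp _ contDiffAt_snd)
            (ContDiffAt.sum fun i _ => ContDiffAt.smul (f := fun q : (E × (ι → ℝ)) × ℝ => q.1.2 i)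
              (by fun_prop) ?_)
          have h1 := (hX i j).contDiffAt
            ((h.isOpen_chartDom j).mem_nhds (⟨hW₁ _ hp1, hu1 e hp2 x hx⟩ : (e, x) ∈ chartDom W Γ j))
          exact h1.comp (((e, t), x) : (E × (ι → ℝ)) × ℝ)
            (f := fun q : (E × (ι → ℝ)) × ℝ => (q.1.1, q.2)) (by fun_prop)
        · have : ∀ᶠ q' : (E × (ι → ℝ)) × ℝ in 𝓝 ((e, t), x), (q'.2 : UnitAddCircle) ∉ K :=
            (hK.isOpen_compl.preimage
              ((AddCircle.continuous_mk' 1).comp continuous_snd)).mem_nhds hx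
          refine (contDiffAt_const (c := (0 : Coord N))).congr_of_eventuallyEq ?_
          filter_upwards [this] with q' hq'
          simp only [B, hχ0 _ hq', zero_smul]
      obtain ⟨W', Θ', hW', h0', hΘ', hB0, hoff, hon⟩ :=
        (hΘ.mono hW₂ Set.inter_subset_left).exists_perturbation (e₀ := (e₀, 0)) ⟨h0, heu⟩ j hK
          (by rw [hΘ0]; exact fun x hx => hρ j hx) hB
          (by ext1 x; simp [B]) (fun e _ x hx => by simp only [B, hχ0 _ hx, zero_smul])
      have hΘ'0 : ∀ e, Θ' (e, 0) = Γ e := fun e => by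
        rw [hB0 (e, 0) (by ext1 x; simp [B]), hΘ0]
      refine ⟨W', Θ', hΘ', h0', fun p hp => hW₁ p (hW' hp).1, hΘ'0, ?_⟩
      intro e x c i he hx
      have hev : ∀ᶠ σ : ℝ in 𝓝 0, ((e, 0) : E × (ι → ℝ)) + σ • (0, Pi.single i 1) ∈ W' := by
        have : Continuous fun σ : ℝ => ((e, 0) : E × (ι → ℝ)) + σ • (0, Pi.single i 1) := by
          fun_prop
        refine this.continuousAt.eventually (hΘ'.isOpen.mem_nhds ?_)
        simpa using he
      by_cases hxK : (x : UnitAddCircle) ∈ K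
      · obtain ⟨k1, k2, k3⟩ := hon _ he _ hxK
        refine hΘ'.fderiv_inCoord_of_chart (c := j) ⟨he, k2⟩ ⟨he, ?_⟩ ?_ _ ?_
        · change Θ' (e, 0) _ ∈ _
          rw [hΘ'0]; exact hx
        · change Θ' (e, 0) _ = _
          rw [hΘ'0]
        have d1 := hΘ'.hasDerivAt_inCoord (c := j) (e := (e, 0)) (x := x) ⟨he, k2⟩
          (0, Pi.single i 1)
        have d2 := hΘ.hasDerivAt_inCoord (c := j) (e := (e, 0)) (x := x) ⟨(hW' he).1, k1⟩
          (0, Pi.single i 1)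
        have d3 : HasDerivAt (fun σ : ℝ => σ • (ρ j (Γ e₀ (x : UnitAddCircle)) •
            coframe j (Γ e (x : UnitAddCircle)) (X i e (x : UnitAddCircle))))
            ((1 : ℝ) • (ρ j (Γ e₀ (x : UnitAddCircle)) •
              coframe j (Γ e (x : UnitAddCircle)) (X i e (x : UnitAddCircle)))) 0 :=
          (hasDerivAt_id (0 : ℝ)).smul_const _
        have d4 := d1.unique ((d2.add d3).congr_of_eventuallyEq (by
          filter_upwards [hev] with σ hσ
          rw [inCoord, (hon _ hσ _ hxK).2.2]
          simp only [inCoord, Pi.add_apply, B]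
          congr 1
          rw [Finset.sum_eq_single i (fun i' _ hi' => by simp [hi']) (by simp)]
          simp only [Prod.snd_add, Prod.smul_snd, Prod.fst_add, Prod.smul_fst,
            zero_add, Pi.smul_apply, Pi.single_eq_same, smul_eq_mul, mul_one]
          rw [smul_comm, show e + σ • (0 : E) = e by simp]
          rfl))
        rw [hΘ0] at k1
        rw [d4, hd e x j i (hW' he).1 k1, Finset.sum_insert hj, one_smul, ← map_smul, ← map_add,
          add_smul, add_comm]
      · have hx' : Θ (e, 0) (x : UnitAddCircle) ∈ (chartAt (Coord N) c).source := by
          rw [hΘ0]; exact hx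
        have hx'' : Θ' (e, 0) (x : UnitAddCircle) ∈ (chartAt (Coord N) c).source := by
          rw [hΘ'0]; exact hx
        have d1 := hΘ'.hasDerivAt_inCoord (c := c) (e := (e, 0)) (x := x) ⟨he, hx''⟩
          (0, Pi.single i 1)
        have d2 := hΘ.hasDerivAt_inCoord (c := c) (e := (e, 0)) (x := x) ⟨(hW' he).1, hx'⟩
          (0, Pi.single i 1)
        have d4 := d1.unique (d2.congr_of_eventuallyEq (by
          filter_upwards [hev] with σ hσ
          rw [inCoord, hoff _ hσ _ hxK]
          rfl))
        rw [d4, hd e x c i (hW' he).1 hx, Finset.sum_insert hj, hχ0 _ hxK, zero_add]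
  -- The image of `Γ e₀` is compact, so only finitely many functions of the partition matter on it,
  -- and there they add up to one.
  have hfin := ρ.locallyFinite.finite_nonempty_inter_compact (isCompact_range (Γ e₀).continuous)
  obtain ⟨W', Θ, h1, h2, h3, h4, h5⟩ := key hfin.toFinset
  refine ⟨W', Θ, h1, h2, h3, h4, fun e x c i he hx => ?_⟩
  rw [h5 e x c i he hx, ρ.sum_finsupport' _ (Set.mem_univ _), one_smul]
  intro j hj
  rw [ρ.mem_finsupport] at hj
  rw [Set.Finite.mem_toFinset]
  exact ⟨_, hj, Set.mem_range_self _⟩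

end Extension

/-! ### Integrals over the circle depending on parameters -/

section ParametricIntegral

variable {E : Type*} [NormedAddCommGroup E] [NormedSpace ℝ E]

theorem continuous_slice {E F : Type*} [TopologicalSpace E] [TopologicalSpace F] {b : E × ℝ → F} {e : E}
    (hb : ∀ x, ContinuousAt b (e, x)) : Continuous fun x : ℝ => b (e, x) :=
  continuous_iff_continuousAt.mpr fun x =>
    (hb x).comp (f := fun x : ℝ => (e, x)) (by fun_prop)

theorem continuous_fderiv_slice {W : Set E} {b : E × ℝ → ℝ}
    (hb : ∀ q : E × ℝ, q.1 ∈ W → ContDiffAt ℝ ∞ b q) {e : E} (he : e ∈ W) (w : E × ℝ) :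
    Continuous fun x : ℝ => fderiv ℝ b (e, x) w :=
  continuous_slice (b := fun q => fderiv ℝ b q w) fun x =>
    (((hb (e, x) he).fderiv_right (m := 0) (by simp)).continuousAt).clm_apply continuousAt_const

/-- The integral of a derivative along the circle vanishes. -/
theorem integral_fderiv_circle {W : Set E} {b : E × ℝ → ℝ}
    (hb : ∀ q : E × ℝ, q.1 ∈ W → ContDiffAt ℝ ∞ b q) {e : E} (he : e ∈ W)
    (hper : b (e, 1) = b (e, 0)) : ∫ x in (0 : ℝ)..1, fderiv ℝ b (e, x) (0, 1) = 0 := by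
  rw [intervalIntegral.integral_eq_sub_of_hasDerivAt (f := fun x => b (e, x)) (fun x _ => ?_)
    ((continuous_fderiv_slice hb he _).intervalIntegrable _ _), hper, sub_self]
  exact ((hb (e, x) he).differentiableAt (by simp)).hasFDerivAt.comp_hasDerivAt x
    ((hasDerivAt_const x e).prodMk (hasDerivAt_id x))

variable [FiniteDimensional ℝ E]

/-- Differentiation under the integral sign for smooth integrands. -/
theorem exists_hasFDerivAt_integral {W : Set E} (hW : IsOpen W) {b : E × ℝ → ℝ}
    (hb : ∀ q : E × ℝ, q.1 ∈ W → ContDiffAt ℝ ∞ b q) {e : E} (he : e ∈ W) :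
    ∃ L : E →L[ℝ] ℝ, HasFDerivAt (fun e => ∫ x in (0 : ℝ)..1, b (e, x)) L e ∧
      ∀ v, L v = ∫ x in (0 : ℝ)..1, fderiv ℝ b (e, x) (v, 0) := by
  let b' : E × ℝ → E →L[ℝ] ℝ := fun q => (fderiv ℝ b q).comp (ContinuousLinearMap.inl ℝ E ℝ)
  have hb' : ∀ q : E × ℝ, q.1 ∈ W → ContinuousAt b' q := fun q hq =>
    (((hb q hq).fderiv_right (m := 0) (by simp)).continuousAt).clm_comp continuousAt_const
  obtain ⟨r, hr, hrW⟩ := Metric.nhds_basis_closedBall.mem_iff.mp (hW.mem_nhds he)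
  have : ProperSpace E := FiniteDimensional.proper ℝ E
  have hK : IsCompact (Metric.closedBall e r ×ˢ Set.Icc (0 : ℝ) 1) :=
    (isCompact_closedBall e r).prod isCompact_Icc
  -- Compactness of a closed ball times `[0, 1]` supplies a constant dominating function for the
  -- derivative.
  obtain ⟨C, hC⟩ := hK.exists_bound_of_continuousOn
    (f := b') (fun q hq => (hb' q (hrW hq.1)).continuousWithinAt)
  have hcont : ∀ e ∈ W, Continuous fun x : ℝ => b (e, x) := fun e he =>
    continuous_slice fun x => (hb (e, x) he).continuousAt
  have hcont' : Continuous fun x : ℝ => b' (e, x) := continuous_slice fun x => hb' (e, x) he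
  refine ⟨∫ x in (0 : ℝ)..1, b' (e, x), ?_, fun v => ?_⟩
  · refine intervalIntegral.hasFDerivAt_integral_of_dominated_of_fderiv_le
      (F := fun e x => b (e, x)) (F' := fun e x => b' (e, x)) (bound := fun _ => C)
      (Metric.closedBall_mem_nhds e hr) ?_ ((hcont e he).intervalIntegrable _ _)
      hcont'.aestronglyMeasurable ?_ intervalIntegrable_const ?_
    · filter_upwards [hW.mem_nhds he] with e' he'
      exact (hcont e' he').aestronglyMeasurable
    · refine Eventually.of_forall fun x hx e' he' => hC (e', x) ⟨he', ?_⟩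
      rw [Set.uIoc_of_le zero_le_one] at hx
      exact Set.Ioc_subset_Icc_self hx
    · refine Eventually.of_forall fun x hx e' he' => ?_
      exact ((hb (e', x) (hrW he')).differentiableAt (by simp)).hasFDerivAt.comp e'
        (hasFDerivAt_prodMk_left e' x)
  · rw [ContinuousLinearMap.intervalIntegral_apply (hcont'.intervalIntegrable _ _)]
    rfl

theorem hasDerivAt_integral_line {W : Set E} (hW : IsOpen W) {b : E × ℝ → ℝ}
    (hb : ∀ q : E × ℝ, q.1 ∈ W → ContDiffAt ℝ ∞ b q) {e : E} (he : e ∈ W) (v : E) :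
    HasDerivAt (fun τ : ℝ => ∫ x in (0 : ℝ)..1, b (e + τ • v, x))
      (∫ x in (0 : ℝ)..1, fderiv ℝ b (e, x) (v, 0)) 0 := by
  obtain ⟨L, hL, hLv⟩ := exists_hasFDerivAt_integral hW hb he
  rw [← hLv v]
  have h2 : HasDerivAt (fun τ : ℝ => e + τ • v) ((1 : ℝ) • v) 0 :=
    ((hasDerivAt_id (0 : ℝ)).smul_const v).const_add e
  rw [one_smul] at h2
  exact HasFDerivAt.comp_hasDerivAt_of_eq (0 : ℝ) hL h2 (by simp)

end ParametricIntegral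

/-! ### Variational derivatives along families and the second variation -/

section Covectors

variable {N : ℕ} {M : Type*} [TopologicalSpace M] [ChartedSpace (Coord N) M]

/-- The components of a covector field in the chart around `c`. -/
def covCoord (f : CovectorField N M) (c : M) (γ : Loop N M) (x : UnitAddCircle) :
    Coord N →L[ℝ] ℝ :=
  LinearMap.toContinuousLinearMap (f γ x ∘ₗ (frame c (γ x)).toLinearMap : Coord N →ₗ[ℝ] ℝ)

theorem covCoord_apply (f : CovectorField N M) (c : M) (γ : Loop N M) (x : UnitAddCircle)
    (w : Coord N) : covCoord f c γ x w = f γ x (frame c (γ x) w) := rfl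

theorem covCoord_coframe [IsManifold (𝓡 N) ∞ M] (f : CovectorField N M) {c : M} {γ : Loop N M}
    {x : UnitAddCircle} (hx : γ x ∈ (chartAt (Coord N) c).source) (ξ : Tan N (γ x)) :
    covCoord f c γ x (coframe c (γ x) ξ) = f γ x ξ := by
  rw [covCoord_apply, frame_coframe hx]

variable {E : Type*} [NormedAddCommGroup E] [NormedSpace ℝ E]

/-- The pairing of a covector field with the derivative of a family in the direction `v`. -/
def pairing (f : CovectorField N M) (Θ : E → Loop N M) (v : E) (q : E × ℝ) : ℝ :=
  f (Θ q.1) (q.2 : UnitAddCircle)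
    (mfderiv 𝓘(ℝ, E) (𝓡 N) (fun e => Θ e (q.2 : UnitAddCircle)) q.1 v)

variable {V : Set (Loop N M)} {F : Loop N M → ℝ} {f : CovectorField N M}
  {W : Set E} {Θ : E → Loop N M}

theorem pairing_eventuallyEq [IsManifold (𝓡 N) ∞ M] (f : CovectorField N M) (h : IsFamily W Θ)
    {c : M} {q : E × ℝ} (hq : q ∈ chartDom W Θ c) (v : E) :
    pairing f Θ v =ᶠ[𝓝 q] fun q => covCoord f c (Θ q.1) (q.2 : UnitAddCircle)
      (fderiv ℝ (inCoord Θ c) q (v, 0)) := by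
  filter_upwards [(h.isOpen_chartDom c).mem_nhds hq] with q' hq'
  rw [← h.coframe_mfderiv_param hq', covCoord_coframe f hq'.2]
  rfl

variable [FiniteDimensional ℝ E]

/-- The definition of a variational derivative quantifies only over the parameter spaces `ℝᵏ`; a
linear isomorphism carries it to an arbitrary finite-dimensional parameter space. -/
theorem HasVariationalDeriv.contDiffAt_covCoord (hF : HasVariationalDeriv V F f)
    (h : IsFamily W Θ) (hV : ∀ e ∈ W, Θ e ∈ V) {c : M} {q : E × ℝ} (hq : q ∈ chartDom W Θ c) :
    ContDiffAt ℝ ∞ (fun q : E × ℝ => covCoord f c (Θ q.1) (q.2 : UnitAddCircle)) q := by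
  let L : (Fin (Module.finrank ℝ E) → ℝ) ≃L[ℝ] E := ContinuousLinearEquiv.ofFinrankEq (by simp)
  have hfam : IsSmoothFamily V (L ⁻¹' W) (Θ ∘ L) := isSmoothFamily_iff.mpr
    ⟨h.comp (h.isOpen.preimage L.continuous) L.contDiff (fun _ ht => ht), fun t ht => hV _ ht⟩
  suffices ContDiffOn ℝ ∞ (fun q : E × ℝ => covCoord f c (Θ q.1) (q.2 : UnitAddCircle))
      (chartDom W Θ c) from this.contDiffAt ((h.isOpen_chartDom c).mem_nhds hq)
  rw [contDiffOn_clm_apply]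
  intro w
  have h1 := hF.smooth _ _ _ hfam c w
  have h2 : ContDiff ℝ ∞ (fun q : E × ℝ => (L.symm q.1, q.2)) := by
    have := L.symm.contDiff (n := ∞)
    fun_prop
  have h3 := h1.comp h2.contDiffOn (s := chartDom W Θ c) (by
    rintro q ⟨hq1, hq2⟩
    simpa using And.intro hq1 hq2)
  refine h3.congr fun q _ => ?_
  have : L (L.symm q.1) = q.1 := L.apply_symm_apply _
  simp only [Function.comp]
  rw [this]
  rfl

theorem HasVariationalDeriv.contDiffAt_pairing [IsManifold (𝓡 N) ∞ M]
    (hF : HasVariationalDeriv V F f) (h : IsFamily W Θ) (hV : ∀ e ∈ W, Θ e ∈ V) (v : E)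
    (q : E × ℝ) (hq : q.1 ∈ W) : ContDiffAt ℝ ∞ (pairing f Θ v) q := by
  have hc : q ∈ chartDom W Θ (Θ q.1 (q.2 : UnitAddCircle)) := ⟨hq, mem_chart_source _ _⟩
  refine ContDiffAt.congr_of_eventuallyEq ?_ (pairing_eventuallyEq f h hc v)
  exact (hF.contDiffAt_covCoord h hV hc).clm_apply
    (((h.contDiffAt_inCoord hc).fderiv_right (m := ∞) (by simp)).clm_apply contDiffAt_const)

theorem HasVariationalDeriv.hasDerivAt_family [IsManifold (𝓡 N) ∞ M]
    (hF : HasVariationalDeriv V F f) (h : IsFamily W Θ) (hV : ∀ e ∈ W, Θ e ∈ V) {e : E}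
    (he : e ∈ W) (v : E) :
    HasDerivAt (fun τ : ℝ => F (Θ (e + τ • v))) (∫ x in (0 : ℝ)..1, pairing f Θ v (e, x)) 0 := by
  let L : (Fin (Module.finrank ℝ E) → ℝ) ≃L[ℝ] E := ContinuousLinearEquiv.ofFinrankEq (by simp)
  have hfamL := h.comp (h.isOpen.preimage L.continuous) L.contDiff (fun _ ht => ht)
  have hfam : IsSmoothFamily V (L ⁻¹' W) (Θ ∘ L) := isSmoothFamily_iff.mpr
    ⟨hfamL, fun t ht => hV _ ht⟩
  have h1 := hF.deriv _ _ _ hfam (L.symm e) (by simpa using he) (L.symm v)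
  have h2 : ∀ x : ℝ, f ((Θ ∘ L) (L.symm e)) (x : UnitAddCircle)
      (mfderiv 𝓘(ℝ, Fin (Module.finrank ℝ E) → ℝ) (𝓡 N)
        (fun t' => (Θ ∘ L) t' (x : UnitAddCircle)) (L.symm e) (L.symm v))
      = pairing f Θ v (e, x) := by
    intro x
    have hq : (e, x) ∈ chartDom W Θ (Θ e (x : UnitAddCircle)) := ⟨he, mem_chart_source _ _⟩
    have hq' : (L.symm e, x) ∈ chartDom (L ⁻¹' W) (Θ ∘ L) (Θ e (x : UnitAddCircle)) := by
      simpa [chartDom] using hq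
    have h3 := (pairing_eventuallyEq f hfamL hq' (L.symm v)).self_of_nhds
    rw [(pairing_eventuallyEq f h hq v).self_of_nhds]
    refine h3.trans ?_
    have h5 : HasFDerivAt (fun q : (Fin (Module.finrank ℝ E) → ℝ) × ℝ => (L q.1, q.2))
        ((L : (Fin (Module.finrank ℝ E) → ℝ) →L[ℝ] E).prodMap (ContinuousLinearMap.id ℝ ℝ))
        (L.symm e, x) :=
      ((L : (Fin (Module.finrank ℝ E) → ℝ) →L[ℝ] E).prodMap
        (ContinuousLinearMap.id ℝ ℝ)).hasFDerivAt
    have h4 := HasFDerivAt.comp (L.symm e, x)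
      (f := fun q : (Fin (Module.finrank ℝ E) → ℝ) × ℝ => (L q.1, q.2))
      (g := inCoord Θ (Θ e (x : UnitAddCircle)))
      (by
        rw [L.apply_symm_apply]
        exact ((h.contDiffAt_inCoord hq).differentiableAt (by simp)).hasFDerivAt) h5
    have h6 := h4.fderiv
    have h7 : fderiv ℝ (inCoord (Θ ∘ L) (Θ e (x : UnitAddCircle))) (L.symm e, x) (L.symm v, 0)
        = fderiv ℝ (inCoord Θ (Θ e (x : UnitAddCircle))) (e, x) (v, 0) := by
      refine (congrArg (fun A => A (L.symm v, 0)) h6).trans ?_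
      simp
    simp only [Function.comp, L.apply_symm_apply] at h7 ⊢
    exact congrArg _ h7
  rw [intervalIntegral.integral_congr (fun x _ => h2 x)] at h1
  simpa only [Function.comp, map_add, map_smul, L.apply_symm_apply] using h1

/-- The second variation is symmetric. -/
theorem HasVariationalDeriv.second_variation_symm [IsManifold (𝓡 N) ∞ M]
    (hF : HasVariationalDeriv V F f) (h : IsFamily W Θ) (hV : ∀ e ∈ W, Θ e ∈ V) {e : E}
    (he : e ∈ W) (v w : E) :
    ∫ x in (0 : ℝ)..1, fderiv ℝ (pairing f Θ v) (e, x) (w, 0)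
      = ∫ x in (0 : ℝ)..1, fderiv ℝ (pairing f Θ w) (e, x) (v, 0) := by
  let ℓ : ℝ × ℝ → E := fun a => e + a.1 • v + a.2 • w
  have hℓ : ∀ a, HasFDerivAt ℓ ((ContinuousLinearMap.fst ℝ ℝ ℝ).smulRight v
      + (ContinuousLinearMap.snd ℝ ℝ ℝ).smulRight w) a := fun a =>
    ((hasFDerivAt_fst.smul_const v).const_add e).add (hasFDerivAt_snd.smul_const w)
  have hℓ0 : ℓ (0, 0) = e := by simp [ℓ]
  have hℓW : ∀ᶠ a in 𝓝 ((0, 0) : ℝ × ℝ), ℓ a ∈ W :=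
    (hℓ (0, 0)).continuousAt.eventually (h.isOpen.mem_nhds (hℓ0.symm ▸ he))
  let B : E → E → ℝ := fun u e => ∫ x in (0 : ℝ)..1, pairing f Θ u (e, x)
  have hB := fun (u : E) (e : E) (he : e ∈ W) => exists_hasFDerivAt_integral h.isOpen
    (fun q hq => hF.contDiffAt_pairing h hV u q hq) he
  let f₁ : ℝ → ℝ → ℝ →L[ℝ] ℝ := fun a b => ContinuousLinearMap.toSpanSingleton ℝ (B v (ℓ (a, b)))
  let f₂ : ℝ → ℝ → ℝ →L[ℝ] ℝ := fun a b => ContinuousLinearMap.toSpanSingleton ℝ (B w (ℓ (a, b)))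
  have hBd : ∀ u, ∀ a, ℓ a ∈ W → DifferentiableAt ℝ (fun a => B u (ℓ a)) a := by
    intro u a ha
    obtain ⟨L, hL, -⟩ := hB u _ ha
    exact (hL.comp a (hℓ a)).differentiableAt
  -- Only derivatives along lines are given. On the plane spanned by v and w the two partial
  -- derivatives are continuous, which gives a Fréchet derivative; this derivative is itself
  -- differentiable at the origin, and symmetry of the second derivative applies.
  have hfd : ∀ a, ℓ a ∈ W → HasFDerivAt (fun a => F (Θ (ℓ a)))
      ((f₁ a.1 a.2).coprod (f₂ a.1 a.2)) a := by
    intro a ha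
    have hev : ∀ᶠ a' in 𝓝 a, ℓ a' ∈ W := (hℓ a).continuousAt.eventually (h.isOpen.mem_nhds ha)
    have hshift : ∀ (u : E) (t : ℝ) (e' : E), e' ∈ W → ∀ (p : ℝ → E),
        (∀ s, p s = e' + (s - t) • u) → HasDerivAt (fun s => F (Θ (p s))) (B u e') t := by
      intro u t e' he' p hp
      have h1 := hF.hasDerivAt_family h hV he' u
      have h2 : HasDerivAt (fun s : ℝ => s - t) 1 t := (hasDerivAt_id t).sub_const t
      have h3 := HasDerivAt.comp_of_eq t h1 h2 (by simp)
      rw [mul_one] at h3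
      refine h3.congr_of_eventuallyEq (Eventually.of_forall fun s => ?_)
      simp [hp]
    refine (hasStrictFDerivAt_uncurry_coprod (f := fun a b => F (Θ (ℓ (a, b))))
      (f₁ := f₁) (f₂ := f₂) (u := a) ?_ ?_ ?_ ?_).hasFDerivAt
    · filter_upwards [hev] with a' ha'
      refine (hshift v a'.1 (ℓ a') ha' (fun s => ℓ (s, a'.2)) fun s => ?_).hasFDerivAt
      simp only [ℓ, sub_smul]; abel
    · filter_upwards [hev] with a' ha'
      refine (hshift w a'.2 (ℓ a') ha' (fun s => ℓ (a'.1, s)) fun s => ?_).hasFDerivAt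
      simp only [ℓ, sub_smul]; abel
    · exact (ContinuousLinearMap.toSpanSingletonCLE (𝕜 := ℝ) (E := ℝ)).continuous.continuousAt.comp
        (f := fun a => B v (ℓ a)) (hBd v a ha).continuousAt
    · exact (ContinuousLinearMap.toSpanSingletonCLE (𝕜 := ℝ) (E := ℝ)).continuous.continuousAt.comp
        (f := fun a => B w (ℓ a)) (hBd w a ha).continuousAt
  obtain ⟨Lv, hLv, hLv'⟩ := hB v e he
  obtain ⟨Lw, hLw, hLw'⟩ := hB w e he
  rw [← hℓ0] at hLv hLw
  have hBv := hLv.comp (0, 0) (hℓ (0, 0))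
  have hBw := hLw.comp (0, 0) (hℓ (0, 0))
  have hd := (hBv.smul_const (ContinuousLinearMap.fst ℝ ℝ ℝ)).add
    (hBw.smul_const (ContinuousLinearMap.snd ℝ ℝ ℝ))
  have hsym := second_derivative_symmetric_of_eventually_of_real (f := fun a => F (Θ (ℓ a)))
    (by
      filter_upwards [hℓW] with a ha
      refine (hfd a ha).congr_fderiv ?_
      ext <;> simp [f₁, f₂, B]) hd (0, 1) (1, 0)
  rw [← hLv' w, ← hLw' v]
  simpa using hsym

end Covectors

/-! ### Pointwise calculus for the derivative of a bracket density -/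

section LocalIdentity

variable {G C : Type*} [NormedAddCommGroup G] [NormedSpace ℝ G] [NormedAddCommGroup C]
  [NormedSpace ℝ C]

theorem fderiv_fderiv_apply {F : Type*} [NormedAddCommGroup F] [NormedSpace ℝ F] {U : G → F} {q : G}
    (hU : ContDiffAt ℝ ∞ U q) (a b : G) :
    fderiv ℝ (fun q => fderiv ℝ U q a) q b = fderiv ℝ (fderiv ℝ U) q b a := by
  have h : DifferentiableAt ℝ (fderiv ℝ U) q :=
    (hU.fderiv_right (m := ∞) (by simp)).differentiableAt (by simp)
  rw [fderiv_clm_apply h (differentiableAt_const a)]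
  simp

theorem fderiv_fderiv_comm {F : Type*} [NormedAddCommGroup F] [NormedSpace ℝ F] {U : G → F} {q : G}
    (hU : ContDiffAt ℝ ∞ U q) (a b : G) :
    fderiv ℝ (fun q => fderiv ℝ U q a) q b = fderiv ℝ (fun q => fderiv ℝ U q b) q a := by
  rw [fderiv_fderiv_apply hU, fderiv_fderiv_apply hU]
  exact (hU.isSymmSndFDerivAt (by
    simp only [minSmoothness_of_isRCLikeNormedField]
    exact WithTop.coe_le_coe.2 (le_top : (2 : ℕ∞) ≤ ⊤))).eq b a

theorem contDiffAt_fderiv_apply {F : Type*} [NormedAddCommGroup F] [NormedSpace ℝ F] {U : G → F}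
    {q : G} (hU : ContDiffAt ℝ ∞ U q) (a : G) : ContDiffAt ℝ ∞ (fun q => fderiv ℝ U q a) q :=
  (hU.fderiv_right (m := ∞) (by simp)).clm_apply contDiffAt_const

theorem fderiv_pairing_apply {F F' : Type*} [NormedAddCommGroup F] [NormedSpace ℝ F]
    [NormedAddCommGroup F'] [NormedSpace ℝ F'] {A : G → F →L[ℝ] F'} {u : G → F}
    {q : G} (hA : ContDiffAt ℝ ∞ A q) (hu : ContDiffAt ℝ ∞ u q) (w : G) :
    fderiv ℝ (fun q => A q (u q)) q w = fderiv ℝ A q w (u q) + A q (fderiv ℝ u q w) := by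
  rw [fderiv_clm_apply (hA.differentiableAt (by simp)) (hu.differentiableAt (by simp))]
  simp [add_comm]

/-- The one-jet of `U` in the direction `ξ`. -/
def jet (U : G → C) (ξ : G) (q : G) : C × C := (U q, fderiv ℝ U q ξ)

theorem contDiffAt_jet {U : G → C} {q : G} (hU : ContDiffAt ℝ ∞ U q) (ξ : G) :
    ContDiffAt ℝ ∞ (jet U ξ) q := hU.prodMk (contDiffAt_fderiv_apply hU ξ)

theorem fderiv_jet {U : G → C} {q : G} (hU : ContDiffAt ℝ ∞ U q) (ξ w : G) :
    fderiv ℝ (jet U ξ) q w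
      = (fderiv ℝ U q w, fderiv ℝ (fun q => fderiv ℝ U q w) q ξ) := by
  have h1 := (hU.differentiableAt (by simp)).hasFDerivAt
  have h2 := ((contDiffAt_fderiv_apply hU ξ).differentiableAt (by simp)).hasFDerivAt
  rw [show jet U ξ = fun q => (U q, fderiv ℝ U q ξ) from rfl, (h1.prodMk h2).fderiv,
    ← fderiv_fderiv_comm hU]
  rfl

/-- The covector `w ↦ f (∂P/∂v [w]) g`. -/
def vertForm (f : C →L[ℝ] ℝ) (P' : C × C →L[ℝ] (C →L[ℝ] ℝ) →L[ℝ] C) (g : C →L[ℝ] ℝ) : C →L[ℝ] ℝ :=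
  f.comp ((P'.flip g).comp (ContinuousLinearMap.inr ℝ C C))

theorem vertForm_apply (f : C →L[ℝ] ℝ) (P' : C × C →L[ℝ] (C →L[ℝ] ℝ) →L[ℝ] C) (g : C →L[ℝ] ℝ)
    (w : C) : vertForm f P' g w = f (P' (0, w) g) := rfl

set_option maxSynthPendingDepth 5 in
theorem contDiffAt_vertForm {f g : G → C →L[ℝ] ℝ} {P : C × C → (C →L[ℝ] ℝ) →L[ℝ] C} {j : G → C × C}
    {q : G} (hf : ContDiffAt ℝ ∞ f q) (hg : ContDiffAt ℝ ∞ g q) (hj : ContDiffAt ℝ ∞ j q)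
    (hP : ContDiffAt ℝ ∞ P (j q)) :
    ContDiffAt ℝ ∞ (fun q => vertForm (f q) (fderiv ℝ P (j q)) (g q)) q := by
  have h1 : ContDiffAt ℝ ∞ (fun q => fderiv ℝ P (j q)) q :=
    (hP.fderiv_right (m := ∞) (by simp)).comp q hj
  have h2 : ContDiffAt ℝ ∞ (fun q => (fderiv ℝ P (j q)).flip) q :=
    (ContinuousLinearMap.flipₗᵢ ℝ (C × C) (C →L[ℝ] ℝ) C).contDiff.contDiffAt.comp q h1
  exact hf.clm_comp ((h2.clm_apply hg).clm_comp contDiffAt_const)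

/-- The derivative of `f (P(u, u_ξ)) g` in the direction `τ`, up to antisymmetrized second
variations and a derivative in the direction `ξ`, is an expression which depends on `τ` only through
the value of `∂u/∂τ`. -/
theorem fderiv_bracket_density {U : G → C} {f g : G → C →L[ℝ] ℝ}
    {P : C × C → (C →L[ℝ] ℝ) →L[ℝ] C} {q : G} (ξ r s τ : G) (hU : ContDiffAt ℝ ∞ U q)
    (hf : ContDiffAt ℝ ∞ f q) (hg : ContDiffAt ℝ ∞ g q) (hP : ContDiffAt ℝ ∞ P (jet U ξ q))
    (hskew : ∀ a b : C →L[ℝ] ℝ, a (P (jet U ξ q) b) = -b (P (jet U ξ q) a))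
    (hr : fderiv ℝ U q r = P (jet U ξ q) (f q)) (hs : fderiv ℝ U q s = P (jet U ξ q) (g q)) :
    fderiv ℝ (fun q => f q (P (jet U ξ q) (g q))) q τ
      - (fderiv ℝ (fun q => f q (fderiv ℝ U q s)) q τ
        - fderiv ℝ (fun q => f q (fderiv ℝ U q τ)) q s)
      + (fderiv ℝ (fun q => g q (fderiv ℝ U q r)) q τ
        - fderiv ℝ (fun q => g q (fderiv ℝ U q τ)) q r)
      - fderiv ℝ (fun q => vertForm (f q) (fderiv ℝ P (jet U ξ q)) (g q) (fderiv ℝ U q τ)) q ξ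
    = fderiv ℝ f q s (fderiv ℝ U q τ) - fderiv ℝ g q r (fderiv ℝ U q τ)
      + f q (fderiv ℝ P (jet U ξ q) (fderiv ℝ U q τ, 0) (g q))
      - fderiv ℝ (fun q => vertForm (f q) (fderiv ℝ P (jet U ξ q)) (g q)) q ξ (fderiv ℝ U q τ) := by
  have hj := contDiffAt_jet hU ξ
  have hPj : ContDiffAt ℝ ∞ (fun q => P (jet U ξ q)) q := hP.comp q hj
  have hdP : fderiv ℝ (fun q => P (jet U ξ q)) q τ
      = fderiv ℝ P (jet U ξ q) (fderiv ℝ (jet U ξ) q τ) := by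
    have := fderiv_comp q (hP.differentiableAt (by simp)) (hj.differentiableAt (by simp))
    exact congrArg (fun L => L τ) this
  rw [fderiv_pairing_apply hf (hPj.clm_apply hg), fderiv_pairing_apply hPj hg,
    fderiv_pairing_apply hf (contDiffAt_fderiv_apply hU s),
    fderiv_pairing_apply hf (contDiffAt_fderiv_apply hU τ),
    fderiv_pairing_apply hg (contDiffAt_fderiv_apply hU r),
    fderiv_pairing_apply hg (contDiffAt_fderiv_apply hU τ),
    fderiv_pairing_apply (contDiffAt_vertForm hf hg hj hP) (contDiffAt_fderiv_apply hU τ),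
    hdP, fderiv_jet hU, fderiv_fderiv_comm hU s τ, fderiv_fderiv_comm hU r τ, hr, hs,
    vertForm_apply]
  have h1 : fderiv ℝ P (jet U ξ q) (fderiv ℝ U q τ, fderiv ℝ (fun q => fderiv ℝ U q τ) q ξ)
      = fderiv ℝ P (jet U ξ q) (fderiv ℝ U q τ, 0)
        + fderiv ℝ P (jet U ξ q) (0, fderiv ℝ (fun q => fderiv ℝ U q τ) q ξ) := by
    rw [← map_add]; simp
  -- Skew-symmetry moves the derivative of g to the front, where it is paired with `P f`, the
  -- derivative of U in the direction r.
  rw [h1, map_add, add_apply, map_add, hskew (f q) (fderiv ℝ g q τ)]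
  ring

end LocalIdentity

/-! ### Matrix operators and bracket densities in charts -/

section Operators

variable {N : ℕ} {M : Type*} [TopologicalSpace M] [ChartedSpace (Coord N) M]

/-- A matrix operator in the chart around `c`. -/
def opCoord (P : MatrixOperator N M) (c : M) (z : Coord N × Coord N) :
    (Coord N →L[ℝ] ℝ) →L[ℝ] Coord N :=
  LinearMap.toContinuousLinearMap
    { toFun := fun a =>
        coframe c ((chartAt (Coord N) c).symm z.1) (P ((chartAt (Coord N) c).symm z.1)
          (frame c ((chartAt (Coord N) c).symm z.1) z.2)
          (coordCovector c ((chartAt (Coord N) c).symm z.1) a.toLinearMap))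
      map_add' := fun a b => by
        rw [← map_add, ← map_add]; rfl
      map_smul' := fun r a => by
        rw [← map_smul, RingHom.id_apply, ← map_smul]; rfl }

/-- The domain in the chart around `c` of operators that are defined for velocities in `O`. -/
def opDom (O : ∀ p : M, Set (Tan N p)) (c : M) : Set (Coord N × Coord N) :=
  {z | z.1 ∈ (chartAt (Coord N) c).target ∧
    frame c ((chartAt (Coord N) c).symm z.1) z.2 ∈ O ((chartAt (Coord N) c).symm z.1)}

/-- Matrix operators that are smooth and skew-symmetric for velocities in the open set `O`. -/
structure IsSmoothSkewOn (O : ∀ p : M, Set (Tan N p)) (P : MatrixOperator N M) : Prop where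
  skew : ∀ (p : M), ∀ v ∈ O p, ∀ α β : Cotan N p, α (P p v β) = -β (P p v α)
  isOpen : ∀ c : M, IsOpen (opDom O c)
  smooth : ∀ c : M, ContDiffOn ℝ ∞ (opCoord P c) (opDom O c)

/-- The density of the bracket. -/
def density (P : MatrixOperator N M) (f g : CovectorField N M) (γ : Loop N M)
    (x : UnitAddCircle) : ℝ :=
  f γ x (P (γ x) (γ.vel x) (g γ x))

theorem bracket_eq_integral_density (P : MatrixOperator N M) (f g : CovectorField N M)
    (γ : Loop N M) : bracket P f g γ = ∫ x in (0 : ℝ)..1, density P f g γ (x : UnitAddCircle) := by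
  simp only [bracket, density, Loop.vel_coe]

/-- The derivative of the density of the bracket in the direction of the velocity. -/
def vertDensity (P : MatrixOperator N M) (f g : CovectorField N M) (γ : Loop N M)
    (x : UnitAddCircle) (ξ : Tan N (γ x)) : ℝ :=
  deriv (fun σ : ℝ => f γ x (P (γ x) (γ.vel x + σ • ξ) (g γ x))) 0

variable [IsManifold (𝓡 N) ∞ M]

theorem opCoord_coframe (P : MatrixOperator N M) {c p : M}
    (hp : p ∈ (chartAt (Coord N) c).source) (v : Tan N p) (α : Cotan N p) (a : Coord N →L[ℝ] ℝ)
    (ha : ∀ w, a w = α (frame c p w)) :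
    opCoord P c (chartAt (Coord N) c p, coframe c p v) a = coframe c p (P p v α) := by
  have h1 : coordCovector c p a.toLinearMap = α := by
    ext ξ
    change a (coframe c p ξ) = α ξ
    rw [ha, frame_coframe hp]
  change coframe c ((chartAt (Coord N) c).symm (chartAt (Coord N) c p)) (P _ (frame c _ _)
    (coordCovector c _ a.toLinearMap)) = _
  rw [(chartAt (Coord N) c).left_inv hp, frame_coframe hp, h1]

theorem mem_opDom {O : ∀ p : M, Set (Tan N p)} {c p : M}
    (hp : p ∈ (chartAt (Coord N) c).source) {v : Tan N p} (hv : v ∈ O p) :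
    (chartAt (Coord N) c p, coframe c p v) ∈ opDom O c := by
  refine ⟨(chartAt (Coord N) c).map_source hp, ?_⟩
  change frame c ((chartAt (Coord N) c).symm (chartAt (Coord N) c p)) (coframe c p v) ∈ O _
  rw [(chartAt (Coord N) c).left_inv hp, frame_coframe hp]
  exact hv

variable {P : MatrixOperator N M} {O : ∀ p : M, Set (Tan N p)} {f g : CovectorField N M}

theorem density_eq (P : MatrixOperator N M) (f g : CovectorField N M) {c : M} {γ : Loop N M}
    {x : UnitAddCircle} (hx : γ x ∈ (chartAt (Coord N) c).source) :
    density P f g γ x = covCoord f c γ x (opCoord P c (chartAt (Coord N) c (γ x),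
      coframe c (γ x) (γ.vel x)) (covCoord g c γ x)) := by
  rw [opCoord_coframe P hx _ (g γ x) (covCoord g c γ x) (fun w => rfl), covCoord_coframe f hx]
  rfl

theorem opCoord_skew {P : MatrixOperator N M} {c p : M}
    (hp : p ∈ (chartAt (Coord N) c).source) {v : Tan N p}
    (h : ∀ α β : Cotan N p, α (P p v β) = -β (P p v α)) (a b : Coord N →L[ℝ] ℝ) :
    a (opCoord P c (chartAt (Coord N) c p, coframe c p v) b)
      = -b (opCoord P c (chartAt (Coord N) c p, coframe c p v) a) := by
  have key : ∀ a : Coord N →L[ℝ] ℝ, ∀ w,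
      a w = (a.toLinearMap ∘ₗ (coframe c p).toLinearMap : Cotan N p) (frame c p w) := fun a w => by
    change a w = a (coframe c p (frame c p w))
    rw [coframe_frame hp]
  rw [opCoord_coframe P hp v _ b (key b), opCoord_coframe P hp v _ a (key a)]
  exact h (a.toLinearMap ∘ₗ (coframe c p).toLinearMap : Cotan N p)
    (b.toLinearMap ∘ₗ (coframe c p).toLinearMap : Cotan N p)

/-- Velocities at a fixed point transform linearly, so the velocity derivative has a meaning
independent of charts. The intrinsic form makes it a single function on the circle, whose
x-derivative integrates to zero; the chart form serves to differentiate it. -/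
theorem IsSmoothSkewOn.vertDensity_eq (hP : IsSmoothSkewOn O P) (f g : CovectorField N M) {c : M}
    {γ : Loop N M} {x : UnitAddCircle} (hx : γ x ∈ (chartAt (Coord N) c).source)
    (hv : γ.vel x ∈ O (γ x)) (ξ : Tan N (γ x)) :
    vertDensity P f g γ x ξ = vertForm (covCoord f c γ x)
      (fderiv ℝ (opCoord P c) (chartAt (Coord N) c (γ x), coframe c (γ x) (γ.vel x)))
      (covCoord g c γ x) (coframe c (γ x) ξ) := by
  have h1 : ∀ σ : ℝ, f γ x (P (γ x) (γ.vel x + σ • ξ) (g γ x))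
      = covCoord f c γ x (opCoord P c ((chartAt (Coord N) c (γ x),
        coframe c (γ x) (γ.vel x)) + σ • ((0 : Coord N), coframe c (γ x) ξ))
        (covCoord g c γ x)) := fun σ => by
    rw [← covCoord_coframe f hx, ← opCoord_coframe P hx _ (g γ x) (covCoord g c γ x) (fun w => rfl)]
    simp only [map_add, map_smul, Prod.smul_mk, smul_zero, Prod.mk_add_mk, add_zero]
  have h2 := ((hP.smooth c).contDiffAt ((hP.isOpen c).mem_nhds (mem_opDom hx hv))).differentiableAt
    (by simp)
  have h3 : HasDerivAt (fun σ : ℝ => ((chartAt (Coord N) c (γ x), coframe c (γ x) (γ.vel x))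
      : Coord N × Coord N) + σ • ((0 : Coord N), coframe c (γ x) ξ))
      ((1 : ℝ) • ((0 : Coord N), coframe c (γ x) ξ)) 0 :=
    ((hasDerivAt_id (0 : ℝ)).smul_const _).const_add _
  rw [one_smul] at h3
  have h4 := HasFDerivAt.comp_hasDerivAt_of_eq (0 : ℝ) h2.hasFDerivAt h3 (by simp)
  have h5 := (covCoord f c γ x).hasFDerivAt.comp_hasDerivAt (0 : ℝ)
    (h4.clm_apply (hasDerivAt_const (0 : ℝ) (covCoord g c γ x)))
  rw [vertDensity, funext h1]
  refine h5.deriv.trans ?_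
  simp [vertForm_apply]

end Operators

/-! ### Derivatives of functions on the circle and along lines -/

section CircleDerivative

variable {F : Type*} [NormedAddCommGroup F] [NormedSpace ℝ F]

/-- The derivative of a function on the circle. -/
def circDeriv (u : UnitAddCircle → F) (z : UnitAddCircle) : F :=
  deriv (fun y : ℝ => u (y : UnitAddCircle)) (Function.surjInv QuotientAddGroup.mk_surjective z)

theorem circDeriv_coe (u : UnitAddCircle → F) (x : ℝ) :
    circDeriv u (x : UnitAddCircle) = deriv (fun y : ℝ => u (y : UnitAddCircle)) x := by
  set y : ℝ := Function.surjInv QuotientAddGroup.mk_surjective (x : UnitAddCircle) with hy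
  have h : (y : UnitAddCircle) = (x : UnitAddCircle) :=
    Function.surjInv_eq QuotientAddGroup.mk_surjective (x : UnitAddCircle)
  have hp (z : ℝ) : ((z + (y - x) : ℝ) : UnitAddCircle) = (z : UnitAddCircle) := by
    rw [AddCircle.coe_add, AddCircle.coe_sub, h, sub_self, add_zero]
  have hyx : y = x + (y - x) := by ring
  rw [circDeriv, ← hy, hyx, ← deriv_comp_add_const]
  simp only [hp]

end CircleDerivative

section Lines

theorem deriv_line_eq {E F : Type*} [NormedAddCommGroup E] [NormedSpace ℝ E] [NormedAddCommGroup F] [NormedSpace ℝ F] {u : E × ℝ → F} {e : E}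
    {x : ℝ} (hu : DifferentiableAt ℝ u (e, x)) (v : E) :
    deriv (fun σ : ℝ => u (e + σ • v, x)) 0 = fderiv ℝ u (e, x) (v, 0) := by
  have h2 : HasDerivAt (fun σ : ℝ => (e + σ • v, x)) ((1 : ℝ) • v, (0 : ℝ)) 0 :=
    HasDerivAt.prodMk (((hasDerivAt_id (0 : ℝ)).smul_const v).const_add e) (hasDerivAt_const 0 x)
  rw [one_smul] at h2
  exact (HasFDerivAt.comp_hasDerivAt_of_eq (0 : ℝ) hu.hasFDerivAt h2 (by simp)).deriv

theorem deriv_slice_eq {E F : Type*} [NormedAddCommGroup E] [NormedSpace ℝ E] [NormedAddCommGroup F] [NormedSpace ℝ F] {u : E × ℝ → F} {e : E}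
    {x : ℝ} (hu : DifferentiableAt ℝ u (e, x)) :
    deriv (fun y : ℝ => u (e, y)) x = fderiv ℝ u (e, x) (0, 1) :=
  (hu.hasFDerivAt.comp_hasDerivAt x ((hasDerivAt_const x e).prodMk (hasDerivAt_id x))).deriv

end Lines

/-! ### Bracket densities along families -/

section FamilyDensities

variable {N : ℕ} {M : Type*} [TopologicalSpace M] [ChartedSpace (Coord N) M]
variable {E : Type*} [NormedAddCommGroup E] [NormedSpace ℝ E]

/-- The density of the bracket along a family. -/
def famDensity (P : MatrixOperator N M) (f g : CovectorField N M) (Θ : E → Loop N M)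
    (q : E × ℝ) : ℝ :=
  density P f g (Θ q.1) (q.2 : UnitAddCircle)

/-- The vertical derivative of the density in the direction of a parameter of the family. -/
def famVert (P : MatrixOperator N M) (f g : CovectorField N M) (Θ : E → Loop N M) (τ : E)
    (q : E × ℝ) : ℝ :=
  vertDensity P f g (Θ q.1) (q.2 : UnitAddCircle)
    (mfderiv 𝓘(ℝ, E) (𝓡 N) (fun e => Θ e (q.2 : UnitAddCircle)) q.1 τ)

/-- The position and the velocity of a loop in the chart around `c`. -/
def loopJet (c : M) (γ : Loop N M) (x : UnitAddCircle) : Coord N × Coord N :=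
  (chartAt (Coord N) c (γ x), coframe c (γ x) (γ.vel x))

variable [IsManifold (𝓡 N) ∞ M]
variable {P : MatrixOperator N M} {O : ∀ p : M, Set (Tan N p)} {f g : CovectorField N M}
  {V : Set (Loop N M)} {W : Set E} {Θ : E → Loop N M}

theorem IsFamily.jet_inCoord (h : IsFamily W Θ) {c : M} {q : E × ℝ} (hq : q ∈ chartDom W Θ c) :
    jet (inCoord Θ c) (0, 1) q = loopJet c (Θ q.1) (q.2 : UnitAddCircle) := by
  rw [jet, loopJet, Loop.vel_coe, h.coframe_velocity hq]
  rfl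

theorem famDensity_eventuallyEq (P : MatrixOperator N M) (f g : CovectorField N M)
    (h : IsFamily W Θ) {c : M} {q : E × ℝ} (hq : q ∈ chartDom W Θ c) :
    famDensity P f g Θ =ᶠ[𝓝 q] fun q => covCoord f c (Θ q.1) (q.2 : UnitAddCircle)
      (opCoord P c (jet (inCoord Θ c) (0, 1) q) (covCoord g c (Θ q.1) (q.2 : UnitAddCircle))) := by
  filter_upwards [(h.isOpen_chartDom c).mem_nhds hq] with q' hq'
  rw [h.jet_inCoord hq', famDensity, density_eq P f g hq'.2]
  rfl

theorem famVert_eventuallyEq (hP : IsSmoothSkewOn O P) (f g : CovectorField N M)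
    (h : IsFamily W Θ) (hO : ∀ e ∈ W, ∀ x, (Θ e).vel x ∈ O (Θ e x)) (τ : E) {c : M} {q : E × ℝ}
    (hq : q ∈ chartDom W Θ c) :
    famVert P f g Θ τ =ᶠ[𝓝 q] fun q => vertForm (covCoord f c (Θ q.1) (q.2 : UnitAddCircle))
      (fderiv ℝ (opCoord P c) (jet (inCoord Θ c) (0, 1) q))
      (covCoord g c (Θ q.1) (q.2 : UnitAddCircle)) (fderiv ℝ (inCoord Θ c) q (τ, 0)) := by
  filter_upwards [(h.isOpen_chartDom c).mem_nhds hq] with q' hq'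
  rw [h.jet_inCoord hq', famVert, hP.vertDensity_eq f g hq'.2 (hO _ hq'.1 _),
    h.coframe_mfderiv_param hq']
  rfl

theorem IsSmoothSkewOn.contDiffAt_opCoord (hP : IsSmoothSkewOn O P) (h : IsFamily W Θ)
    (hO : ∀ e ∈ W, ∀ x, (Θ e).vel x ∈ O (Θ e x)) {c : M} {q : E × ℝ} (hq : q ∈ chartDom W Θ c) :
    ContDiffAt ℝ ∞ (opCoord P c) (jet (inCoord Θ c) (0, 1) q) := by
  refine (hP.smooth c).contDiffAt ((hP.isOpen c).mem_nhds ?_)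
  rw [h.jet_inCoord hq]
  exact mem_opDom hq.2 (hO _ hq.1 _)

variable [FiniteDimensional ℝ E] {I J : Loop N M → ℝ}

theorem contDiffAt_famDensity (hP : IsSmoothSkewOn O P) (hI : HasVariationalDeriv V I f)
    (hJ : HasVariationalDeriv V J g) (h : IsFamily W Θ) (hV : ∀ e ∈ W, Θ e ∈ V)
    (hO : ∀ e ∈ W, ∀ x, (Θ e).vel x ∈ O (Θ e x)) (q : E × ℝ) (hq : q.1 ∈ W) :
    ContDiffAt ℝ ∞ (famDensity P f g Θ) q := by
  have hc : q ∈ chartDom W Θ (Θ q.1 (q.2 : UnitAddCircle)) := ⟨hq, mem_chart_source _ _⟩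
  refine ContDiffAt.congr_of_eventuallyEq ?_ (famDensity_eventuallyEq P f g h hc)
  exact (hI.contDiffAt_covCoord h hV hc).clm_apply
    ((((hP.contDiffAt_opCoord h hO hc).comp q (contDiffAt_jet (h.contDiffAt_inCoord hc) _))).clm_apply
      (hJ.contDiffAt_covCoord h hV hc))

theorem contDiffAt_famVert (hP : IsSmoothSkewOn O P) (hI : HasVariationalDeriv V I f)
    (hJ : HasVariationalDeriv V J g) (h : IsFamily W Θ) (hV : ∀ e ∈ W, Θ e ∈ V)
    (hO : ∀ e ∈ W, ∀ x, (Θ e).vel x ∈ O (Θ e x)) (τ : E) (q : E × ℝ) (hq : q.1 ∈ W) :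
    ContDiffAt ℝ ∞ (famVert P f g Θ τ) q := by
  have hc : q ∈ chartDom W Θ (Θ q.1 (q.2 : UnitAddCircle)) := ⟨hq, mem_chart_source _ _⟩
  refine ContDiffAt.congr_of_eventuallyEq ?_ (famVert_eventuallyEq hP f g h hO τ hc)
  exact (contDiffAt_vertForm (hI.contDiffAt_covCoord h hV hc) (hJ.contDiffAt_covCoord h hV hc)
    (contDiffAt_jet (h.contDiffAt_inCoord hc) _) (hP.contDiffAt_opCoord h hO hc)).clm_apply
    (contDiffAt_fderiv_apply (h.contDiffAt_inCoord hc) _)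

theorem hasDerivAt_bracket_family (hP : IsSmoothSkewOn O P) (hI : HasVariationalDeriv V I f)
    (hJ : HasVariationalDeriv V J g) (h : IsFamily W Θ) (hV : ∀ e ∈ W, Θ e ∈ V)
    (hO : ∀ e ∈ W, ∀ x, (Θ e).vel x ∈ O (Θ e x)) {e : E} (he : e ∈ W) (τ : E) :
    HasDerivAt (fun σ : ℝ => bracket P f g (Θ (e + σ • τ)))
      (∫ x in (0 : ℝ)..1, fderiv ℝ (famDensity P f g Θ) (e, x) (τ, 0)) 0 := by
  simp only [bracket_eq_integral_density]
  exact hasDerivAt_integral_line h.isOpen (contDiffAt_famDensity hP hI hJ h hV hO) he τ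

end FamilyDensities

/-! ### A formula for the variational derivative of a bracket -/

section Gradient

variable {N : ℕ} {M : Type*} [TopologicalSpace M] [ChartedSpace (Coord N) M]
variable {E : Type*} [NormedAddCommGroup E] [NormedSpace ℝ E]

/-- The derivative of the density of the bracket in the direction `τ`, up to terms whose integral
vanishes. -/
def defect (P : MatrixOperator N M) (f g : CovectorField N M) (Θ : E → Loop N M) (r s τ : E)
    (q : E × ℝ) : ℝ :=
  fderiv ℝ (famDensity P f g Θ) q (τ, 0)
    - (fderiv ℝ (pairing f Θ s) q (τ, 0) - fderiv ℝ (pairing f Θ τ) q (s, 0))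
    + (fderiv ℝ (pairing g Θ r) q (τ, 0) - fderiv ℝ (pairing g Θ τ) q (r, 0))
    - fderiv ℝ (famVert P f g Θ τ) q (0, 1)

/-- The components in the chart around `c` of the variational derivative of the bracket. -/
def gradCoord (P : MatrixOperator N M) (f g : CovectorField N M) (Θ : E → Loop N M) (r s : E)
    (c : M) (e : E) (x : UnitAddCircle) : Coord N →L[ℝ] ℝ :=
  deriv (fun σ : ℝ => covCoord f c (Θ (e + σ • s)) x) 0
    - deriv (fun σ : ℝ => covCoord g c (Θ (e + σ • r)) x) 0
    + (covCoord f c (Θ e) x).comp (((fderiv ℝ (opCoord P c) (loopJet c (Θ e) x)).flip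
        (covCoord g c (Θ e) x)).comp (ContinuousLinearMap.inl ℝ (Coord N) (Coord N)))
    - circDeriv (fun y => vertForm (covCoord f c (Θ e) y)
        (fderiv ℝ (opCoord P c) (loopJet c (Θ e) y)) (covCoord g c (Θ e) y)) x

/-- The variational derivative of the bracket at the loop `Θ e`. -/
def gradCovector (P : MatrixOperator N M) (f g : CovectorField N M) (Θ : E → Loop N M) (r s : E)
    (e : E) (x : UnitAddCircle) : Cotan N (Θ e x) :=
  coordCovector (Θ e x) (Θ e x) (gradCoord P f g Θ r s (Θ e x) e x).toLinearMap

/-- At the parameter `e`, the derivative of the family `Θ` in the direction `r` is the Hamiltonian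
vector field `P f`. -/
def IsHamiltonianDir (P : MatrixOperator N M) (f : CovectorField N M) (Θ : E → Loop N M) (r : E)
    (e : E) : Prop :=
  ∀ (x : ℝ) (c : M), Θ e (x : UnitAddCircle) ∈ (chartAt (Coord N) c).source →
    fderiv ℝ (inCoord Θ c) (e, x) (r, 0) = coframe c (Θ e (x : UnitAddCircle))
      (P (Θ e (x : UnitAddCircle)) ((Θ e).vel (x : UnitAddCircle)) (f (Θ e) (x : UnitAddCircle)))

variable [IsManifold (𝓡 N) ∞ M]
variable {P : MatrixOperator N M} {O : ∀ p : M, Set (Tan N p)} {f g : CovectorField N M}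
  {V : Set (Loop N M)} {W : Set E} {Θ : E → Loop N M}

theorem IsHamiltonianDir.fderiv_eq {r e : E} (hr : IsHamiltonianDir P f Θ r e)
    (h : IsFamily W Θ) {c : M} {x : ℝ} (hq : (e, x) ∈ chartDom W Θ c) :
    fderiv ℝ (inCoord Θ c) (e, x) (r, 0) = opCoord P c (jet (inCoord Θ c) (0, 1) (e, x))
      (covCoord f c (Θ e) (x : UnitAddCircle)) := by
  rw [hr x c hq.2, h.jet_inCoord hq, loopJet]
  exact (opCoord_coframe P hq.2 _ _ _ (fun w => rfl)).symm

variable [FiniteDimensional ℝ E] {I J : Loop N M → ℝ}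

theorem contDiffAt_defect (hP : IsSmoothSkewOn O P) (hI : HasVariationalDeriv V I f)
    (hJ : HasVariationalDeriv V J g) (h : IsFamily W Θ) (hV : ∀ e ∈ W, Θ e ∈ V)
    (hO : ∀ e ∈ W, ∀ x, (Θ e).vel x ∈ O (Θ e x)) (r s τ : E) (q : E × ℝ) (hq : q.1 ∈ W) :
    ContDiffAt ℝ ∞ (defect P f g Θ r s τ) q := by
  have h1 := contDiffAt_famDensity hP hI hJ h hV hO q hq
  have h2 := fun v => hI.contDiffAt_pairing h hV v q hq
  have h3 := fun v => hJ.contDiffAt_pairing h hV v q hq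
  have h4 := contDiffAt_famVert hP hI hJ h hV hO τ q hq
  exact (((contDiffAt_fderiv_apply h1 _).sub ((contDiffAt_fderiv_apply (h2 s) _).sub
    (contDiffAt_fderiv_apply (h2 τ) _))).add ((contDiffAt_fderiv_apply (h3 r) _).sub
    (contDiffAt_fderiv_apply (h3 τ) _))).sub (contDiffAt_fderiv_apply h4 _)

/-- In every chart, the defect is given by the variational derivative. -/
theorem defect_eq_gradCoord (hP : IsSmoothSkewOn O P) (hI : HasVariationalDeriv V I f)
    (hJ : HasVariationalDeriv V J g) (h : IsFamily W Θ) (hV : ∀ e ∈ W, Θ e ∈ V)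
    (hO : ∀ e ∈ W, ∀ x, (Θ e).vel x ∈ O (Θ e x)) {r s : E} (τ : E) {e : E} {x : ℝ} {c : M}
    (hr : IsHamiltonianDir P f Θ r e) (hs : IsHamiltonianDir P g Θ s e)
    (hq : (e, x) ∈ chartDom W Θ c) :
    defect P f g Θ r s τ (e, x) = gradCoord P f g Θ r s c e (x : UnitAddCircle)
      (fderiv ℝ (inCoord Θ c) (e, x) (τ, 0)) := by
  have hU := h.contDiffAt_inCoord hq
  have hf := hI.contDiffAt_covCoord h hV hq
  have hg := hJ.contDiffAt_covCoord h hV hq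
  have hPc := hP.contDiffAt_opCoord h hO hq
  have hjet := h.jet_inCoord hq
  have key := fderiv_bracket_density (0, 1) (r, 0) (s, 0) (τ, 0) hU hf hg hPc
    (fun a b => by
      rw [hjet]
      exact opCoord_skew hq.2 (hP.skew _ _ (hO _ hq.1 _)) a b)
    (hr.fderiv_eq h hq) (hs.fderiv_eq h hq)
  have hv := contDiffAt_vertForm hf hg (contDiffAt_jet hU (0, 1)) hPc
  rw [defect, (famDensity_eventuallyEq P f g h hq).fderiv_eq,
    (pairing_eventuallyEq f h hq s).fderiv_eq, (pairing_eventuallyEq f h hq τ).fderiv_eq,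
    (pairing_eventuallyEq g h hq r).fderiv_eq, (pairing_eventuallyEq g h hq τ).fderiv_eq,
    (famVert_eventuallyEq hP f g h hO τ hq).fderiv_eq, key, gradCoord, circDeriv_coe]
  -- The covector `gradCoord` is written with one-variable derivatives, so that it depends only on
  -- the loops on a few lines of parameters; here these are matched with the total derivatives of
  -- the local identity.
  have e1 := deriv_line_eq (hf.differentiableAt (by simp)) s
  have e2 := deriv_line_eq (hg.differentiableAt (by simp)) r
  have e3 : deriv (fun y : ℝ => vertForm (covCoord f c (Θ e) (y : UnitAddCircle))
        (fderiv ℝ (opCoord P c) (loopJet c (Θ e) (y : UnitAddCircle)))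
        (covCoord g c (Θ e) (y : UnitAddCircle))) x
      = fderiv ℝ (fun q : E × ℝ => vertForm (covCoord f c (Θ q.1) (q.2 : UnitAddCircle))
        (fderiv ℝ (opCoord P c) (jet (inCoord Θ c) (0, 1) q))
        (covCoord g c (Θ q.1) (q.2 : UnitAddCircle))) (e, x) (0, 1) := by
    rw [← deriv_slice_eq (hv.differentiableAt (by simp))]
    refine Filter.EventuallyEq.deriv_eq ?_
    have hc : ContinuousAt (fun y : ℝ => (e, y)) x := by fun_prop
    filter_upwards [hc.eventually ((h.isOpen_chartDom c).mem_nhds hq)] with y hy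
    rw [h.jet_inCoord hy]
  rw [e1, e2, e3, ← hjet]
  rfl

theorem defect_eq_gradCovector (hP : IsSmoothSkewOn O P) (hI : HasVariationalDeriv V I f)
    (hJ : HasVariationalDeriv V J g) (h : IsFamily W Θ) (hV : ∀ e ∈ W, Θ e ∈ V)
    (hO : ∀ e ∈ W, ∀ x, (Θ e).vel x ∈ O (Θ e x)) {r s : E} (τ : E) {e : E} (he : e ∈ W) (x : ℝ)
    (hr : IsHamiltonianDir P f Θ r e) (hs : IsHamiltonianDir P g Θ s e) :
    defect P f g Θ r s τ (e, x) = gradCovector P f g Θ r s e (x : UnitAddCircle)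
      (mfderiv 𝓘(ℝ, E) (𝓡 N) (fun e => Θ e (x : UnitAddCircle)) e τ) := by
  have hq : (e, x) ∈ chartDom W Θ (Θ e (x : UnitAddCircle)) := ⟨he, mem_chart_source _ _⟩
  rw [defect_eq_gradCoord hP hI hJ h hV hO τ hr hs hq, ← h.coframe_mfderiv_param hq]
  rfl

/-- The derivative of the bracket in the direction of a parameter of the family. -/
theorem hasDerivAt_bracket_defect (hP : IsSmoothSkewOn O P) (hI : HasVariationalDeriv V I f)
    (hJ : HasVariationalDeriv V J g) (h : IsFamily W Θ) (hV : ∀ e ∈ W, Θ e ∈ V)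
    (hO : ∀ e ∈ W, ∀ x, (Θ e).vel x ∈ O (Θ e x)) (r s τ : E) {e : E} (he : e ∈ W) :
    HasDerivAt (fun σ : ℝ => bracket P f g (Θ (e + σ • τ)))
      (∫ x in (0 : ℝ)..1, defect P f g Θ r s τ (e, x)) 0 := by
  have h1 := contDiffAt_famDensity hP hI hJ h hV hO
  have h2 := hI.contDiffAt_pairing h hV
  have h3 := hJ.contDiffAt_pairing h hV
  have h4 := contDiffAt_famVert hP hI hJ h hV hO τ
  have int : ∀ {b : E × ℝ → ℝ}, (∀ q : E × ℝ, q.1 ∈ W → ContDiffAt ℝ ∞ b q) → ∀ w : E × ℝ,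
      IntervalIntegrable (fun x => fderiv ℝ b (e, x) w) MeasureTheory.volume 0 1 :=
    fun hb w => (continuous_fderiv_slice hb he w).intervalIntegrable _ _
  have hper : famVert P f g Θ τ (e, 1) = famVert P f g Θ τ (e, 0) := by
    have : ((1 : ℝ) : UnitAddCircle) = ((0 : ℝ) : UnitAddCircle) := by
      rw [AddCircle.coe_period, AddCircle.coe_zero]
    simp only [famVert]
    rw [this]
  -- The corrections contained in the defect integrate to zero: two differences by symmetry of the
  -- second variations, the x-derivative by periodicity of `famVert`. No condition on r and s
  -- enters.
  have key : ∫ x in (0 : ℝ)..1, defect P f g Θ r s τ (e, x)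
      = ∫ x in (0 : ℝ)..1, fderiv ℝ (famDensity P f g Θ) (e, x) (τ, 0) := by
    simp only [defect]
    rw [intervalIntegral.integral_sub (((int h1 _).sub ((int (h2 s) _).sub (int (h2 τ) _))).add
        ((int (h3 r) _).sub (int (h3 τ) _))) (int h4 _),
      intervalIntegral.integral_add ((int h1 _).sub ((int (h2 s) _).sub (int (h2 τ) _)))
        ((int (h3 r) _).sub (int (h3 τ) _)),
      intervalIntegral.integral_sub (int h1 _) ((int (h2 s) _).sub (int (h2 τ) _)),
      intervalIntegral.integral_sub (int (h2 s) _) (int (h2 τ) _),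
      intervalIntegral.integral_sub (int (h3 r) _) (int (h3 τ) _),
      hI.second_variation_symm h hV he s τ, hJ.second_variation_symm h hV he r τ,
      integral_fderiv_circle h4 he hper]
    ring
  rw [key]
  exact hasDerivAt_bracket_family hP hI hJ h hV hO he τ

end Gradient

/-! ### Gradients tested by perturbations in charts; their uniqueness -/

section Closure

variable {N : ℕ} {M : Type*} [TopologicalSpace M] [ChartedSpace (Coord N) M]

theorem IsLoopOpen.isOpen_family {E : Type*} [NormedAddCommGroup E] [NormedSpace ℝ E]
    [FiniteDimensional ℝ E] {V : Set (Loop N M)} (hV : IsLoopOpen V) {W : Set E}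
    {Θ : E → Loop N M} (h : IsFamily W Θ) : IsOpen {e | e ∈ W ∧ Θ e ∈ V} := by
  let L : (Fin (Module.finrank ℝ E) → ℝ) ≃L[ℝ] E := ContinuousLinearEquiv.ofFinrankEq (by simp)
  have h1 := hV _ (L ⁻¹' W) (Θ ∘ L) (isSmoothFamily_iff.mpr
    ⟨h.comp (h.isOpen.preimage L.continuous) L.contDiff (fun _ ht => ht), fun _ _ => trivial⟩)
  have h2 := h1.preimage L.symm.continuous
  convert h2 using 1
  ext e
  simp

/-- Near `τ = 0` the loop `δ τ` arises from `γ` by adding `τ b` in the chart around `c`. -/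
def IsPerturbation (c : M) (K : Set UnitAddCircle) (b : UnitAddCircle → Coord N) (γ : Loop N M)
    (δ : ℝ → Loop N M) : Prop :=
  ∀ᶠ τ in 𝓝 (0 : ℝ), (∀ x ∉ K, δ τ x = γ x) ∧ ∀ x ∈ K, δ τ x ∈ (chartAt (Coord N) c).source ∧
    chartAt (Coord N) c (δ τ x) = chartAt (Coord N) c (γ x) + τ • b x

/-- The covector field `h` along `γ` is smooth, and it is the variational derivative of `F` at `γ` as
far as perturbations in charts are concerned. -/
structure IsGradientAt (F : Loop N M → ℝ) (γ : Loop N M) (h : ∀ x : UnitAddCircle, Cotan N (γ x)) :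
    Prop where
  smooth : ∀ (c : M) (w : Coord N), ∀ x : ℝ, γ (x : UnitAddCircle) ∈ (chartAt (Coord N) c).source →
    ContDiffAt ℝ ∞ (fun x : ℝ => h (x : UnitAddCircle) (frame c (γ (x : UnitAddCircle)) w)) x
  deriv : ∀ (c : M) (K : Set UnitAddCircle) (b : UnitAddCircle → Coord N), IsClosed K →
    (∀ x ∈ K, γ x ∈ (chartAt (Coord N) c).source) →
    ContDiff ℝ ∞ (fun x : ℝ => b (x : UnitAddCircle)) → (∀ x ∉ K, b x = 0) →
    ∀ δ : ℝ → Loop N M, IsPerturbation c K b γ δ → HasDerivAt (fun τ => F (δ τ))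
      (∫ x in (0 : ℝ)..1, h (x : UnitAddCircle) (frame c (γ (x : UnitAddCircle))
        (b (x : UnitAddCircle)))) 0

/-- The data fix the coordinates of the perturbed loop over K and the loop itself elsewhere, hence
the germ of the curve at zero. A derivative computed along one convenient curve thus holds along all
of them. -/
theorem IsPerturbation.eventuallyEq {c : M} {K : Set UnitAddCircle} {b : UnitAddCircle → Coord N}
    {γ : Loop N M} {δ δ' : ℝ → Loop N M} (h : IsPerturbation c K b γ δ)
    (h' : IsPerturbation c K b γ δ') : δ =ᶠ[𝓝 0] δ' := by
  filter_upwards [h, h'] with τ h1 h2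
  refine Loop.ext fun x => ?_
  by_cases hx : x ∈ K
  · refine (chartAt (Coord N) c).injOn (h1.2 x hx).1 (h2.2 x hx).1 ?_
    rw [(h1.2 x hx).2, (h2.2 x hx).2]
  · rw [h1.1 x hx, h2.1 x hx]

variable [IsManifold (𝓡 N) ∞ M]

theorem exists_isPerturbation (γ : Loop N M) (c : M) {K : Set UnitAddCircle} (hK : IsClosed K)
    (hKc : ∀ x ∈ K, γ x ∈ (chartAt (Coord N) c).source) {b : UnitAddCircle → Coord N}
    (hb : ContDiff ℝ ∞ (fun x : ℝ => b (x : UnitAddCircle))) (hbK : ∀ x ∉ K, b x = 0) :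
    ∃ δ, IsPerturbation c K b γ δ := by
  obtain ⟨W', Γ', -, h0, hf, -, h1, h2⟩ := (isFamily_const (E := ℝ) γ).exists_perturbation
    (e₀ := 0) trivial c hK hKc (B := fun τ x => τ • b x)
    (ContDiff.contDiffOn (contDiff_fst.smul (hb.comp contDiff_snd))) (by ext1 x; simp)
    (fun e _ x hx => by simp [hbK x hx])
  refine ⟨Γ', ?_⟩
  filter_upwards [hf.isOpen.mem_nhds h0] with τ hτ
  exact ⟨h1 τ hτ, fun x hx => (h2 τ hτ x hx).2⟩

theorem exists_bump [T2Space M] {p c : M} (hp : p ∈ (chartAt (Coord N) c).source) :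
    ∃ ρ : M → ℝ, ContMDiff (𝓡 N) 𝓘(ℝ, ℝ) ∞ ρ ∧ tsupport ρ ⊆ (chartAt (Coord N) c).source ∧
      (∀ᶠ p' in 𝓝 p, ρ p' = 1) ∧ ∀ p', 0 ≤ ρ p' := by
  obtain ⟨ρ, -, hρ⟩ := (SmoothBumpFunction.nhds_basis_tsupport (I := 𝓡 N) p).mem_iff.mp
    ((chartAt (Coord N) c).open_source.mem_nhds hp)
  exact ⟨ρ, ρ.contMDiff, hρ, ρ.eventuallyEq_one, fun _ => ρ.nonneg⟩

/-- This is the fundamental lemma of the calculus of variations, with test fields supported in one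
chart. -/
theorem IsGradientAt.unique [T2Space M] {F : Loop N M → ℝ} {γ : Loop N M}
    {h h' : ∀ x : UnitAddCircle, Cotan N (γ x)} (hh : IsGradientAt F γ h)
    (hh' : IsGradientAt F γ h') : h = h' := by
  funext z
  obtain ⟨x₀, hx₀, rfl⟩ := exists_mem_Icc_coe z
  set c : M := γ (x₀ : UnitAddCircle) with hc
  have hcs : γ (x₀ : UnitAddCircle) ∈ (chartAt (Coord N) c).source := mem_chart_source _ _
  suffices key : ∀ w : Coord N, (h (x₀ : UnitAddCircle) - h' (x₀ : UnitAddCircle))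
      (frame c (γ (x₀ : UnitAddCircle)) w) = 0 by
    refine LinearMap.ext fun ξ => ?_
    have := key (coframe c _ ξ)
    rw [frame_coframe hcs] at this
    exact sub_eq_zero.mp this
  intro w
  by_contra hne
  obtain ⟨ρ, hρ, hρc, hρ1, hρ0⟩ := exists_bump hcs
  -- With k the difference of the two candidates on the frame vector w, the test field `ρ k w` gives
  -- `∫ ρ k² = 0`, while the integrand is nonnegative and positive at `x₀`.
  let k : UnitAddCircle → ℝ := fun x => (h x - h' x) (frame c (γ x) w)
  let b : UnitAddCircle → Coord N := fun x => (ρ (γ x) * k x) • w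
  let K : Set UnitAddCircle := γ.toFun ⁻¹' tsupport ρ
  have hK : IsClosed K := (isClosed_tsupport _).preimage γ.continuous
  have hρs : ContDiff ℝ ∞ (fun x : ℝ => ρ (γ (x : UnitAddCircle))) := by
    rw [← contMDiff_iff_contDiff]
    exact hρ.comp γ.smooth
  have hχ0 : ∀ x ∉ K, ρ (γ x) = 0 := fun x hx =>
    image_eq_zero_of_notMem_tsupport (f := ρ) hx
  have hks : ∀ x : ℝ, (x : UnitAddCircle) ∈ K →
      ContDiffAt ℝ ∞ (fun x : ℝ => k (x : UnitAddCircle)) x := fun x hx =>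
    (hh.smooth c w x (hρc hx)).sub (hh'.smooth c w x (hρc hx))
  have hρk : ContDiff ℝ ∞ (fun x : ℝ => ρ (γ (x : UnitAddCircle)) * k (x : UnitAddCircle)) := by
    rw [contDiff_iff_contDiffAt]
    intro x
    by_cases hx : (x : UnitAddCircle) ∈ K
    · exact hρs.contDiffAt.mul (hks x hx)
    · refine (contDiffAt_const (c := (0 : ℝ))).congr_of_eventuallyEq ?_
      filter_upwards [(hK.isOpen_compl.preimage (AddCircle.continuous_mk' 1)).mem_nhds hx] with y hy
      rw [hχ0 (y : UnitAddCircle) hy, zero_mul]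
  have hb : ContDiff ℝ ∞ (fun x : ℝ => b (x : UnitAddCircle)) := hρk.smul contDiff_const
  have hbK : ∀ x ∉ K, b x = 0 := fun x hx => by simp [b, hχ0 x hx]
  obtain ⟨δ, hδ⟩ := exists_isPerturbation γ c hK (fun x hx => hρc hx) hb hbK
  have e1 := (hh.deriv c K b hK (fun x hx => hρc hx) hb hbK δ hδ).unique
    (hh'.deriv c K b hK (fun x hx => hρc hx) hb hbK δ hδ)
  have hval : ∀ (u : ∀ x : UnitAddCircle, Cotan N (γ x)) (x : UnitAddCircle),
      u x (frame c (γ x) (b x)) = (ρ (γ x) * k x) * u x (frame c (γ x) w) := fun u x => by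
    simp only [b, map_smul, smul_eq_mul]
  have hint : ∀ u : ∀ x : UnitAddCircle, Cotan N (γ x), IsGradientAt F γ u →
      IntervalIntegrable (fun x : ℝ => u (x : UnitAddCircle) (frame c (γ (x : UnitAddCircle))
        (b (x : UnitAddCircle)))) MeasureTheory.volume 0 1 := by
    intro u hu
    refine Continuous.intervalIntegrable (continuous_iff_continuousAt.mpr fun x => ?_) _ _
    simp only [hval u]
    by_cases hx : (x : UnitAddCircle) ∈ K
    · exact hρk.continuous.continuousAt.mul (hu.smooth c w x (hρc hx)).continuousAt
    · refine (continuousAt_const (y := (0 : ℝ))).congr ?_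
      filter_upwards [(hK.isOpen_compl.preimage (AddCircle.continuous_mk' 1)).mem_nhds hx] with y hy
      rw [hχ0 (y : UnitAddCircle) hy, zero_mul, zero_mul]
  have e2 : ∫ x in (0 : ℝ)..1, (ρ (γ (x : UnitAddCircle)) * k (x : UnitAddCircle))
      * k (x : UnitAddCircle) = 0 := by
    rw [← sub_eq_zero, ← intervalIntegral.integral_sub (hint h hh) (hint h' hh')] at e1
    refine (intervalIntegral.integral_congr fun x _ => ?_).trans e1
    simp only [hval]
    rw [← mul_sub]
    rfl
  have hpos : 0 < ∫ x in (0 : ℝ)..1, (ρ (γ (x : UnitAddCircle)) * k (x : UnitAddCircle))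
      * k (x : UnitAddCircle) := by
    refine intervalIntegral.integral_pos zero_lt_one ?_ ?_ ⟨x₀, hx₀, ?_⟩
    · refine Continuous.continuousOn (continuous_iff_continuousAt.mpr fun x => ?_)
      by_cases hx : (x : UnitAddCircle) ∈ K
      · exact hρk.continuous.continuousAt.mul (hks x hx).continuousAt
      · refine (continuousAt_const (y := (0 : ℝ))).congr ?_
        filter_upwards [(hK.isOpen_compl.preimage (AddCircle.continuous_mk' 1)).mem_nhds hx]
          with y hy
        rw [hχ0 (y : UnitAddCircle) hy, zero_mul, zero_mul]
    · intro x _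
      rw [mul_assoc]
      exact mul_nonneg (hρ0 _) (mul_self_nonneg _)
    · rw [hρ1.self_of_nhds, one_mul]
      exact mul_self_pos.mpr hne
  exact hpos.ne' e2

variable {E : Type*} [NormedAddCommGroup E] [NormedSpace ℝ E]
variable {P : MatrixOperator N M} {O : ∀ p : M, Set (Tan N p)} {f g : CovectorField N M}
  {V : Set (Loop N M)} {W : Set E} {Θ : E → Loop N M}
variable [FiniteDimensional ℝ E] {I J : Loop N M → ℝ}

/-- Add one parameter that moves the loops along b in the chart around c. The defect in this new
direction is smooth, is defined without any Hamiltonian condition, and equals the value of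
`gradCovector` on b wherever r and s are Hamiltonian. It gives access to the smoothness of
`gradCovector`, whose definition uses a different chart at every point of the loop. -/
theorem exists_test_family (hP : IsSmoothSkewOn O P) (hI : HasVariationalDeriv V I f)
    (hJ : HasVariationalDeriv V J g) (hVo : IsLoopOpen V) (hVO : ∀ γ ∈ V, ∀ x, γ.vel x ∈ O (γ x))
    (h : IsFamily W Θ) (hV : ∀ e ∈ W, Θ e ∈ V) (r s : E) {e₀ : E} (he₀ : e₀ ∈ W) (c : M)
    {K : Set UnitAddCircle} (hK : IsClosed K)
    (hKc : ∀ x ∈ K, Θ e₀ x ∈ (chartAt (Coord N) c).source) {b : UnitAddCircle → Coord N}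
    (hb : ContDiff ℝ ∞ (fun x : ℝ => b (x : UnitAddCircle))) (hbK : ∀ x ∉ K, b x = 0) :
    ∃ D : E × ℝ → ℝ, (∀ x : ℝ, ContDiffAt ℝ ∞ D (e₀, x)) ∧
      (∀ᶠ e in 𝓝 e₀, IsHamiltonianDir P f Θ r e → IsHamiltonianDir P g Θ s e → ∀ x : ℝ,
        gradCovector P f g Θ r s e (x : UnitAddCircle)
          (frame c (Θ e (x : UnitAddCircle)) (b (x : UnitAddCircle))) = D (e, x)) ∧
      ∀ δ : ℝ → Loop N M, IsPerturbation c K b (Θ e₀) δ →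
        HasDerivAt (fun τ => bracket P f g (δ τ)) (∫ x in (0 : ℝ)..1, D (e₀, x)) 0 := by
  have hfst : IsFamily (Prod.fst ⁻¹' W) (Θ ∘ (Prod.fst : E × ℝ → E)) :=
    h.comp (h.isOpen.preimage continuous_fst) contDiff_fst (fun _ hp => hp)
  obtain ⟨W₁, Θ', hW₁, h01, hf₁, hB0, hoff, hon⟩ := hfst.exists_perturbation
    (e₀ := (e₀, 0)) he₀ c hK hKc (B := fun p x => p.2 • b x)
    (ContDiff.contDiffOn ((contDiff_snd.comp contDiff_fst).smul (hb.comp contDiff_snd)))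
    (by ext1 x; simp) (fun e _ x hx => by simp [hbK x hx])
  have hΘ0 : ∀ e, Θ' (e, 0) = Θ e := fun e => hB0 (e, 0) (by ext1 x; simp)
  -- Openness of V keeps the extended family inside V after the parameters are shrunk.
  have hW₂ := hVo.isOpen_family hf₁
  set W₂ : Set (E × ℝ) := {p | p ∈ W₁ ∧ Θ' p ∈ V} with hW₂d
  have hf₂ : IsFamily W₂ Θ' := hf₁.mono hW₂ (fun p hp => hp.1)
  have hV₂ : ∀ p ∈ W₂, Θ' p ∈ V := fun p hp => hp.2
  have hO₂ : ∀ p ∈ W₂, ∀ x, (Θ' p).vel x ∈ O (Θ' p x) := fun p hp => hVO _ hp.2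
  have h02 : (e₀, (0 : ℝ)) ∈ W₂ := ⟨h01, by rw [hΘ0]; exact hV _ he₀⟩
  have hD := contDiffAt_defect hP hI hJ hf₂ hV₂ hO₂ (r, 0) (s, 0) (0, 1)
  have hev : ∀ᶠ e in 𝓝 e₀, (e, (0 : ℝ)) ∈ W₂ := by
    have hc : ContinuousAt (fun e : E => (e, (0 : ℝ))) e₀ := by fun_prop
    exact hc.eventually (hW₂.mem_nhds h02)
  refine ⟨fun q => defect P f g Θ' (r, 0) (s, 0) (0, 1) ((q.1, 0), q.2), fun x => ?_, ?_, ?_⟩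
  · exact (hD ((e₀, 0), x) h02).comp (e₀, x) (f := fun q : E × ℝ => ((q.1, (0 : ℝ)), q.2))
      (by fun_prop)
  · filter_upwards [hev] with e he hr hs x
    have hdir : ∀ (f : CovectorField N M) (r : E), IsHamiltonianDir P f Θ r e →
        IsHamiltonianDir P f Θ' (r, 0) (e, 0) := by
      intro f r hr x c hx
      rw [hΘ0] at hx ⊢
      rw [← hr x c hx]
      have d1 := hf₂.hasDerivAt_inCoord (c := c) (e := (e, 0)) (x := x)
        ⟨he, by rw [hΘ0]; exact hx⟩ (r, 0)
      have d2 := h.hasDerivAt_inCoord (c := c) (e := e) (x := x) ⟨hW₁ (a := (e, (0 : ℝ))) he.1, hx⟩ r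
      refine d1.unique (d2.congr_of_eventuallyEq (Eventually.of_forall fun σ => ?_))
      simp only [inCoord, Prod.smul_mk, Prod.mk_add_mk, smul_zero, add_zero, hΘ0]
    -- The directions `(r, 0)` and `(s, 0)` do not involve the new parameter, so only the
    -- restriction of `Θ'` to its zero value enters, and that is Θ.
    have hgrad : ∀ c, gradCoord P f g Θ' (r, 0) (s, 0) c (e, 0) = gradCoord P f g Θ r s c e := by
      intro c
      unfold gradCoord
      simp only [Prod.smul_mk, Prod.mk_add_mk, smul_zero, add_zero, hΘ0]
    have hq : ((e, (0 : ℝ)), x) ∈ chartDom W₂ Θ' (Θ e (x : UnitAddCircle)) :=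
      ⟨he, by rw [hΘ0]; exact mem_chart_source _ _⟩
    rw [defect_eq_gradCoord hP hI hJ hf₂ hV₂ hO₂ (0, 1) (hdir f r hr) (hdir g s hs) hq, hgrad]
    have hτ : fderiv ℝ (inCoord Θ' (Θ e (x : UnitAddCircle))) ((e, 0), x) ((0, 1), 0)
        = coframe (Θ e (x : UnitAddCircle)) (Θ e (x : UnitAddCircle))
          (frame c (Θ e (x : UnitAddCircle)) (b (x : UnitAddCircle))) := by
      have hcurve : ∀ᶠ σ : ℝ in 𝓝 0, ((e, 0) : E × ℝ) + σ • (0, 1) ∈ W₂ := by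
        have : Continuous fun σ : ℝ => ((e, 0) : E × ℝ) + σ • (0, 1) := by fun_prop
        refine this.continuousAt.eventually (hW₂.mem_nhds ?_)
        simpa using he
      by_cases hx : (x : UnitAddCircle) ∈ K
      · obtain ⟨k1, k2, -⟩ := hon _ he.1 _ hx
        refine hf₂.fderiv_inCoord_of_chart (c := c) ⟨he, k2⟩ hq (by simp [hΘ0]) _ ?_
        change Θ e (x : UnitAddCircle) ∈ _ at k1
        rw [coframe_frame k1]
        have d1 := hf₂.hasDerivAt_inCoord (c := c) (e := (e, 0)) (x := x) ⟨he, k2⟩ (0, 1)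
        have d3 : HasDerivAt (fun σ : ℝ => chartAt (Coord N) c (Θ e (x : UnitAddCircle))
            + σ • b (x : UnitAddCircle)) ((1 : ℝ) • b (x : UnitAddCircle)) 0 :=
          ((hasDerivAt_id (0 : ℝ)).smul_const _).const_add _
        rw [one_smul] at d3
        refine d1.unique (d3.congr_of_eventuallyEq ?_)
        filter_upwards [hcurve] with σ hσ
        rw [inCoord, (hon _ hσ.1 _ hx).2.2]
        simp
      · rw [hbK _ hx, map_zero, map_zero]
        have d1 := hf₂.hasDerivAt_inCoord (e := (e, 0)) (x := x) hq (0, 1)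
        refine d1.unique ((hasDerivAt_const (0 : ℝ) (chartAt (Coord N) (Θ e (x : UnitAddCircle))
          (Θ e (x : UnitAddCircle)))).congr_of_eventuallyEq ?_)
        filter_upwards [hcurve] with σ hσ
        rw [inCoord, hoff _ hσ.1 _ hx]
        simp
    rw [hτ]
    rfl
  · intro δ hδ
    have h1 := hasDerivAt_bracket_defect hP hI hJ hf₂ hV₂ hO₂ (r, 0) (s, 0) (0, 1) h02
    have h2 : IsPerturbation c K b (Θ e₀) (fun σ => Θ' ((e₀, 0) + σ • (0, 1))) := by
      have hcurve : ∀ᶠ σ : ℝ in 𝓝 0, ((e₀, 0) : E × ℝ) + σ • (0, 1) ∈ W₂ := by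
        have : Continuous fun σ : ℝ => ((e₀, 0) : E × ℝ) + σ • (0, 1) := by fun_prop
        refine this.continuousAt.eventually (hW₂.mem_nhds ?_)
        simpa using h02
      filter_upwards [hcurve] with σ hσ
      refine ⟨fun x hx => ?_, fun x hx => ?_⟩
      · rw [hoff _ hσ.1 x hx]; simp
      · obtain ⟨-, k2, k3⟩ := hon _ hσ.1 _ hx
        refine ⟨k2, k3.trans ?_⟩
        simp
    refine h1.congr_of_eventuallyEq ?_
    filter_upwards [hδ.eventuallyEq h2] with σ hσ
    rw [hσ]

end Closure

/-! ### Existence of the variational derivative of a bracket -/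

section VariationalDerivative

variable {N : ℕ} {M : Type*} [TopologicalSpace M] [ChartedSpace (Coord N) M]
  [IsManifold (𝓡 N) ∞ M]
variable {E : Type*} [NormedAddCommGroup E] [NormedSpace ℝ E] [FiniteDimensional ℝ E]
variable {P : MatrixOperator N M} {O : ∀ p : M, Set (Tan N p)} {f g : CovectorField N M}
  {V : Set (Loop N M)} {W : Set E} {Θ Γ : E → Loop N M} {I J : Loop N M → ℝ}

theorem contDiffOn_hamiltonian (hP : IsSmoothSkewOn O P) (hI : HasVariationalDeriv V I f)
    (h : IsFamily W Θ) (hV : ∀ e ∈ W, Θ e ∈ V) (hO : ∀ e ∈ W, ∀ x, (Θ e).vel x ∈ O (Θ e x))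
    (c : M) : ContDiffOn ℝ ∞ (fun q : E × ℝ => coframe c (Θ q.1 (q.2 : UnitAddCircle))
      (P (Θ q.1 (q.2 : UnitAddCircle)) ((Θ q.1).vel (q.2 : UnitAddCircle))
        (f (Θ q.1) (q.2 : UnitAddCircle)))) (chartDom W Θ c) := by
  intro q hq
  refine ContDiffAt.contDiffWithinAt ?_
  have h1 := ((hP.contDiffAt_opCoord h hO hq).comp q
    (contDiffAt_jet (h.contDiffAt_inCoord hq) _)).clm_apply (hI.contDiffAt_covCoord h hV hq)
  refine h1.congr_of_eventuallyEq ?_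
  filter_upwards [(h.isOpen_chartDom c).mem_nhds hq] with q' hq'
  simp only [Function.comp]
  rw [h.jet_inCoord hq', loopJet]
  exact (opCoord_coframe P hq'.2 _ _ _ (fun w => rfl)).symm

variable [T2Space M] [SecondCountableTopology M]

/-- Extending Γ by two parameters makes the Hamiltonian fields of f and of g available as directions
at every `(e, 0)`, and the formula `gradCovector` then applies along the whole original family near
`e₀`. -/
theorem exists_local_gradient (hP : IsSmoothSkewOn O P) (hI : HasVariationalDeriv V I f)
    (hJ : HasVariationalDeriv V J g) (hVo : IsLoopOpen V) (hVO : ∀ γ ∈ V, ∀ x, γ.vel x ∈ O (γ x))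
    (hΓ : IsFamily W Γ) (hV : ∀ e ∈ W, Γ e ∈ V) {e₀ : E} (he₀ : e₀ ∈ W) :
    ∃ (U : Set E) (h : ∀ (e : E) (x : UnitAddCircle), Cotan N (Γ e x)), IsOpen U ∧ e₀ ∈ U ∧
      (∀ e ∈ U, IsGradientAt (bracket P f g) (Γ e) (h e)) ∧
      (∀ e ∈ U, ∀ v : E, HasDerivAt (fun σ : ℝ => bracket P f g (Γ (e + σ • v)))
        (∫ x in (0 : ℝ)..1, h e (x : UnitAddCircle)
          (mfderiv 𝓘(ℝ, E) (𝓡 N) (fun e => Γ e (x : UnitAddCircle)) e v)) 0) ∧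
      ∀ e ∈ U, ∀ (c : M) (w : Coord N) (x : ℝ),
        Γ e (x : UnitAddCircle) ∈ (chartAt (Coord N) c).source →
        ContDiffAt ℝ ∞ (fun q : E × ℝ => h q.1 (q.2 : UnitAddCircle)
          (frame c (Γ q.1 (q.2 : UnitAddCircle)) w)) (e, x) := by
  obtain ⟨W₁, Θ, hf₁, h01, hW₁, hΘ0, hX⟩ := hΓ.exists_extension he₀
    (ι := Bool) (fun i e x => P (Γ e x) ((Γ e).vel x) (if i then g (Γ e) x else f (Γ e) x))
    (fun i c => by
      cases i
      · exact contDiffOn_hamiltonian hP hI hΓ hV (fun e he => hVO _ (hV e he)) c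
      · exact contDiffOn_hamiltonian hP hJ hΓ hV (fun e he => hVO _ (hV e he)) c)
  -- Replacing Γ by the restriction of Θ makes the cotangent spaces of both families literally the
  -- same types.
  obtain rfl : Γ = fun e => Θ (e, 0) := funext fun e => (hΘ0 e).symm
  have hW₂ := hVo.isOpen_family hf₁
  set W₂ : Set (E × (Bool → ℝ)) := {p | p ∈ W₁ ∧ Θ p ∈ V} with hW₂d
  have hf₂ : IsFamily W₂ Θ := hf₁.mono hW₂ (fun p hp => hp.1)
  have hV₂ : ∀ p ∈ W₂, Θ p ∈ V := fun p hp => hp.2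
  have hO₂ : ∀ p ∈ W₂, ∀ x, (Θ p).vel x ∈ O (Θ p x) := fun p hp => hVO _ hp.2
  set r : E × (Bool → ℝ) := (0, Pi.single false 1) with hr
  set s : E × (Bool → ℝ) := (0, Pi.single true 1) with hs
  have hdr : ∀ e : E, (e, 0) ∈ W₂ → IsHamiltonianDir P f Θ r (e, 0) :=
    fun e he x c hx => hX e x c false he.1 hx
  have hds : ∀ e : E, (e, 0) ∈ W₂ → IsHamiltonianDir P g Θ s (e, 0) :=
    fun e he x c hx => hX e x c true he.1 hx
  have hcont : Continuous fun e : E => (e, (0 : Bool → ℝ)) := by fun_prop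
  have hU : IsOpen ((fun e : E => (e, (0 : Bool → ℝ))) ⁻¹' W₂) := hW₂.preimage hcont
  have hsm : ∀ e : E, (e, 0) ∈ W₂ → ∀ (c : M) (w : Coord N) (x : ℝ),
      Θ (e, 0) (x : UnitAddCircle) ∈ (chartAt (Coord N) c).source →
      ContDiffAt ℝ ∞ (fun q : E × ℝ => gradCovector P f g Θ r s (q.1, 0) (q.2 : UnitAddCircle)
        (frame c (Θ (q.1, 0) (q.2 : UnitAddCircle)) w)) (e, x) := by
    intro e he c w x hx
    -- The field `ρ w` is an admissible test field on the whole circle and equals w near the point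
    -- where smoothness is claimed.
    obtain ⟨ρ, hρ, hρc, hρ1, -⟩ := exists_bump hx
    have hρs : ContDiff ℝ ∞ (fun x : ℝ => ρ (Θ (e, 0) (x : UnitAddCircle))) := by
      rw [← contMDiff_iff_contDiff]
      exact hρ.comp (Θ (e, 0)).smooth
    obtain ⟨D, hD, hDe, -⟩ := exists_test_family hP hI hJ hVo hVO hf₂ hV₂ r s he c
      (K := (Θ (e, 0)).toFun ⁻¹' tsupport ρ)
      ((isClosed_tsupport _).preimage (Θ (e, 0)).continuous) (fun x hx => hρc hx)
      (b := fun x => ρ (Θ (e, 0) x) • w) (hρs.smul contDiff_const)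
      (fun x hx => by
        have : ρ (Θ (e, 0) x) = 0 := image_eq_zero_of_notMem_tsupport (f := ρ) hx
        simp only [this, zero_smul])
    have h1 : ContDiffAt ℝ ∞ (fun q : E × ℝ => D ((q.1, 0), q.2)) (e, x) :=
      (hD x).comp (e, x) (f := fun q : E × ℝ => ((q.1, (0 : Bool → ℝ)), q.2)) (by fun_prop)
    refine h1.congr_of_eventuallyEq ?_
    have c1 : ContinuousAt (fun q : E × ℝ => (q.1, (0 : Bool → ℝ))) (e, x) := by fun_prop
    have c2 : ContinuousAt (fun q : E × ℝ => Θ (e, 0) (q.2 : UnitAddCircle)) (e, x) :=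
      (((Θ (e, 0)).continuous.comp (AddCircle.continuous_mk' 1)).comp continuous_snd).continuousAt
    filter_upwards [c1.eventually hDe, c2.eventually hρ1, c1.eventually (hW₂.mem_nhds he)]
      with q hq1 hq2 hq3
    have := hq1 (hdr _ hq3) (hds _ hq3) q.2
    rw [hq2, one_smul] at this
    exact this
  refine ⟨_, fun e => gradCovector P f g Θ r s (e, 0), hU, ⟨h01, hV e₀ he₀⟩, ?_, ?_, hsm⟩
  · intro e he
    refine ⟨fun c w x hx => ?_, fun c K b hK hKc hb hbK δ hδ => ?_⟩
    · exact (hsm e he c w x hx).comp x (f := fun x : ℝ => (e, x)) (by fun_prop)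
    · obtain ⟨D, -, hDe, hDδ⟩ := exists_test_family hP hI hJ hVo hVO hf₂ hV₂ r s he c hK hKc hb hbK
      have h1 := hDδ δ hδ
      have h2 := hDe.self_of_nhds (hdr e he) (hds e he)
      simp only [← h2] at h1
      exact h1
  · intro e he v
    have h1 := hasDerivAt_bracket_defect hP hI hJ hf₂ hV₂ hO₂ r s (v, 0) he
    simp only [Prod.smul_mk, Prod.mk_add_mk, smul_zero, add_zero] at h1
    have h2 : ∀ x : ℝ, defect P f g Θ r s (v, 0) ((e, 0), x)
        = gradCovector P f g Θ r s (e, 0) (x : UnitAddCircle)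
          (mfderiv 𝓘(ℝ, E) (𝓡 N) (fun e => Θ (e, 0) (x : UnitAddCircle)) e v) := by
      intro x
      rw [defect_eq_gradCovector hP hI hJ hf₂ hV₂ hO₂ (v, 0) he x (hdr e he) (hds e he)]
      congr 1
      have hq : ((e, (0 : Bool → ℝ)), x) ∈ chartDom W₂ Θ (Θ (e, 0) (x : UnitAddCircle)) :=
        ⟨he, mem_chart_source _ _⟩
      have hq' : (e, x) ∈ chartDom W (fun e => Θ (e, 0)) (Θ (e, 0) (x : UnitAddCircle)) :=
        ⟨hW₁ _ he.1, mem_chart_source _ _⟩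
      refine coframe_injective (mem_chart_source _ _) ((hf₂.coframe_mfderiv_param hq (v, 0)).trans
        (Eq.trans ?_ (hΓ.coframe_mfderiv_param hq' v).symm))
      have d1 := hf₂.hasDerivAt_inCoord hq (v, 0)
      have d2 := hΓ.hasDerivAt_inCoord hq' v
      refine d1.unique (d2.congr_of_eventuallyEq (Eventually.of_forall fun σ => ?_))
      simp only [inCoord, Prod.smul_mk, Prod.mk_add_mk, smul_zero, add_zero]
    rw [intervalIntegral.integral_congr (fun x _ => h2 x)] at h1
    exact h1

open Classical in
/-- The bracket defined by a smooth skew-symmetric matrix operator has a smooth variational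
derivative. -/
theorem exists_hasVariationalDeriv_bracket (hP : IsSmoothSkewOn O P)
    (hI : HasVariationalDeriv V I f) (hJ : HasVariationalDeriv V J g) (hVo : IsLoopOpen V)
    (hVO : ∀ γ ∈ V, ∀ x, γ.vel x ∈ O (γ x)) :
    ∃ dIJ : CovectorField N M, HasVariationalDeriv V (bracket P f g) dIJ := by
  -- The value at γ is characterized by γ alone, without a family. By uniqueness it agrees with the
  -- local gradient of every family through γ, so smoothness can be checked family by family.
  let dIJ : CovectorField N M := fun γ =>
    if h : ∃ h, IsGradientAt (bracket P f g) γ h then h.choose else 0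
  have hd : ∀ γ h, IsGradientAt (bracket P f g) γ h → dIJ γ = h := by
    intro γ h hh
    have hex : ∃ h, IsGradientAt (bracket P f g) γ h := ⟨h, hh⟩
    simp only [dIJ, dif_pos hex]
    exact hex.choose_spec.unique hh
  refine ⟨dIJ, ⟨fun k W Γ hΓ c w => ?_, fun k W Γ hΓ t ht v => ?_⟩⟩
  · obtain ⟨hf, hV⟩ := isSmoothFamily_iff.mp hΓ
    rintro ⟨t, x⟩ ⟨ht, hx⟩
    obtain ⟨U, h, hU, htU, h1, -, h3⟩ := exists_local_gradient hP hI hJ hVo hVO hf hV ht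
    refine ((h3 t htU c w x hx).congr_of_eventuallyEq ?_).contDiffWithinAt
    filter_upwards [(hU.preimage continuous_fst).mem_nhds htU] with q hq
    rw [hd _ _ (h1 q.1 hq)]
  · obtain ⟨hf, hV⟩ := isSmoothFamily_iff.mp hΓ
    obtain ⟨U, h, hU, htU, h1, h2, -⟩ := exists_local_gradient hP hI hJ hVo hVO hf hV ht
    rw [hd _ _ (h1 t htU)]
    exact h2 t htU v

end VariationalDerivative

set_option maxSynthPendingDepth 5
set_option synthInstance.maxHeartbeats 200000

/-! ### Trilinear forms as iterated linear maps -/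

section Trilinear

variable {C : Type*} [NormedAddCommGroup C] [NormedSpace ℝ C]

/-- Alternating trilinear forms as iterated linear maps. -/
def triCLM : (C [⋀^Fin 3]→L[ℝ] ℝ) →L[ℝ] (C →L[ℝ] C →L[ℝ] C →L[ℝ] ℝ) :=
  let L₂ : ContinuousMultilinearMap ℝ (fun _ : Fin 2 => C) ℝ →L[ℝ] (C →L[ℝ] C →L[ℝ] ℝ) :=
    (ContinuousLinearMap.compL ℝ C _ (C →L[ℝ] ℝ)
      (continuousMultilinearCurryFin1 ℝ C ℝ).toContinuousLinearEquiv.toContinuousLinearMap).comp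
    (continuousMultilinearCurryLeftEquiv ℝ
      (fun _ : Fin 2 => C) ℝ).toContinuousLinearEquiv.toContinuousLinearMap
  (ContinuousLinearMap.compL ℝ C _ (C →L[ℝ] C →L[ℝ] ℝ) L₂).comp
    ((continuousMultilinearCurryLeftEquiv ℝ
      (fun _ : Fin 3 => C) ℝ).toContinuousLinearEquiv.toContinuousLinearMap.comp
      (ContinuousAlternatingMap.toContinuousMultilinearMapCLM ℝ))

theorem triCLM_apply (A : C [⋀^Fin 3]→L[ℝ] ℝ) (a b c : C) : triCLM A a b c = A ![a, b, c] := by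
  change A (Fin.cons a (Fin.cons b (fun _ => c))) = _
  congr 1
  ext i; fin_cases i <;> rfl

end Trilinear

/-! ### The pointwise cyclic sum behind the Jacobi identity -/

section LocalJacobi

variable {G C : Type*} [NormedAddCommGroup G] [NormedSpace ℝ G] [NormedAddCommGroup C]
  [NormedSpace ℝ C]

theorem fderiv_density {U : G → C} {f g : G → C →L[ℝ] ℝ} {P : C × C → (C →L[ℝ] ℝ) →L[ℝ] C} {q : G}
    (ξ τ : G) (hU : ContDiffAt ℝ ∞ U q) (hf : ContDiffAt ℝ ∞ f q) (hg : ContDiffAt ℝ ∞ g q)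
    (hP : ContDiffAt ℝ ∞ P (jet U ξ q))
    (hskew : ∀ a b : C →L[ℝ] ℝ, a (P (jet U ξ q) b) = -b (P (jet U ξ q) a)) :
    fderiv ℝ (fun q => f q (P (jet U ξ q) (g q))) q τ
      = fderiv ℝ f q τ (P (jet U ξ q) (g q)) - fderiv ℝ g q τ (P (jet U ξ q) (f q))
        + f q (fderiv ℝ P (jet U ξ q)
          (fderiv ℝ U q τ, fderiv ℝ (fun q => fderiv ℝ U q τ) q ξ) (g q)) := by
  have hj := contDiffAt_jet hU ξ
  have hPj : ContDiffAt ℝ ∞ (fun q => P (jet U ξ q)) q := hP.comp q hj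
  have hdP : fderiv ℝ (fun q => P (jet U ξ q)) q τ
      = fderiv ℝ P (jet U ξ q) (fderiv ℝ (jet U ξ) q τ) := by
    have := fderiv_comp q (hP.differentiableAt (by simp)) (hj.differentiableAt (by simp))
    exact congrArg (fun L => L τ) this
  rw [fderiv_pairing_apply hf (hPj.clm_apply hg), fderiv_pairing_apply hPj hg, hdP, fderiv_jet hU,
    map_add, hskew (f q) (fderiv ℝ g q τ)]
  ring

/-- The mixed second derivatives of U cancel, so only first derivatives of f survive. -/
theorem fderiv_antisymm {U : G → C} {f : G → C →L[ℝ] ℝ} {q : G} (v w : G)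
    (hU : ContDiffAt ℝ ∞ U q) (hf : ContDiffAt ℝ ∞ f q) :
    fderiv ℝ (fun q => f q (fderiv ℝ U q w)) q v - fderiv ℝ (fun q => f q (fderiv ℝ U q v)) q w
      = fderiv ℝ f q v (fderiv ℝ U q w) - fderiv ℝ f q w (fderiv ℝ U q v) := by
  rw [fderiv_pairing_apply hf (contDiffAt_fderiv_apply hU w),
    fderiv_pairing_apply hf (contDiffAt_fderiv_apply hU v), fderiv_fderiv_comm hU w v]
  ring

theorem fderiv_trilinear {U : G → C} {T : C → C →L[ℝ] C →L[ℝ] C →L[ℝ] ℝ} {q : G} (ξ x y z : G)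
    (hU : ContDiffAt ℝ ∞ U q) (hT : ContDiffAt ℝ ∞ T (U q)) :
    fderiv ℝ (fun q => T (U q) (fderiv ℝ U q x) (fderiv ℝ U q y) (fderiv ℝ U q z)) q ξ
      = fderiv ℝ T (U q) (fderiv ℝ U q ξ) (fderiv ℝ U q x) (fderiv ℝ U q y) (fderiv ℝ U q z)
        + T (U q) (fderiv ℝ (fun q => fderiv ℝ U q x) q ξ) (fderiv ℝ U q y) (fderiv ℝ U q z)
        + T (U q) (fderiv ℝ U q x) (fderiv ℝ (fun q => fderiv ℝ U q y) q ξ) (fderiv ℝ U q z)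
        + T (U q) (fderiv ℝ U q x) (fderiv ℝ U q y) (fderiv ℝ (fun q => fderiv ℝ U q z) q ξ) := by
  have hTU : ContDiffAt ℝ ∞ (fun q => T (U q)) q := hT.comp q hU
  have hdT : fderiv ℝ (fun q => T (U q)) q ξ = fderiv ℝ T (U q) (fderiv ℝ U q ξ) := by
    have := fderiv_comp q (hT.differentiableAt (by simp)) (hU.differentiableAt (by simp))
    exact congrArg (fun L => L ξ) this
  have h1 := hTU.clm_apply (contDiffAt_fderiv_apply hU x)
  have h2 := h1.clm_apply (contDiffAt_fderiv_apply hU y)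
  rw [fderiv_pairing_apply h2 (contDiffAt_fderiv_apply hU z),
    fderiv_pairing_apply h1 (contDiffAt_fderiv_apply hU y),
    fderiv_pairing_apply hTU (contDiffAt_fderiv_apply hU x), hdT]
  simp only [add_apply]

/-- The cyclic sum of the derivatives of the bracket densities in the directions of Hamiltonian vector
fields. -/
theorem fderiv_density_cyclic {U : G → C} {f g h : G → C →L[ℝ] ℝ}
    {P : ℕ → C × C → (C →L[ℝ] ℝ) →L[ℝ] C} {q : G} (ξ : G) (x y z : ℕ → G) (S : Finset (ℕ × ℕ))
    (hS : ∀ F : ℕ × ℕ → ℝ, ∑ p ∈ S, F p = ∑ p ∈ S, F p.swap)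
    (hU : ContDiffAt ℝ ∞ U q) (hf : ContDiffAt ℝ ∞ f q) (hg : ContDiffAt ℝ ∞ g q)
    (hh : ContDiffAt ℝ ∞ h q) (hP : ∀ n, ContDiffAt ℝ ∞ (P n) (jet U ξ q))
    (hskew : ∀ n, ∀ a b : C →L[ℝ] ℝ, a (P n (jet U ξ q) b) = -b (P n (jet U ξ q) a))
    (hx : ∀ p ∈ S, fderiv ℝ U q (x p.1) = P p.1 (jet U ξ q) (f q)
      ∧ fderiv ℝ U q (x p.2) = P p.2 (jet U ξ q) (f q))
    (hy : ∀ p ∈ S, fderiv ℝ U q (y p.1) = P p.1 (jet U ξ q) (g q)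
      ∧ fderiv ℝ U q (y p.2) = P p.2 (jet U ξ q) (g q))
    (hz : ∀ p ∈ S, fderiv ℝ U q (z p.1) = P p.1 (jet U ξ q) (h q)
      ∧ fderiv ℝ U q (z p.2) = P p.2 (jet U ξ q) (h q)) :
    ∑ p ∈ S, (fderiv ℝ (fun q => f q (P p.2 (jet U ξ q) (g q))) q (z p.1)
      + fderiv ℝ (fun q => g q (P p.2 (jet U ξ q) (h q))) q (x p.1)
      + fderiv ℝ (fun q => h q (P p.2 (jet U ξ q) (f q))) q (y p.1))
    = ∑ p ∈ S, ((fderiv ℝ (fun q => f q (fderiv ℝ U q (y p.2))) q (z p.1)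
          - fderiv ℝ (fun q => f q (fderiv ℝ U q (z p.1))) q (y p.2))
        + (fderiv ℝ (fun q => g q (fderiv ℝ U q (z p.2))) q (x p.1)
          - fderiv ℝ (fun q => g q (fderiv ℝ U q (x p.1))) q (z p.2))
        + (fderiv ℝ (fun q => h q (fderiv ℝ U q (x p.2))) q (y p.1)
          - fderiv ℝ (fun q => h q (fderiv ℝ U q (y p.1))) q (x p.2)))
      + ∑ p ∈ S, (f q (fderiv ℝ (P p.2) (jet U ξ q)
            (fderiv ℝ U q (z p.1), fderiv ℝ (fun q => fderiv ℝ U q (z p.1)) q ξ) (g q))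
          + g q (fderiv ℝ (P p.2) (jet U ξ q)
            (fderiv ℝ U q (x p.1), fderiv ℝ (fun q => fderiv ℝ U q (x p.1)) q ξ) (h q))
          + h q (fderiv ℝ (P p.2) (jet U ξ q)
            (fderiv ℝ U q (y p.1), fderiv ℝ (fun q => fderiv ℝ U q (y p.1)) q ξ) (f q))) := by
  -- These are the terms containing derivatives of the covectors. After subtraction of the
  -- antisymmetrized second variations they occur as `F p - F p.swap`, and S is invariant under the
  -- swap.
  let F : ℕ × ℕ → ℝ := fun p =>
    fderiv ℝ f q (y p.2) (fderiv ℝ U q (z p.1)) + fderiv ℝ g q (z p.2) (fderiv ℝ U q (x p.1))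
      + fderiv ℝ h q (x p.2) (fderiv ℝ U q (y p.1))
  rw [← sub_eq_zero, ← sub_sub, ← Finset.sum_sub_distrib, ← Finset.sum_sub_distrib]
  have h0 : ∑ p ∈ S, (F p - F p.swap) = 0 := by
    rw [Finset.sum_sub_distrib, ← hS F, sub_self]
  rw [← h0]
  refine Finset.sum_congr rfl fun p hp => ?_
  simp only [fderiv_antisymm _ _ hU hf, fderiv_antisymm _ _ hU hg, fderiv_antisymm _ _ hU hh]
  rw [fderiv_density ξ _ hU hf hg (hP _) (hskew _), fderiv_density ξ _ hU hg hh (hP _) (hskew _),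
    fderiv_density ξ _ hU hh hf (hP _) (hskew _)]
  simp only [F, Prod.fst_swap, Prod.snd_swap, (hx p hp).1, (hx p hp).2, (hy p hp).1, (hy p hp).2,
    (hz p hp).1, (hz p hp).2]
  ring

end LocalJacobi

/-! ### From the local identity to the Jacobi identity on the loop space -/

section Jacobi

variable {N : ℕ} {M : Type*} [TopologicalSpace M] [ChartedSpace (Coord N) M]

/-- A 3-form in the chart around `c`, as an iterated linear map. -/
def triForm (T : ThreeForm N M) (c : M) (y : Coord N) :
    Coord N →L[ℝ] Coord N →L[ℝ] Coord N →L[ℝ] ℝ :=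
  triCLM (T.inChart c y)

variable {E : Type*} [NormedAddCommGroup E] [NormedSpace ℝ E]

/-- The value of a 3-form on the derivatives of a family in three directions. -/
def famTri (T : ThreeForm N M) (Θ : E → Loop N M) (x y z : E) (q : E × ℝ) : ℝ :=
  T (Θ q.1 (q.2 : UnitAddCircle))
    ![mfderiv 𝓘(ℝ, E) (𝓡 N) (fun e => Θ e (q.2 : UnitAddCircle)) q.1 x,
      mfderiv 𝓘(ℝ, E) (𝓡 N) (fun e => Θ e (q.2 : UnitAddCircle)) q.1 y,
      mfderiv 𝓘(ℝ, E) (𝓡 N) (fun e => Θ e (q.2 : UnitAddCircle)) q.1 z]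

theorem IsClosedThreeForm.contDiffOn_triForm {T : ThreeForm N M} (hT : IsClosedThreeForm T) (c : M) :
    ContDiffOn ℝ ∞ (triForm T c) (chartAt (Coord N) c).target :=
  (ContinuousLinearMap.contDiff (𝕜 := ℝ) (triCLM (C := Coord N))).comp_contDiffOn (hT.smooth c)

theorem contDiffAt_triForm_inCoord {T : ThreeForm N M} (hT : IsClosedThreeForm T) {E : Type*} {W : Set E}
    {Θ : E → Loop N M} {c : M} {q : E × ℝ} (hq : q ∈ chartDom W Θ c) :
    ContDiffAt ℝ ∞ (triForm T c) (inCoord Θ c q) :=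
  (hT.contDiffOn_triForm c).contDiffAt ((chartAt (Coord N) c).open_target.mem_nhds
    ((chartAt (Coord N) c).map_source hq.2))

variable [IsManifold (𝓡 N) ∞ M]

theorem triForm_coframe (T : ThreeForm N M) {c p : M} (hp : p ∈ (chartAt (Coord N) c).source)
    (ξ η ζ : Tan N p) :
    triForm T c (chartAt (Coord N) c p) (coframe c p ξ) (coframe c p η) (coframe c p ζ)
      = T p ![ξ, η, ζ] := by
  rw [triForm, triCLM_apply]
  change T ((chartAt (Coord N) c).symm (chartAt (Coord N) c p))
    (frame c ((chartAt (Coord N) c).symm (chartAt (Coord N) c p)) ∘ _) = _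
  rw [(chartAt (Coord N) c).left_inv hp]
  congr 1
  ext1 i
  fin_cases i
  · exact frame_coframe hp ξ
  · exact frame_coframe hp η
  · exact frame_coframe hp ζ

variable {V : Set (Loop N M)} {W : Set E} {Θ : E → Loop N M} {T : ThreeForm N M}

theorem famTri_eventuallyEq (T : ThreeForm N M) (h : IsFamily W Θ) (x y z : E) {c : M}
    {q : E × ℝ} (hq : q ∈ chartDom W Θ c) :
    famTri T Θ x y z =ᶠ[𝓝 q] fun q => triForm T c (inCoord Θ c q) (fderiv ℝ (inCoord Θ c) q (x, 0))
      (fderiv ℝ (inCoord Θ c) q (y, 0)) (fderiv ℝ (inCoord Θ c) q (z, 0)) := by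
  filter_upwards [(h.isOpen_chartDom c).mem_nhds hq] with q' hq'
  rw [← h.coframe_mfderiv_param hq', ← h.coframe_mfderiv_param hq', ← h.coframe_mfderiv_param hq',
    inCoord, triForm_coframe T hq'.2]
  rfl

theorem contDiffAt_famTri (hT : IsClosedThreeForm T) (h : IsFamily W Θ) (x y z : E) (q : E × ℝ)
    (hq : q.1 ∈ W) : ContDiffAt ℝ ∞ (famTri T Θ x y z) q := by
  have hc : q ∈ chartDom W Θ (Θ q.1 (q.2 : UnitAddCircle)) := ⟨hq, mem_chart_source _ _⟩
  refine ContDiffAt.congr_of_eventuallyEq ?_ (famTri_eventuallyEq T h x y z hc)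
  have hU := h.contDiffAt_inCoord hc
  exact ((((contDiffAt_triForm_inCoord hT hc).comp q hU).clm_apply
    (contDiffAt_fderiv_apply hU _)).clm_apply (contDiffAt_fderiv_apply hU _)).clm_apply
    (contDiffAt_fderiv_apply hU _)

/-- The algebraic identity in charts, for the operators `P n`, that underlies the Jacobi identity: the
cyclic sums over `S` of the derivatives of the operators along Hamiltonian vector fields are total
derivatives of values of `T`. -/
def IsJacobiTriple (T : ThreeForm N M) (O : ∀ p : M, Set (Tan N p)) (P : ℕ → MatrixOperator N M)
    (m : ℕ) (S : Finset (ℕ × ℕ)) (S₃ : Finset (ℕ × ℕ × ℕ)) (ε : ℝ) : Prop :=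
  ∀ (c : M), ∀ w ∈ opDom O c, ∀ (f g h : Coord N →L[ℝ] ℝ) (X Y Z X' Y' Z' : ℕ → Coord N),
    (∀ a ≤ m, X a = opCoord (P a) c w f) → (∀ a ≤ m, Y a = opCoord (P a) c w g) →
    (∀ a ≤ m, Z a = opCoord (P a) c w h) →
    ∑ p ∈ S, (f (fderiv ℝ (opCoord (P p.2) c) w (Z p.1, Z' p.1) g)
        + g (fderiv ℝ (opCoord (P p.2) c) w (X p.1, X' p.1) h)
        + h (fderiv ℝ (opCoord (P p.2) c) w (Y p.1, Y' p.1) f))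
      = ε * ∑ t ∈ S₃, (fderiv ℝ (triForm T c) w.1 w.2 (X t.1) (Y t.2.1) (Z t.2.2)
        + triForm T c w.1 (X' t.1) (Y t.2.1) (Z t.2.2)
        + triForm T c w.1 (X t.1) (Y' t.2.1) (Z t.2.2)
        + triForm T c w.1 (X t.1) (Y t.2.1) (Z' t.2.2))

variable [FiniteDimensional ℝ E]
variable {P : ℕ → MatrixOperator N M} {O : ∀ p : M, Set (Tan N p)} {f g k : CovectorField N M}
  {I J K : Loop N M → ℝ}

/-- The outer bracket pairs d with the Hamiltonian field of k, which is the derivative of Θ in the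
direction z. So it is the derivative of the inner bracket in that direction, and this can also be
found by differentiating the inner density under the integral. -/
theorem bracket_bracket_eq {Q R : MatrixOperator N M} (hR : IsSmoothSkewOn O R)
    (hI : HasVariationalDeriv V I f) (hJ : HasVariationalDeriv V J g) {d : CovectorField N M}
    (hd : HasVariationalDeriv V (bracket R f g) d) (h : IsFamily W Θ) (hV : ∀ e ∈ W, Θ e ∈ V)
    (hO : ∀ e ∈ W, ∀ x, (Θ e).vel x ∈ O (Θ e x)) {z e : E} (he : e ∈ W)
    (hz : IsHamiltonianDir Q k Θ z e) :
    bracket Q d k (Θ e) = ∫ x in (0 : ℝ)..1, fderiv ℝ (famDensity R f g Θ) (e, x) (z, 0) := by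
  rw [← (hd.hasDerivAt_family h hV he z).unique (hasDerivAt_bracket_family hR hI hJ h hV hO he z),
    bracket_eq_integral_density]
  refine intervalIntegral.integral_congr fun x _ => ?_
  have hq : (e, x) ∈ chartDom W Θ (Θ e (x : UnitAddCircle)) := ⟨he, mem_chart_source _ _⟩
  simp only [density, pairing]
  congr 1
  exact coframe_injective (mem_chart_source _ _)
    ((h.coframe_mfderiv_param hq z).trans (hz x _ hq.2)).symm

/-- The computation uses a chart around the point in question, but every term is a function defined
along the whole loop. The identity can therefore be integrated over the circle, although the loop
may leave every chart. -/
theorem sum_fderiv_famDensity_eq (hT : IsClosedThreeForm T) (hP : ∀ n, IsSmoothSkewOn O (P n))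
    {m : ℕ} {S : Finset (ℕ × ℕ)} {S₃ : Finset (ℕ × ℕ × ℕ)} {ε : ℝ}
    (hS : ∀ F : ℕ × ℕ → ℝ, ∑ p ∈ S, F p = ∑ p ∈ S, F p.swap)
    (hSm : ∀ p ∈ S, p.1 ≤ m ∧ p.2 ≤ m) (hJac : IsJacobiTriple T O P m S S₃ ε)
    (hI : HasVariationalDeriv V I f) (hJ : HasVariationalDeriv V J g)
    (hK : HasVariationalDeriv V K k) (h : IsFamily W Θ) (hV : ∀ e ∈ W, Θ e ∈ V)
    (hO : ∀ e ∈ W, ∀ x, (Θ e).vel x ∈ O (Θ e x)) {x y z : ℕ → E} {e : E} (he : e ∈ W)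
    (hx : ∀ a ≤ m, IsHamiltonianDir (P a) f Θ (x a) e)
    (hy : ∀ a ≤ m, IsHamiltonianDir (P a) g Θ (y a) e)
    (hz : ∀ a ≤ m, IsHamiltonianDir (P a) k Θ (z a) e) (u : ℝ) :
    ∑ p ∈ S, (fderiv ℝ (famDensity (P p.2) f g Θ) (e, u) (z p.1, 0)
      + fderiv ℝ (famDensity (P p.2) g k Θ) (e, u) (x p.1, 0)
      + fderiv ℝ (famDensity (P p.2) k f Θ) (e, u) (y p.1, 0))
    = ∑ p ∈ S, ((fderiv ℝ (pairing f Θ (y p.2)) (e, u) (z p.1, 0)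
          - fderiv ℝ (pairing f Θ (z p.1)) (e, u) (y p.2, 0))
        + (fderiv ℝ (pairing g Θ (z p.2)) (e, u) (x p.1, 0)
          - fderiv ℝ (pairing g Θ (x p.1)) (e, u) (z p.2, 0))
        + (fderiv ℝ (pairing k Θ (x p.2)) (e, u) (y p.1, 0)
          - fderiv ℝ (pairing k Θ (y p.1)) (e, u) (x p.2, 0)))
      + ε * ∑ t ∈ S₃, fderiv ℝ (famTri T Θ (x t.1) (y t.2.1) (z t.2.2)) (e, u) (0, 1) := by
  obtain ⟨c, hq⟩ : ∃ c, (e, u) ∈ chartDom W Θ c := ⟨_, he, mem_chart_source _ _⟩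
  have hU := h.contDiffAt_inCoord hq
  have hf := hI.contDiffAt_covCoord h hV hq
  have hg := hJ.contDiffAt_covCoord h hV hq
  have hk := hK.contDiffAt_covCoord h hV hq
  have hT' := contDiffAt_triForm_inCoord hT hq
  have hjet := h.jet_inCoord hq
  have hx' := fun a ha => (hx a ha).fderiv_eq h hq
  have hy' := fun a ha => (hy a ha).fderiv_eq h hq
  have hz' := fun a ha => (hz a ha).fderiv_eq h hq
  have hD := fun (Q : MatrixOperator N M) (f g : CovectorField N M) => (famDensity_eventuallyEq Q f g h hq).fderiv_eq (𝕜 := ℝ)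
  have hp := fun (f : CovectorField N M) v => (pairing_eventuallyEq f h hq v).fderiv_eq (𝕜 := ℝ)
  have hτ := fun x y z => congrArg (fun L => L ((0, 1) : E × ℝ))
    ((famTri_eventuallyEq T h x y z hq).fderiv_eq (𝕜 := ℝ))
  have hτ' := fun x y z => (hτ x y z).trans (fderiv_trilinear (0, 1) (x, 0) (y, 0) (z, 0) hU hT')
  simp only [hD, hp, hτ']
  rw [fderiv_density_cyclic (0, 1) (fun a => (x a, 0)) (fun a => (y a, 0)) (fun a => (z a, 0)) S hS
    hU hf hg hk (fun n => (hP n).contDiffAt_opCoord h hO hq)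
    (fun n a b => by
      rw [hjet]
      exact opCoord_skew hq.2 ((hP n).skew _ _ (hO _ hq.1 _)) a b)
    (fun p hp => ⟨hx' _ (hSm p hp).1, hx' _ (hSm p hp).2⟩)
    (fun p hp => ⟨hy' _ (hSm p hp).1, hy' _ (hSm p hp).2⟩)
    (fun p hp => ⟨hz' _ (hSm p hp).1, hz' _ (hSm p hp).2⟩)]
  have hmem : jet (inCoord Θ c) (0, 1) (e, u) ∈ opDom O c := by
    rw [hjet]
    exact mem_opDom hq.2 (hO _ hq.1 _)
  have key := hJac c _ hmem (covCoord f c (Θ e) (u : UnitAddCircle))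
    (covCoord g c (Θ e) (u : UnitAddCircle)) (covCoord k c (Θ e) (u : UnitAddCircle))
    (fun a => fderiv ℝ (inCoord Θ c) (e, u) (x a, 0))
    (fun a => fderiv ℝ (inCoord Θ c) (e, u) (y a, 0))
    (fun a => fderiv ℝ (inCoord Θ c) (e, u) (z a, 0))
    (fun a => fderiv ℝ (fun q => fderiv ℝ (inCoord Θ c) q (x a, 0)) (e, u) (0, 1))
    (fun a => fderiv ℝ (fun q => fderiv ℝ (inCoord Θ c) q (y a, 0)) (e, u) (0, 1))
    (fun a => fderiv ℝ (fun q => fderiv ℝ (inCoord Θ c) q (z a, 0)) (e, u) (0, 1)) hx' hy' hz'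
  refine congrArg₂ (· + ·) rfl ?_
  simp only [jet] at key ⊢
  exact key

variable [T2Space M] [SecondCountableTopology M]

/-- All three double brackets become integrals over one family through γ. In the integrated cyclic
sum the differences of second variations vanish by symmetry and the derivatives of `famTri` by
periodicity. -/
theorem sum_bracket_bracket_eq_zero (hT : IsClosedThreeForm T)
    (hP : ∀ n, IsSmoothSkewOn O (P n)) {m : ℕ} {S : Finset (ℕ × ℕ)} {S₃ : Finset (ℕ × ℕ × ℕ)} {ε : ℝ}
    (hS : ∀ F : ℕ × ℕ → ℝ, ∑ p ∈ S, F p = ∑ p ∈ S, F p.swap)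
    (hSm : ∀ p ∈ S, p.1 ≤ m ∧ p.2 ≤ m) (hJac : IsJacobiTriple T O P m S S₃ ε)
    (hV : IsLoopOpen V) (hVO : ∀ γ ∈ V, ∀ x, γ.vel x ∈ O (γ x))
    (hI : HasVariationalDeriv V I f) (hJ : HasVariationalDeriv V J g)
    (hK : HasVariationalDeriv V K k) {dfg dgk dkf : ℕ → CovectorField N M}
    (hfg : ∀ b, HasVariationalDeriv V (bracket (P b) f g) (dfg b))
    (hgk : ∀ b, HasVariationalDeriv V (bracket (P b) g k) (dgk b))
    (hkf : ∀ b, HasVariationalDeriv V (bracket (P b) k f) (dkf b)) {γ : Loop N M} (hγ : γ ∈ V) :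
    ∑ p ∈ S, (bracket (P p.1) (dfg p.2) k γ + bracket (P p.1) (dgk p.2) f γ
      + bracket (P p.1) (dkf p.2) g γ) = 0 := by
  let d : Fin 3 → CovectorField N M := ![f, g, k]
  -- The starting family is constant, over an idle real parameter; it receives one new direction for
  -- each of the three functionals and each order `a ≤ m`.
  obtain ⟨W₁, Θ, hf₁, h01, -, hΘ0, hX⟩ :=
    (isFamily_const (E := ℝ) γ).exists_extension (Set.mem_univ 0) (ι := Fin 3 × Fin (m + 1))
      (fun i e x => P i.2 (γ x) (γ.vel x) (d i.1 γ x))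
      (fun i c => by
        obtain ⟨j, a⟩ := i
        fin_cases j
        · exact contDiffOn_hamiltonian (hP a) hI (isFamily_const γ) (fun _ _ => hγ)
            (fun _ _ => hVO _ hγ) c
        · exact contDiffOn_hamiltonian (hP a) hJ (isFamily_const γ) (fun _ _ => hγ)
            (fun _ _ => hVO _ hγ) c
        · exact contDiffOn_hamiltonian (hP a) hK (isFamily_const γ) (fun _ _ => hγ)
            (fun _ _ => hVO _ hγ) c)
  have hW₂ := hV.isOpen_family hf₁
  set W : Set (ℝ × (Fin 3 × Fin (m + 1) → ℝ)) := {p | p ∈ W₁ ∧ Θ p ∈ V} with hWd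
  have h : IsFamily W Θ := hf₁.mono hW₂ (fun p hp => hp.1)
  have hWV : ∀ p ∈ W, Θ p ∈ V := fun p hp => hp.2
  have hWO : ∀ p ∈ W, ∀ x, (Θ p).vel x ∈ O (Θ p x) := fun p hp => hVO _ hp.2
  have he : ((0, 0) : ℝ × (Fin 3 × Fin (m + 1) → ℝ)) ∈ W := ⟨h01, by rw [hΘ0]; exact hγ⟩
  -- `Fin.ofNat` reduces modulo `m + 1`, so these directions have the intended meaning only for `a ≤
  -- m`; no other orders occur in S.
  let X : Fin 3 → ℕ → ℝ × (Fin 3 × Fin (m + 1) → ℝ) :=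
    fun j a => (0, Pi.single (j, Fin.ofNat (m + 1) a) 1)
  have hXd : ∀ j a, a ≤ m → IsHamiltonianDir (P a) (d j) Θ (X j a) (0, 0) := by
    intro j a ha x c hx
    rw [hΘ0] at hx ⊢
    have h1 := hX 0 x c (j, Fin.ofNat (m + 1) a) h01 hx
    rwa [Fin.val_ofNat, Nat.mod_eq_of_lt (Nat.lt_succ_of_le ha)] at h1
  have hx : ∀ a ≤ m, IsHamiltonianDir (P a) f Θ (X 0 a) (0, 0) := fun a ha => hXd 0 a ha
  have hy : ∀ a ≤ m, IsHamiltonianDir (P a) g Θ (X 1 a) (0, 0) := fun a ha => hXd 1 a ha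
  have hz : ∀ a ≤ m, IsHamiltonianDir (P a) k Θ (X 2 a) (0, 0) := fun a ha => hXd 2 a ha
  have hD : ∀ {F G : Loop N M → ℝ} {φ ψ : CovectorField N M}, HasVariationalDeriv V F φ →
      HasVariationalDeriv V G ψ → ∀ n w, IntervalIntegrable
        (fun u => fderiv ℝ (famDensity (P n) φ ψ Θ) ((0, 0), u) w) MeasureTheory.volume 0 1 :=
    fun hF hG n w => (continuous_fderiv_slice
      (fun q hq => contDiffAt_famDensity (hP n) hF hG h hWV hWO q hq) he w).intervalIntegrable _ _
  have hp : ∀ {F : Loop N M → ℝ} {φ : CovectorField N M}, HasVariationalDeriv V F φ → ∀ v w,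
      IntervalIntegrable (fun u => fderiv ℝ (pairing φ Θ v) ((0, 0), u) w)
        MeasureTheory.volume 0 1 :=
    fun hF v w => (continuous_fderiv_slice
      (fun q hq => hF.contDiffAt_pairing h hWV v q hq) he w).intervalIntegrable _ _
  have hτ : ∀ x y z w, IntervalIntegrable (fun u => fderiv ℝ (famTri T Θ x y z) ((0, 0), u) w)
        MeasureTheory.volume 0 1 :=
    fun x y z w => (continuous_fderiv_slice
      (fun q hq => contDiffAt_famTri hT h x y z q hq) he w).intervalIntegrable _ _
  have hanti : ∀ {F : Loop N M → ℝ} {φ : CovectorField N M}, HasVariationalDeriv V F φ → ∀ v w,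
      ∫ u in (0 : ℝ)..1, (fderiv ℝ (pairing φ Θ v) ((0, 0), u) (w, 0)
        - fderiv ℝ (pairing φ Θ w) ((0, 0), u) (v, 0)) = 0 := by
    intro F φ hF v w
    rw [intervalIntegral.integral_sub (hp hF _ _) (hp hF _ _),
      hF.second_variation_symm h hWV he v w, sub_self]
  have hper : ∀ x y z, ∫ u in (0 : ℝ)..1, fderiv ℝ (famTri T Θ x y z) ((0, 0), u) (0, 1) = 0 :=
    fun x y z => integral_fderiv_circle (fun q hq => contDiffAt_famTri hT h x y z q hq) he
      (congrArg (fun u : UnitAddCircle => T (Θ (0, 0) u)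
        ![mfderiv 𝓘(ℝ, ℝ × (Fin 3 × Fin (m + 1) → ℝ)) (𝓡 N) (fun e => Θ e u) (0, 0) x,
          mfderiv 𝓘(ℝ, ℝ × (Fin 3 × Fin (m + 1) → ℝ)) (𝓡 N) (fun e => Θ e u) (0, 0) y,
          mfderiv 𝓘(ℝ, ℝ × (Fin 3 × Fin (m + 1) → ℝ)) (𝓡 N) (fun e => Θ e u) (0, 0) z])
        (show ((1 : ℝ) : UnitAddCircle) = ((0 : ℝ) : UnitAddCircle) by simp))
  have hsum : ∀ {α : Type} {s : Finset α} {F : α → ℝ → ℝ},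
      (∀ i ∈ s, IntervalIntegrable (F i) MeasureTheory.volume 0 1) →
      IntervalIntegrable (fun u => ∑ i ∈ s, F i u) MeasureTheory.volume 0 1 := by
    intro α s F hF
    have := IntervalIntegrable.sum s hF
    rwa [Finset.sum_fn] at this
  have hγ0 : γ = Θ (0, 0) := (hΘ0 0).symm
  calc _ = ∑ p ∈ S, ∫ u in (0 : ℝ)..1,
        (fderiv ℝ (famDensity (P p.2) f g Θ) ((0, 0), u) (X 2 p.1, 0)
        + fderiv ℝ (famDensity (P p.2) g k Θ) ((0, 0), u) (X 0 p.1, 0)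
        + fderiv ℝ (famDensity (P p.2) k f Θ) ((0, 0), u) (X 1 p.1, 0)) := by
        refine Finset.sum_congr rfl fun p hpS => ?_
        have hm := (hSm p hpS).1
        rw [hγ0, bracket_bracket_eq (hP _) hI hJ (hfg _) h hWV hWO he (hz _ hm),
          bracket_bracket_eq (hP _) hJ hK (hgk _) h hWV hWO he (hx _ hm),
          bracket_bracket_eq (hP _) hK hI (hkf _) h hWV hWO he (hy _ hm),
          intervalIntegral.integral_add ((hD hI hJ _ _).add (hD hJ hK _ _)) (hD hK hI _ _),
          intervalIntegral.integral_add (hD hI hJ _ _) (hD hJ hK _ _)]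
    _ = ∫ u in (0 : ℝ)..1, ∑ p ∈ S,
        (fderiv ℝ (famDensity (P p.2) f g Θ) ((0, 0), u) (X 2 p.1, 0)
        + fderiv ℝ (famDensity (P p.2) g k Θ) ((0, 0), u) (X 0 p.1, 0)
        + fderiv ℝ (famDensity (P p.2) k f Θ) ((0, 0), u) (X 1 p.1, 0)) :=
      (intervalIntegral.integral_finsetSum fun p _ =>
        ((hD hI hJ _ _).add (hD hJ hK _ _)).add (hD hK hI _ _)).symm
    _ = _ := by
      simp only [sum_fderiv_famDensity_eq hT hP hS hSm hJac hI hJ hK h hWV hWO he hx hy hz]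
      rw [intervalIntegral.integral_add, intervalIntegral.integral_finsetSum,
        intervalIntegral.integral_const_mul, intervalIntegral.integral_finsetSum]
      · rw [Finset.sum_eq_zero, Finset.sum_eq_zero, mul_zero, add_zero]
        · exact fun t _ => hper _ _ _
        · intro p _
          rw [intervalIntegral.integral_add, intervalIntegral.integral_add, hanti hI, hanti hJ,
            hanti hK, add_zero, add_zero]
          · exact (hp hI _ _).sub (hp hI _ _)
          · exact (hp hJ _ _).sub (hp hJ _ _)
          · exact ((hp hI _ _).sub (hp hI _ _)).add ((hp hJ _ _).sub (hp hJ _ _))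
          · exact (hp hK _ _).sub (hp hK _ _)
      · exact fun t _ => hτ _ _ _ _
      · exact fun p _ => (((hp hI _ _).sub (hp hI _ _)).add ((hp hJ _ _).sub (hp hJ _ _))).add
          ((hp hK _ _).sub (hp hK _ _))
      · exact hsum fun p _ => (((hp hI _ _).sub (hp hI _ _)).add
          ((hp hJ _ _).sub (hp hJ _ _))).add ((hp hK _ _).sub (hp hK _ _))
      · exact (hsum fun t _ => hτ _ _ _ _).const_mul _

end Jacobi

/-! ### Linear algebra of skew maps: skew-symmetry of the operators -/

section Skew

variable {V : Type*} [AddCommGroup V] [Module ℝ V] {B : Module.Dual ℝ V →ₗ[ℝ] V}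
  {τ : V →ₗ[ℝ] Module.Dual ℝ V}

/-- The skew-symmetry of `A = (1 + ε B τ)⁻¹ B`. -/
theorem deformed_skew {A : Module.Dual ℝ V → V} {ε : ℝ} (hA : ∀ a, A a + ε • B (τ (A a)) = B a)
    (hB : ∀ a b : Module.Dual ℝ V, a (B b) = -b (B a)) (hτ : ∀ x y, τ x y = -τ y x)
    (f g : Module.Dual ℝ V) : f (A g) = -g (A f) := by
  -- This is the identity `A = B (1 - ε τ A)`. It expresses `f (A g)` through B and τ in a form
  -- whose antisymmetry in f and g is visible.
  have hX : ∀ f, B (f - ε • τ (A f)) = A f := fun f => by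
    rw [map_sub, map_smul, sub_eq_iff_eq_add]
    exact (hA f).symm
  have h1 : ∀ f g, f (A g) = (f - ε • τ (A f)) (B (g - ε • τ (A g))) + ε * τ (A f) (A g) := by
    intro f g
    rw [hX]
    simp
  rw [h1, h1 g f, hB, hτ]
  ring

/-- Since B and τ are both skew, `-τ B` is self-adjoint for the bilinear form `f (B g)`; its powers
move from one argument to the other without a sign. -/
theorem series_skew (hB : ∀ a b : Module.Dual ℝ V, a (B b) = -b (B a))
    (hτ : ∀ x y, τ x y = -τ y x) (n : ℕ) (f g : Module.Dual ℝ V) :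
    f (B (((-(τ ∘ₗ B)) ^ n) g)) = -g (B (((-(τ ∘ₗ B)) ^ n) f)) := by
  have h1 : ∀ f g : Module.Dual ℝ V, f (B ((-(τ ∘ₗ B)) g)) = ((-(τ ∘ₗ B)) f) (B g) := fun f g => by
    rw [hB]
    simpa using hτ (B g) (B f)
  have h2 : ∀ (n : ℕ) (f g : Module.Dual ℝ V),
      f (B (((-(τ ∘ₗ B)) ^ n) g)) = (((-(τ ∘ₗ B)) ^ n) f) (B g) := by
    intro n
    induction n with
    | zero => exact fun f g => rfl
    | succ n ih =>
      intro f g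
      rw [pow_succ', Module.End.mul_apply, h1, ih, ← Module.End.mul_apply, ← pow_succ, pow_succ']
  rw [h2, hB]

end Skew

/-! ### Coefficients of the expansion and derivatives of the operators -/

section Series

variable {H C : Type*} [NormedAddCommGroup C] [NormedSpace ℝ C]
  {B : H → (C →L[ℝ] ℝ) →L[ℝ] C} {τ : H → C →L[ℝ] C →L[ℝ] ℝ}

/-- The coefficients `B (-τ B) ^ n` of the expansion of `(1 + ε B τ)⁻¹ B`. -/
def seriesOp (B : H → (C →L[ℝ] ℝ) →L[ℝ] C) (τ : H → C →L[ℝ] C →L[ℝ] ℝ) (n : ℕ) (z : H) :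
    (C →L[ℝ] ℝ) →L[ℝ] C :=
  B z ∘L (-(τ z ∘L B z)) ^ n
theorem seriesOp_zero : seriesOp B τ 0 = B := by
  ext z a
  simp [seriesOp]

theorem seriesOp_succ_apply (n : ℕ) (z : H) (a : C →L[ℝ] ℝ) :
    seriesOp B τ (n + 1) z a = -B z (τ z (seriesOp B τ n z a)) := by
  simp [seriesOp, pow_succ']

end Series

section Algebra

variable {H C : Type*} [NormedAddCommGroup H] [NormedSpace ℝ H] [NormedAddCommGroup C]
  [NormedSpace ℝ C] {B : H → (C →L[ℝ] ℝ) →L[ℝ] C} {τ : H → C →L[ℝ] C →L[ℝ] ℝ} {w : H}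

/-- The derivative of `A = (1 + ε B τ)⁻¹ B`. -/
theorem fderiv_deformed_apply {A : H → (C →L[ℝ] ℝ) →L[ℝ] C} {ε : ℝ} (hω : ContDiffAt ℝ ∞ B w)
    (hτ : ContDiffAt ℝ ∞ τ w) (hA : ContDiffAt ℝ ∞ A w)
    (hAω : ∀ᶠ z in 𝓝 w, ∀ a, A z a + ε • B z (τ z (A z a)) = B z a)
    (hωs : ∀ a b : C →L[ℝ] ℝ, a (B w b) = -b (B w a)) (hτs : ∀ x y, τ w x y = -τ w y x) (η : H)
    (f g : C →L[ℝ] ℝ) :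
    f (fderiv ℝ A w η g)
      = (f - ε • τ w (A w f)) (fderiv ℝ B w η (g - ε • τ w (A w g)))
        + ε * fderiv ℝ τ w η (A w g) (A w f) := by
  have hc : ∀ a : C →L[ℝ] ℝ, ContDiffAt ℝ ∞ (fun _ : H => a) w := fun a => contDiffAt_const
  have hAg := hA.clm_apply (hc g)
  have hτA := hτ.clm_apply hAg
  have h0 : ∀ (L : H → (C →L[ℝ] ℝ) →L[ℝ] C), ContDiffAt ℝ ∞ L w →
      fderiv ℝ (fun z => L z g) w η = fderiv ℝ L w η g := fun L hL => by
    rw [fderiv_pairing_apply hL (hc g), fderiv_fun_const]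
    simp
  have h1 : fderiv ℝ (fun z => A z g + ε • B z (τ z (A z g))) w η = fderiv ℝ B w η g := by
    rw [← h0 B hω]
    exact congrArg (fun L : H →L[ℝ] C => L η)
      (Filter.EventuallyEq.fderiv_eq (𝕜 := ℝ) (hAω.mono fun z hz => hz g))
  have h2 : fderiv ℝ (fun z => A z g + ε • B z (τ z (A z g))) w
      = fderiv ℝ (fun z => A z g) w + ε • fderiv ℝ (fun z => B z (τ z (A z g))) w := by
    have hd := (hω.clm_apply hτA).differentiableAt (by simp)
    rw [fderiv_fun_add (hAg.differentiableAt (by simp)) (hd.fun_const_smul ε),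
      fderiv_fun_const_smul hd]
  rw [h2, add_apply, smul_apply, fderiv_pairing_apply hω hτA,
    fderiv_pairing_apply hτ hAg, h0 A hA] at h1
  have hX : B w (f - ε • τ w (A w f)) = A w f := by
    rw [map_sub, map_smul, sub_eq_iff_eq_add]
    exact (hAω.self_of_nhds f).symm
  -- This is the transpose of `1 + ε B τ`: testing with the shifted covector after applying the
  -- matrix is testing with f. It replaces inversion of the matrix in the differentiated identity.
  have hα : ∀ u, f u = (f - ε • τ w (A w f)) (u + ε • B w (τ w u)) := by
    intro u
    rw [map_add, map_smul, hωs _ (τ w u), hX, hτs u]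
    simp
  have h3 := hα (fderiv ℝ A w η g)
  have h4 : fderiv ℝ A w η g + ε • B w (τ w (fderiv ℝ A w η g))
      = fderiv ℝ B w η (g - ε • τ w (A w g)) - ε • B w (fderiv ℝ τ w η (A w g)) := by
    rw [map_sub, map_smul, ← h1, map_add]
    module
  rw [h3, h4, map_sub, map_smul, hωs _ (fderiv ℝ τ w η (A w g)), hX]
  simp

theorem contDiffAt_seriesOp (hω : ContDiffAt ℝ ∞ B w) (hτ : ContDiffAt ℝ ∞ τ w) (n : ℕ) :
    ContDiffAt ℝ ∞ (seriesOp B τ n) w := by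
  refine hω.clm_comp ?_
  exact (hτ.clm_comp hω).neg.pow n

/-- The Leibniz rule for `B (-τ B)ⁿ`: the factors to the left of the differentiated one are moved
onto f by skew-symmetry. A derivative of τ uses up one of the n factors τ, hence the orders i and `n
- 1 - i`; for `n = 0` that sum is empty, so the truncated subtraction does no harm. -/
theorem fderiv_seriesOp_apply (hω : ContDiffAt ℝ ∞ B w) (hτ : ContDiffAt ℝ ∞ τ w)
    (hωs : ∀ a b : C →L[ℝ] ℝ, a (B w b) = -b (B w a)) (hτs : ∀ x y, τ w x y = -τ w y x) (η : H)
    (n : ℕ) (f g : C →L[ℝ] ℝ) :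
    f (fderiv ℝ (seriesOp B τ n) w η g)
      = ∑ i ∈ Finset.range (n + 1), (((-(τ w ∘L B w)) ^ i) f)
          (fderiv ℝ B w η (((-(τ w ∘L B w)) ^ (n - i)) g))
        + ∑ i ∈ Finset.range n,
          fderiv ℝ τ w η (seriesOp B τ (n - 1 - i) w g) (seriesOp B τ i w f) := by
  have hc : ContDiffAt ℝ ∞ (fun _ : H => g) w := contDiffAt_const
  have h0 : ∀ (L : H → (C →L[ℝ] ℝ) →L[ℝ] C), ContDiffAt ℝ ∞ L w →
      fderiv ℝ L w η g = fderiv ℝ (fun z => L z g) w η := fun L hL => by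
    rw [fderiv_pairing_apply hL hc, fderiv_fun_const]
    simp
  induction n generalizing f with
  | zero => simp [seriesOp_zero]
  | succ n ih =>
    have hn := contDiffAt_seriesOp hω hτ n
    have hng := hn.clm_apply hc
    have h1 : fderiv ℝ (seriesOp B τ (n + 1)) w η g
        = -(fderiv ℝ B w η (τ w (seriesOp B τ n w g))
          + B w (fderiv ℝ τ w η (seriesOp B τ n w g)
            + τ w (fderiv ℝ (seriesOp B τ n) w η g))) := by
      rw [h0 _ (contDiffAt_seriesOp hω hτ (n + 1)), h0 _ hn]
      simp only [seriesOp_succ_apply]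
      rw [fderiv_fun_neg, neg_apply, fderiv_pairing_apply hω (hτ.clm_apply hng),
        fderiv_pairing_apply hτ hng]
    have h2 : ∀ u, f (B w (τ w u)) = -((-(τ w ∘L B w)) f) u := fun u => by
      rw [hωs, hτs u]
      simp
    have h3 : τ w (seriesOp B τ n w g) = -(((-(τ w ∘L B w)) ^ (n + 1)) g) := by
      simp [seriesOp, pow_succ']
    have h4 : ∀ i, seriesOp B τ i w ((-(τ w ∘L B w)) f) = seriesOp B τ (i + 1) w f := fun i => by
      simp only [seriesOp, pow_succ]; rfl
    have h5 : ∀ i, ((-(τ w ∘L B w)) ^ i) ((-(τ w ∘L B w)) f) = ((-(τ w ∘L B w)) ^ (i + 1)) f :=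
      fun i => by rw [pow_succ]; rfl
    rw [h1, map_neg, map_add, map_add, map_add, h2, ih, h3, map_neg, map_neg,
      hωs f (fderiv ℝ τ w η _)]
    rw [Finset.sum_range_succ' (fun i => ((-(τ w ∘L B w)) ^ i) f _) (n + 1),
      Finset.sum_range_succ'
        (fun i => fderiv ℝ τ w η (seriesOp B τ (n + 1 - 1 - i) w g) (seriesOp B τ i w f)) n]
    have h6 : ∀ i, n - 1 - i = n - (i + 1) := fun i => by omega
    have h7 : ∀ u, (1 : (C →L[ℝ] ℝ) →L[ℝ] (C →L[ℝ] ℝ)) u = u := fun _ => rfl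
    simp only [h4, h5, h6, h7, Nat.add_sub_add_right, Nat.sub_zero, pow_zero, seriesOp_zero,
      Nat.add_sub_cancel]
    ring

end Algebra

/-! ### Sums over triples of orders -/

section TripleSum

/-- The triples of natural numbers whose sum increased by `e` is `n`. -/
def triples (n e : ℕ) : Finset (ℕ × ℕ × ℕ) :=
  (Finset.range (n + 1) ×ˢ Finset.range (n + 1) ×ˢ Finset.range (n + 1)).filter
    fun t => t.1 + t.2.1 + t.2.2 + e = n

theorem mem_triples {n e : ℕ} {t : ℕ × ℕ × ℕ} :
    t ∈ triples n e ↔ t.1 + t.2.1 + t.2.2 + e = n := by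
  simp only [triples, Finset.mem_filter, Finset.mem_product, Finset.mem_range]
  omega

theorem sum_triples_rotate (n e : ℕ) (F : ℕ → ℕ → ℕ → ℝ) :
    ∑ t ∈ triples n e, F t.2.1 t.2.2 t.1 = ∑ t ∈ triples n e, F t.1 t.2.1 t.2.2 := by
  refine Finset.sum_nbij' (fun t => (t.2.1, t.2.2, t.1)) (fun t => (t.2.2, t.1, t.2.1)) ?_ ?_ ?_ ?_
    ?_ <;> intro t ht <;> first | rfl | (rw [mem_triples] at *; dsimp only; omega)

theorem sum_antidiagonal_range (n e : ℕ) (F : ℕ → ℕ → ℕ → ℝ) :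
    ∑ p ∈ Finset.HasAntidiagonal.antidiagonal n, ∑ i ∈ Finset.range (p.2 + 1 - e), F i (p.2 - e - i) p.1
      = ∑ t ∈ triples n e, F t.1 t.2.1 t.2.2 := by
  rw [Finset.sum_sigma']
  refine Finset.sum_nbij' (fun s => (s.2, s.1.2 - e - s.2, s.1.1))
    (fun t => ⟨(t.2.2, n - t.2.2), t.1⟩) ?_ ?_ ?_ ?_ ?_
  · rintro ⟨⟨a, b⟩, i⟩ h
    simp only [Finset.mem_sigma, Finset.HasAntidiagonal.mem_antidiagonal, Finset.mem_range] at h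
    rw [mem_triples]; dsimp only; omega
  · rintro ⟨i, j, k⟩ h
    rw [mem_triples] at h
    simp only [Finset.mem_sigma, Finset.HasAntidiagonal.mem_antidiagonal, Finset.mem_range] at *
    omega
  · rintro ⟨⟨a, b⟩, i⟩ h
    simp only [Finset.mem_sigma, Finset.HasAntidiagonal.mem_antidiagonal, Finset.mem_range] at h
    obtain rfl : n - a = b := by omega
    rfl
  · rintro ⟨i, j, k⟩ h
    rw [mem_triples] at h
    dsimp only at *
    simp only [Prod.mk.injEq, and_true, true_and]
    omega
  · intro s _
    rfl

end TripleSum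

/-! ### Closed 3-forms in charts -/

section Alternating

variable {V : Type*} [AddCommGroup V] [Module ℝ V]

theorem alternating_swap₁₂ (A : V [⋀^Fin 3]→ₗ[ℝ] ℝ) (a b c : V) :
    A ![a, b, c] = -A ![b, a, c] := by
  refine Eq.trans ?_ (A.map_swap ![b, a, c] (i := 0) (j := 1) (by decide))
  congr 1
  ext i; fin_cases i <;> rfl

theorem alternating_swap₂₃ (A : V [⋀^Fin 3]→ₗ[ℝ] ℝ) (a b c : V) :
    A ![a, b, c] = -A ![a, c, b] := by
  refine Eq.trans ?_ (A.map_swap ![a, c, b] (i := 1) (j := 2) (by decide))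
  congr 1
  ext i; fin_cases i <;> rfl

end Alternating

section ThreeForms

variable {C : Type*} [NormedAddCommGroup C] [NormedSpace ℝ C]

theorem triCLM_swap₁₂ (A : C [⋀^Fin 3]→L[ℝ] ℝ) (a b c : C) :
    triCLM A a b c = -triCLM A b a c := by
  rw [triCLM_apply, triCLM_apply]
  exact alternating_swap₁₂ A.toAlternatingMap a b c

theorem triCLM_swap₂₃ (A : C [⋀^Fin 3]→L[ℝ] ℝ) (a b c : C) :
    triCLM A a b c = -triCLM A a c b := by
  rw [triCLM_apply, triCLM_apply]
  exact alternating_swap₂₃ A.toAlternatingMap a b c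

variable {N : ℕ} {M : Type*} [TopologicalSpace M] [ChartedSpace (Coord N) M] {T : ThreeForm N M}

theorem IsClosedThreeForm.fderiv_triForm_apply (hT : IsClosedThreeForm T) {c : M} {y : Coord N}
    (hy : y ∈ (chartAt (Coord N) c).target) (d a b e : Coord N) :
    fderiv ℝ (triForm T c) y d a b e = triCLM (fderiv ℝ (T.inChart c) y d) a b e := by
  have h1 : DifferentiableAt ℝ (T.inChart c) y :=
    ((hT.smooth c).contDiffAt ((chartAt (Coord N) c).open_target.mem_nhds hy)).differentiableAt
      (by simp)
  have h2 : HasFDerivAt (triForm T c) (triCLM.comp (fderiv ℝ (T.inChart c) y)) y :=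
    (ContinuousLinearMap.hasFDerivAt (triCLM (C := Coord N))).comp y h1.hasFDerivAt
  rw [h2.fderiv]
  rfl

/-- The vanishing exterior derivative, evaluated on four vectors and solved for the term
differentiated along d. -/
theorem IsClosedThreeForm.fderiv_triForm_closed (hT : IsClosedThreeForm T) {c : M} {y : Coord N}
    (hy : y ∈ (chartAt (Coord N) c).target) (d a b e : Coord N) :
    fderiv ℝ (triForm T c) y d a b e = fderiv ℝ (triForm T c) y a d b e
      - fderiv ℝ (triForm T c) y b d a e + fderiv ℝ (triForm T c) y e d a b := by
  have h1 : DifferentiableAt ℝ (T.inChart c) y :=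
    ((hT.smooth c).contDiffAt ((chartAt (Coord N) c).open_target.mem_nhds hy)).differentiableAt
      (by simp)
  have h2 : ∑ i : Fin 4, (-1 : ℤ) ^ i.val • fderiv ℝ
      (fun y => T.inChart c y (Fin.removeNth i ![d, a, b, e])) y (![d, a, b, e] i) = 0 :=
    (extDeriv_apply h1 ![d, a, b, e]).symm.trans (by rw [hT.closed c y hy]; rfl)
  have h3 : ∀ v : Fin 3 → Coord N, fderiv ℝ (fun y => T.inChart c y v) y
      = (ContinuousAlternatingMap.apply ℝ (Coord N) ℝ v).comp (fderiv ℝ (T.inChart c) y) := fun v =>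
    ((ContinuousLinearMap.hasFDerivAt (ContinuousAlternatingMap.apply ℝ (Coord N) ℝ v)).comp y
      h1.hasFDerivAt).fderiv
  simp only [Fin.sum_univ_four, h3] at h2
  simp only [hT.fderiv_triForm_apply hy, triCLM_apply]
  have e0 : Fin.removeNth (0 : Fin 4) ![d, a, b, e] = ![a, b, e] := by
    ext i; fin_cases i <;> rfl
  have e1 : Fin.removeNth (1 : Fin 4) ![d, a, b, e] = ![d, b, e] := by
    ext i; fin_cases i <;> rfl
  have e2 : Fin.removeNth (2 : Fin 4) ![d, a, b, e] = ![d, a, e] := by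
    ext i; fin_cases i <;> rfl
  have e3 : Fin.removeNth (3 : Fin 4) ![d, a, b, e] = ![d, a, b] := by
    ext i; fin_cases i <;> rfl
  rw [e0, e1, e2, e3] at h2
  simp at h2
  linarith

/-- The contraction `T_{pjk} v^k` in the chart around `c`. -/
def contractCoord (T : ThreeForm N M) (c : M) (z : Coord N × Coord N) :
    Coord N →L[ℝ] Coord N →L[ℝ] ℝ :=
  (triForm T c z.1).flip z.2

theorem contractCoord_skew (T : ThreeForm N M) (c : M) (z : Coord N × Coord N) (ξ η : Coord N) :
    contractCoord T c z ξ η = -contractCoord T c z η ξ := by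
  simp only [contractCoord, ContinuousLinearMap.flip_apply, triForm]
  rw [triCLM_swap₁₂, triCLM_swap₂₃, triCLM_swap₁₂]
  ring

theorem IsClosedThreeForm.contDiffAt_contractCoord (hT : IsClosedThreeForm T) {c : M}
    {z : Coord N × Coord N} (hz : z.1 ∈ (chartAt (Coord N) c).target) :
    ContDiffAt ℝ ∞ (contractCoord T c) z := by
  have h1 : ContDiffAt ℝ ∞ (fun z : Coord N × Coord N => triForm T c z.1) z :=
    ((hT.contDiffOn_triForm c).contDiffAt ((chartAt (Coord N) c).open_target.mem_nhds hz)).comp z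
      contDiffAt_fst
  exact ((ContinuousLinearEquiv.contDiff (𝕜 := ℝ) (ContinuousLinearMap.flipₗᵢ ℝ (Coord N) (Coord N)
    (Coord N →L[ℝ] ℝ)).toContinuousLinearEquiv).contDiffAt.comp z h1).clm_apply contDiffAt_snd

theorem IsClosedThreeForm.fderiv_contractCoord_apply (hT : IsClosedThreeForm T) {c : M}
    {z : Coord N × Coord N} (hz : z.1 ∈ (chartAt (Coord N) c).target) (d : Coord N × Coord N)
    (ξ η : Coord N) : fderiv ℝ (contractCoord T c) z d ξ η
      = fderiv ℝ (triForm T c) z.1 d.1 ξ z.2 η + triForm T c z.1 ξ d.2 η := by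
  have h0 : ContDiffAt ℝ ∞ (triForm T c) z.1 :=
    (hT.contDiffOn_triForm c).contDiffAt ((chartAt (Coord N) c).open_target.mem_nhds hz)
  have h1 : ContDiffAt ℝ ∞ (fun z : Coord N × Coord N => triForm T c z.1) z :=
    h0.comp z contDiffAt_fst
  have h2 : fderiv ℝ (fun z : Coord N × Coord N => triForm T c z.1) z d
      = fderiv ℝ (triForm T c) z.1 d.1 := by
    have := (h0.differentiableAt (by simp)).hasFDerivAt.comp z (hasFDerivAt_fst (p := z) (𝕜 := ℝ))
    exact congrArg (fun L => L d) this.fderiv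
  have hc : ∀ u : Coord N, ContDiffAt ℝ ∞ (fun _ : Coord N × Coord N => u) z :=
    fun u => contDiffAt_const
  have hC := hT.contDiffAt_contractCoord hz
  have hl : fderiv ℝ (fun z => contractCoord T c z ξ η) z d
      = fderiv ℝ (contractCoord T c) z d ξ η := by
    rw [fderiv_pairing_apply (hC.clm_apply (hc ξ)) (hc η), fderiv_pairing_apply hC (hc ξ)]
    simp
  have hr : fderiv ℝ (fun z : Coord N × Coord N => triForm T c z.1 ξ z.2 η) z d
      = fderiv ℝ (triForm T c) z.1 d.1 ξ z.2 η + triForm T c z.1 ξ d.2 η := by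
    rw [fderiv_pairing_apply ((h1.clm_apply (hc ξ)).clm_apply contDiffAt_snd) (hc η),
      fderiv_pairing_apply (h1.clm_apply (hc ξ)) contDiffAt_snd, fderiv_pairing_apply h1 (hc ξ), h2]
    simp [fderiv_snd]
  rw [← hl, ← hr]
  rfl

/-- Closedness trades the derivatives of T along Z, X and Y, with the velocity `z.2` inserted in T,
for the derivative along the velocity with X, Y, Z inserted. With the variations of the velocity
this becomes the Leibniz expansion of the x-derivative of `T(X, Y, Z)`. -/
theorem IsClosedThreeForm.fderiv_contractCoord_cyclic (hT : IsClosedThreeForm T) {c : M}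
    {z : Coord N × Coord N} (hz : z.1 ∈ (chartAt (Coord N) c).target)
    (X Y Z X' Y' Z' : Coord N) :
    fderiv ℝ (contractCoord T c) z (Z, Z') Y X + fderiv ℝ (contractCoord T c) z (X, X') Z Y
      + fderiv ℝ (contractCoord T c) z (Y, Y') X Z
    = fderiv ℝ (triForm T c) z.1 z.2 X Y Z + triForm T c z.1 X' Y Z + triForm T c z.1 X Y' Z
      + triForm T c z.1 X Y Z' := by
  simp only [hT.fderiv_contractCoord_apply hz]
  rw [hT.fderiv_triForm_closed hz z.2 X Y Z]
  simp only [hT.fderiv_triForm_apply hz]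
  simp only [triForm]
  rw [triCLM_swap₁₂ _ Y z.2 X, triCLM_swap₂₃ _ z.2 Y X, triCLM_swap₁₂ _ Z z.2 Y,
    triCLM_swap₂₃ _ z.2 Z Y, triCLM_swap₁₂ _ X z.2 Z,
    triCLM_swap₁₂ _ Y Z' X, triCLM_swap₂₃ _ Z' Y X, triCLM_swap₁₂ _ Z' X Y, triCLM_swap₂₃ _ X Z' Y,
    triCLM_swap₁₂ _ Z X' Y, triCLM_swap₂₃ _ X' Z Y]
  ring

end ThreeForms

/-! ### The Poisson structure in charts -/

section Bivectors

variable {N : ℕ} {M : Type*} [TopologicalSpace M] [ChartedSpace (Coord N) M] {ω₀ : TwoTensor N M}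

/-- A 2-tensor in the chart around `c`. -/
def tensorCoord (ω₀ : TwoTensor N M) (c : M) (z : Coord N × Coord N) :
    (Coord N →L[ℝ] ℝ) →L[ℝ] Coord N :=
  opCoord (fun p _ => ω₀ p) c z

theorem IsPoissonStructure.contDiffAt_tensorCoord (hω₀ : IsPoissonStructure ω₀) {c : M}
    {z : Coord N × Coord N} (hz : z.1 ∈ (chartAt (Coord N) c).target) :
    ContDiffAt ℝ ∞ (tensorCoord ω₀ c) z := by
  have h1 : ContDiffOn ℝ ∞ (tensorCoord ω₀ c) ((chartAt (Coord N) c).target ×ˢ Set.univ) := by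
    rw [contDiffOn_clm_apply]
    exact fun a => (hω₀.smooth c a.toLinearMap).comp contDiffOn_fst fun z hz => hz.1
  exact h1.contDiffAt (((chartAt (Coord N) c).open_target.prod isOpen_univ).mem_nhds ⟨hz, trivial⟩)

/-- The components of ω do not depend on the velocity, so the components `X'`, `Y'`, `Z'` are
arbitrary and this is the Jacobi identity on M. -/
theorem IsPoissonStructure.fderiv_tensorCoord_cyclic (hω₀ : IsPoissonStructure ω₀) {c : M}
    {z : Coord N × Coord N} (hz : z.1 ∈ (chartAt (Coord N) c).target) (X' Y' Z' : Coord N)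
    (a b d : Coord N →L[ℝ] ℝ) :
    a (fderiv ℝ (tensorCoord ω₀ c) z (tensorCoord ω₀ c z d, Z') b)
      + b (fderiv ℝ (tensorCoord ω₀ c) z (tensorCoord ω₀ c z a, X') d)
      + d (fderiv ℝ (tensorCoord ω₀ c) z (tensorCoord ω₀ c z b, Y') a) = 0 := by
  have h1 : ∀ (a b : Coord N →L[ℝ] ℝ) (e : Coord N × Coord N),
      a (fderiv ℝ (tensorCoord ω₀ c) z e b)
        = fderiv ℝ (fun y => a (ω₀.inChart c b.toLinearMap y)) z.1 e.1 := by
    intro a b e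
    have h2 : DifferentiableAt ℝ (ω₀.inChart c b.toLinearMap) z.1 :=
      ((hω₀.smooth c b.toLinearMap).contDiffAt
        ((chartAt (Coord N) c).open_target.mem_nhds hz)).differentiableAt (by simp)
    have h3 : fderiv ℝ (fun z => tensorCoord ω₀ c z b) z e
        = fderiv ℝ (tensorCoord ω₀ c) z e b := by
      rw [fderiv_pairing_apply (hω₀.contDiffAt_tensorCoord hz) contDiffAt_const, fderiv_fun_const]
      simp
    have h4 : fderiv ℝ (fun z => tensorCoord ω₀ c z b) z e
        = fderiv ℝ (ω₀.inChart c b.toLinearMap) z.1 e.1 := by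
      have := h2.hasFDerivAt.comp z (hasFDerivAt_fst (p := z) (𝕜 := ℝ))
      exact congrArg (fun L => L e) this.fderiv
    have h5 := (a.hasFDerivAt.comp z.1 h2.hasFDerivAt).fderiv
    rw [← h3, h4]
    exact (congrArg (fun L => L e.1) h5).symm
  simp only [h1]
  exact hω₀.jacobi c a.toLinearMap b.toLinearMap d.toLinearMap z.1 hz

end Bivectors

/-! ### The deformed operator and its coefficients satisfy the local conditions -/

section Coordinates

variable {N : ℕ} {M : Type*} [TopologicalSpace M] [ChartedSpace (Coord N) M]
  {ω₀ : TwoTensor N M} {T : ThreeForm N M}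

theorem contract_apply (T : ThreeForm N M) (p : M) (v ξ η : Tan N p) :
    contract T p v ξ η = T p ![η, ξ, v] := rfl

theorem contract_skew (T : ThreeForm N M) (p : M) (v ξ η : Tan N p) :
    contract T p v ξ η = -contract T p v η ξ :=
  alternating_swap₁₂ (T p).toAlternatingMap η ξ v

/-- The matrix `δ + ε ω T v` in the chart around `c`. -/
def deformCoord (ω₀ : TwoTensor N M) (T : ThreeForm N M) (ε : ℝ) (c : M)
    (z : Coord N × Coord N) : Coord N →L[ℝ] Coord N :=
  1 + ε • (tensorCoord ω₀ c z ∘L contractCoord T c z)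

theorem contDiffAt_deformCoord (hω₀ : IsPoissonStructure ω₀) (hT : IsClosedThreeForm T) (ε : ℝ)
    {c : M} {z : Coord N × Coord N} (hz : z.1 ∈ (chartAt (Coord N) c).target) :
    ContDiffAt ℝ ∞ (deformCoord ω₀ T ε c) z :=
  contDiffAt_const.add (((hω₀.contDiffAt_tensorCoord hz).clm_comp
    (hT.contDiffAt_contractCoord hz)).const_smul ε)

/-- The velocities for which the deformation is defined. -/
def invertibleSet (ω₀ : TwoTensor N M) (T : ThreeForm N M) (ε : ℝ) (p : M) : Set (Tan N p) :=
  {v | IsUnit (deformationMatrix ω₀ T ε p v)}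

theorem deformedOperator_apply {ε : ℝ} {p : M} {v : Tan N p} (hv : v ∈ invertibleSet ω₀ T ε p)
    (α : Cotan N p) :
    deformedOperator ω₀ T ε p v α + ε • ω₀ p (contract T p v (deformedOperator ω₀ T ε p v α))
      = ω₀ p α := by
  have h : deformationMatrix ω₀ T ε p v * Ring.inverse (deformationMatrix ω₀ T ε p v) = 1 :=
    Ring.mul_inverse_cancel _ hv
  exact congrArg (fun L : Module.End ℝ (Tan N p) => L (ω₀ p α)) h

/-- The coefficients of the expansion of the deformed operator in powers of `ε`. -/
def coeffOperator (ω₀ : TwoTensor N M) (T : ThreeForm N M) (n : ℕ) : MatrixOperator N M :=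
  fun p v => ω₀ p ∘ₗ (-(contract T p v ∘ₗ ω₀ p)) ^ n

theorem coeffOperator_succ_apply (n : ℕ) (p : M) (v : Tan N p) (α : Cotan N p) :
    coeffOperator ω₀ T (n + 1) p v α = -ω₀ p (contract T p v (coeffOperator ω₀ T n p v α)) := by
  rw [coeffOperator, pow_succ', LinearMap.comp_apply, Module.End.mul_apply, LinearMap.neg_apply,
    map_neg]
  rfl

theorem opDom_univ (c : M) : opDom (fun p : M => (Set.univ : Set (Tan N p))) c
    = (chartAt (Coord N) c).target ×ˢ Set.univ := by
  ext z
  simp [opDom]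

variable [IsManifold (𝓡 N) ∞ M]

theorem exists_eq_coframe {c : M} {z : Coord N × Coord N}
    (hz : z.1 ∈ (chartAt (Coord N) c).target) :
    ∃ p ∈ (chartAt (Coord N) c).source, ∃ v : Tan N p,
      z = (chartAt (Coord N) c p, coframe c p v) := by
  have hp := (chartAt (Coord N) c).map_target hz
  refine ⟨(chartAt (Coord N) c).symm z.1, hp, frame c _ z.2, ?_⟩
  rw [coframe_frame hp, (chartAt (Coord N) c).right_inv hz]

theorem opCoord_apply (P : MatrixOperator N M) {c p : M}
    (hp : p ∈ (chartAt (Coord N) c).source) (v : Tan N p) (a : Coord N →L[ℝ] ℝ) :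
    opCoord P c (chartAt (Coord N) c p, coframe c p v) a
      = coframe c p (P p v (coordCovector c p a.toLinearMap)) :=
  opCoord_coframe P hp v _ a fun w => by
    change a w = a (coframe c p (frame c p w))
    rw [coframe_frame hp]

theorem tensorCoord_apply (ω₀ : TwoTensor N M) {c p : M}
    (hp : p ∈ (chartAt (Coord N) c).source) (v : Tan N p) (a : Coord N →L[ℝ] ℝ) :
    tensorCoord ω₀ c (chartAt (Coord N) c p, coframe c p v) a
      = coframe c p (ω₀ p (coordCovector c p a.toLinearMap)) :=
  opCoord_apply _ hp v a

theorem tensorCoord_skew (hω₀ : IsPoissonStructure ω₀) {c : M} {z : Coord N × Coord N}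
    (hz : z.1 ∈ (chartAt (Coord N) c).target) (a b : Coord N →L[ℝ] ℝ) :
    a (tensorCoord ω₀ c z b) = -b (tensorCoord ω₀ c z a) := by
  obtain ⟨p, hp, v, rfl⟩ := exists_eq_coframe hz
  exact opCoord_skew hp (hω₀.skew p) a b

/-- The two contractions insert the velocity in the third and in the second slot of T; the arguments
differ by a cyclic permutation, which is even. -/
theorem coordCovector_contractCoord (T : ThreeForm N M) {c p : M}
    (hp : p ∈ (chartAt (Coord N) c).source) (v ξ : Tan N p) :
    coordCovector c p
      (contractCoord T c (chartAt (Coord N) c p, coframe c p v) (coframe c p ξ)).toLinearMap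
      = contract T p v ξ := by
  ext η
  change triForm T c _ (coframe c p ξ) (coframe c p v) (coframe c p η) = _
  rw [triForm_coframe T hp, contract_apply]
  refine (alternating_swap₂₃ (T p).toAlternatingMap ξ v η).trans ?_
  rw [alternating_swap₁₂ (T p).toAlternatingMap ξ η v, neg_neg]
  rfl

theorem deformCoord_coframe (ω₀ : TwoTensor N M) (T : ThreeForm N M) (ε : ℝ) {c p : M}
    (hp : p ∈ (chartAt (Coord N) c).source) (v ξ : Tan N p) :
    deformCoord ω₀ T ε c (chartAt (Coord N) c p, coframe c p v) (coframe c p ξ)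
      = coframe c p (deformationMatrix ω₀ T ε p v ξ) := by
  change coframe c p ξ + ε • tensorCoord ω₀ c _ (contractCoord T c _ (coframe c p ξ))
    = coframe c p (ξ + ε • ω₀ p (contract T p v ξ))
  rw [tensorCoord_apply ω₀ hp, coordCovector_contractCoord T hp, map_add, map_smul]

/-- The two matrices are conjugate by the differential of the chart. -/
theorem isUnit_deformCoord (ω₀ : TwoTensor N M) (T : ThreeForm N M) (ε : ℝ) {c p : M}
    (hp : p ∈ (chartAt (Coord N) c).source) (v : Tan N p) :
    IsUnit (deformCoord ω₀ T ε c (chartAt (Coord N) c p, coframe c p v))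
      ↔ IsUnit (deformationMatrix ω₀ T ε p v) := by
  rw [ContinuousLinearMap.isUnit_iff_bijective, Module.End.isUnit_iff]
  obtain ⟨e, he, -⟩ := exists_coframe_equiv (N := N) hp
  have h : deformCoord ω₀ T ε c (chartAt (Coord N) c p, coframe c p v) ∘ e
      = e ∘ deformationMatrix ω₀ T ε p v := by
    funext ξ
    have := deformCoord_coframe ω₀ T ε hp v ξ
    rw [he] at this ⊢
    exact this
  rw [← Function.Bijective.of_comp_iff _ e.bijective, h,
    Function.Bijective.of_comp_iff' e.bijective]

theorem opDom_invertibleSet (ω₀ : TwoTensor N M) (T : ThreeForm N M) (ε : ℝ) (c : M) :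
    opDom (invertibleSet ω₀ T ε) c
      = {z | z.1 ∈ (chartAt (Coord N) c).target ∧ IsUnit (deformCoord ω₀ T ε c z)} := by
  ext z
  refine and_congr_right fun hz => ?_
  have hp := (chartAt (Coord N) c).map_target hz
  rw [invertibleSet, Set.mem_ofPred_eq, ← isUnit_deformCoord ω₀ T ε hp, coframe_frame hp,
    (chartAt (Coord N) c).right_inv hz]

theorem opCoord_deformedOperator {ε : ℝ} {c : M} {z : Coord N × Coord N}
    (hz : z ∈ opDom (invertibleSet ω₀ T ε) c) (a : Coord N →L[ℝ] ℝ) :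
    opCoord (deformedOperator ω₀ T ε) c z a
      + ε • tensorCoord ω₀ c z (contractCoord T c z (opCoord (deformedOperator ω₀ T ε) c z a))
      = tensorCoord ω₀ c z a := by
  rw [opDom_invertibleSet] at hz
  obtain ⟨hz₁, hz₂⟩ := hz
  obtain ⟨p, hp, v, rfl⟩ := exists_eq_coframe hz₁
  rw [isUnit_deformCoord ω₀ T ε hp] at hz₂
  rw [opCoord_apply _ hp, tensorCoord_apply ω₀ hp, tensorCoord_apply ω₀ hp,
    coordCovector_contractCoord T hp, ← map_smul, ← map_add, deformedOperator_apply hz₂]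

theorem opCoord_deformedOperator_eq {ε : ℝ} {c : M} {z : Coord N × Coord N}
    (hz : z ∈ opDom (invertibleSet ω₀ T ε) c) :
    opCoord (deformedOperator ω₀ T ε) c z
      = Ring.inverse (deformCoord ω₀ T ε c z) ∘L tensorCoord ω₀ c z := by
  ext1 a
  have h : Ring.inverse (deformCoord ω₀ T ε c z) * deformCoord ω₀ T ε c z = 1 := by
    rw [opDom_invertibleSet] at hz
    exact Ring.inverse_mul_cancel _ hz.2
  rw [ContinuousLinearMap.comp_apply, ← opCoord_deformedOperator hz]
  exact (congrArg (fun L : Coord N →L[ℝ] Coord N =>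
    L (opCoord (deformedOperator ω₀ T ε) c z a)) h).symm

theorem isSmoothSkewOn_deformedOperator (hω₀ : IsPoissonStructure ω₀) (hT : IsClosedThreeForm T)
    (ε : ℝ) : IsSmoothSkewOn (invertibleSet ω₀ T ε) (deformedOperator ω₀ T ε) where
  skew p v hv α β := deformed_skew (B := ω₀ p) (τ := contract T p v)
    (A := deformedOperator ω₀ T ε p v) (deformedOperator_apply hv) (hω₀.skew p)
    (contract_skew T p v) α β
  isOpen c := by
    rw [opDom_invertibleSet]
    have h : ContinuousOn (deformCoord ω₀ T ε c) ((chartAt (Coord N) c).target ×ˢ Set.univ) :=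
      fun z hz => (contDiffAt_deformCoord hω₀ hT ε hz.1).continuousAt.continuousWithinAt
    convert h.isOpen_inter_preimage ((chartAt (Coord N) c).open_target.prod isOpen_univ)
      Units.isOpen using 1
    ext z
    simp
  smooth c := by
    intro z hz
    have hz' := hz
    rw [opDom_invertibleSet] at hz'
    obtain ⟨u, hu⟩ := hz'.2
    have h1 : ContDiffAt ℝ ∞ (fun z => Ring.inverse (deformCoord ω₀ T ε c z)) z :=
      ContDiffAt.comp (g := Ring.inverse) z (by rw [← hu]; exact contDiffAt_ringInverse ℝ u)
        (contDiffAt_deformCoord hω₀ hT ε hz'.1)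
    exact ((h1.clm_comp (hω₀.contDiffAt_tensorCoord hz'.1)).contDiffWithinAt).congr
      (fun y hy => opCoord_deformedOperator_eq hy) (opCoord_deformedOperator_eq hz)

theorem opCoord_coeffOperator (n : ℕ) {c : M} {z : Coord N × Coord N}
    (hz : z.1 ∈ (chartAt (Coord N) c).target) :
    opCoord (coeffOperator ω₀ T n) c z
      = seriesOp (tensorCoord ω₀ c) (contractCoord T c) n z := by
  obtain ⟨p, hp, v, rfl⟩ := exists_eq_coframe hz
  ext1 a
  induction n with
  | zero =>
    rw [opCoord_apply _ hp, seriesOp_zero, tensorCoord_apply ω₀ hp]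
    rfl
  | succ n ih =>
    rw [seriesOp_succ_apply, ← ih, opCoord_apply _ hp, opCoord_apply _ hp,
      tensorCoord_apply ω₀ hp, coordCovector_contractCoord T hp, coeffOperator_succ_apply, map_neg]

theorem isSmoothSkewOn_coeffOperator (hω₀ : IsPoissonStructure ω₀) (hT : IsClosedThreeForm T)
    (n : ℕ) : IsSmoothSkewOn (fun _ => Set.univ) (coeffOperator ω₀ T n) where
  skew p v _ α β := series_skew (hω₀.skew p) (contract_skew T p v) n α β
  isOpen c := by
    rw [opDom_univ]
    exact (chartAt (Coord N) c).open_target.prod isOpen_univ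
  smooth c := by
    intro z hz
    rw [opDom_univ] at hz ⊢
    exact ((contDiffAt_seriesOp (hω₀.contDiffAt_tensorCoord hz.1)
      (hT.contDiffAt_contractCoord hz.1) n).contDiffWithinAt).congr
      (fun y hy => opCoord_coeffOperator n hy.1) (opCoord_coeffOperator n hz.1)

/-- The derivative formula for A reduces the claim to the Jacobi identity of ω at the covectors `f -
ε τ A f` and to the closedness of T. -/
theorem isJacobiTriple_deformedOperator (hω₀ : IsPoissonStructure ω₀) (hT : IsClosedThreeForm T)
    (ε : ℝ) : IsJacobiTriple T (invertibleSet ω₀ T ε) (fun _ => deformedOperator ω₀ T ε) 0 {(0, 0)}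
      {(0, 0, 0)} ε := by
  intro c w hw f g h X Y Z X' Y' Z' hX hY hZ
  have hP := isSmoothSkewOn_deformedOperator hω₀ hT ε
  have hwn := (hP.isOpen c).mem_nhds hw
  have hev : ∀ᶠ z in 𝓝 w, ∀ a, opCoord (deformedOperator ω₀ T ε) c z a
      + ε • tensorCoord ω₀ c z (contractCoord T c z (opCoord (deformedOperator ω₀ T ε) c z a))
      = tensorCoord ω₀ c z a := by
    filter_upwards [hwn] with z hz a
    exact opCoord_deformedOperator hz a
  -- Applying ω to the shifted covectors gives exactly X, Y and Z, the directions of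
  -- differentiation, as the Jacobi identity of ω requires.
  have hB : ∀ a, tensorCoord ω₀ c w
      (a - ε • contractCoord T c w (opCoord (deformedOperator ω₀ T ε) c w a))
      = opCoord (deformedOperator ω₀ T ε) c w a := fun a => by
    rw [map_sub, map_smul, sub_eq_iff_eq_add]
    exact (opCoord_deformedOperator hw a).symm
  have key := fun (η : Coord N × Coord N) (f g : Coord N →L[ℝ] ℝ) =>
    fderiv_deformed_apply (hω₀.contDiffAt_tensorCoord hw.1) (hT.contDiffAt_contractCoord hw.1)
      ((hP.smooth c).contDiffAt hwn) hev (tensorCoord_skew hω₀ hw.1) (contractCoord_skew T c w) η f g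
  have hpois := hω₀.fderiv_tensorCoord_cyclic hw.1 (X' 0) (Y' 0) (Z' 0)
    (f - ε • contractCoord T c w (opCoord (deformedOperator ω₀ T ε) c w f))
    (g - ε • contractCoord T c w (opCoord (deformedOperator ω₀ T ε) c w g))
    (h - ε • contractCoord T c w (opCoord (deformedOperator ω₀ T ε) c w h))
  have hclosed := hT.fderiv_contractCoord_cyclic hw.1 (X 0) (Y 0) (Z 0) (X' 0) (Y' 0) (Z' 0)
  rw [hB, hB, hB, ← hX 0 le_rfl, ← hY 0 le_rfl, ← hZ 0 le_rfl] at hpois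
  simp only [Finset.sum_singleton, key]
  rw [← hX 0 le_rfl, ← hY 0 le_rfl, ← hZ 0 le_rfl, ← hclosed]
  linear_combination hpois

/-- With `K = -τ ω`, the vectors `X a` are ω applied to `Kᵃ f`. The terms with a differentiated ω
group, for each triple of total order n, into the Jacobi identity of ω at `Kⁱ f`, `Kʲ g`, `Kᵏ h`;
those with a differentiated τ group, for total order `n - 1`, into the closedness identity. -/
theorem isJacobiTriple_coeffOperator (hω₀ : IsPoissonStructure ω₀) (hT : IsClosedThreeForm T)
    (n : ℕ) : IsJacobiTriple T (fun _ => Set.univ) (coeffOperator ω₀ T) n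
      (Finset.HasAntidiagonal.antidiagonal n) (triples n 1) 1 := by
  intro c w hw f g h X Y Z X' Y' Z' hX hY hZ
  rw [opDom_univ] at hw
  set B := tensorCoord ω₀ c with hBd
  set τ := contractCoord T c with hτd
  set K := -(τ w ∘L B w) with hK
  have hev : ∀ b, opCoord (coeffOperator ω₀ T b) c =ᶠ[𝓝 w] seriesOp B τ b := fun b => by
    filter_upwards [((chartAt (Coord N) c).open_target.prod isOpen_univ).mem_nhds hw] with z hz
    exact opCoord_coeffOperator b hz.1
  have hX₁ : ∀ a ≤ n, B w ((K ^ a) f) = X a := fun a ha => by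
    rw [hX a ha, opCoord_coeffOperator a hw.1]; rfl
  have hY₁ : ∀ a ≤ n, B w ((K ^ a) g) = Y a := fun a ha => by
    rw [hY a ha, opCoord_coeffOperator a hw.1]; rfl
  have hZ₁ : ∀ a ≤ n, B w ((K ^ a) h) = Z a := fun a ha => by
    rw [hZ a ha, opCoord_coeffOperator a hw.1]; rfl
  let F : (Coord N →L[ℝ] ℝ) → (Coord N →L[ℝ] ℝ) → (ℕ → Coord N) → (ℕ → Coord N) → ℕ → ℕ → ℕ → ℝ :=
    fun f g U U' i j k => ((K ^ i) f) (fderiv ℝ B w (U k, U' k) ((K ^ j) g))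
  let G : (ℕ → Coord N) → (ℕ → Coord N) → (ℕ → Coord N) → (ℕ → Coord N) → ℕ → ℕ → ℕ → ℝ :=
    fun V W U U' i j k => fderiv ℝ τ w (U k, U' k) (W j) (V i)
  have key : ∀ (f g : Coord N →L[ℝ] ℝ) (V W U U' : ℕ → Coord N),
      (∀ a ≤ n, B w ((K ^ a) f) = V a) → (∀ a ≤ n, B w ((K ^ a) g) = W a) →
      ∑ p ∈ Finset.HasAntidiagonal.antidiagonal n,
        f (fderiv ℝ (opCoord (coeffOperator ω₀ T p.2) c) w (U p.1, U' p.1) g)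
      = ∑ t ∈ triples n 0, F f g U U' t.1 t.2.1 t.2.2
        + ∑ t ∈ triples n 1, G V W U U' t.1 t.2.1 t.2.2 := by
    intro f g V W U U' hV hW
    rw [← sum_antidiagonal_range n 0 (F f g U U'), ← sum_antidiagonal_range n 1 (G V W U U'),
      ← Finset.sum_add_distrib]
    refine Finset.sum_congr rfl fun p hp => ?_
    rw [Finset.HasAntidiagonal.mem_antidiagonal] at hp
    rw [(hev p.2).fderiv_eq, fderiv_seriesOp_apply (hω₀.contDiffAt_tensorCoord hw.1)
      (hT.contDiffAt_contractCoord hw.1) (tensorCoord_skew hω₀ hw.1) (contractCoord_skew T c w)]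
    refine congrArg₂ (· + ·) rfl (Finset.sum_congr rfl fun i hi => ?_)
    have hi' := Finset.mem_range.mp hi
    change fderiv ℝ τ w _ (B w ((K ^ (p.2 - 1 - i)) g)) (B w ((K ^ i) f)) = _
    rw [hV i (by omega), hW (p.2 - 1 - i) (by omega)]
  -- The three cyclic terms carry rotated index triples. The second is rotated once and the third
  -- twice, so that all are indexed by the orders of f, g, h.
  rw [Finset.sum_add_distrib, Finset.sum_add_distrib, key f g X Y Z Z' hX₁ hY₁,
    key g h Y Z X X' hY₁ hZ₁, key h f Z X Y Y' hZ₁ hX₁,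
    ← sum_triples_rotate n 0 (F g h X X'), ← sum_triples_rotate n 1 (G Y Z X X'),
    ← sum_triples_rotate n 0 (F h f Y Y'), ← sum_triples_rotate n 1 (G Z X Y Y'),
    ← sum_triples_rotate n 0 (fun i j k => F h f Y Y' j k i),
    ← sum_triples_rotate n 1 (fun i j k => G Z X Y Y' j k i), one_mul]
  have h1 : ∑ t ∈ triples n 0, (F f g Z Z' t.1 t.2.1 t.2.2 + F g h X X' t.2.1 t.2.2 t.1
      + F h f Y Y' t.2.2 t.1 t.2.1) = 0 := by
    refine Finset.sum_eq_zero fun t ht => ?_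
    rw [mem_triples] at ht
    have := hω₀.fderiv_tensorCoord_cyclic hw.1 (X' t.1) (Y' t.2.1) (Z' t.2.2)
      ((K ^ t.1) f) ((K ^ t.2.1) g) ((K ^ t.2.2) h)
    rwa [← hBd, hX₁ _ (by omega), hY₁ _ (by omega), hZ₁ _ (by omega)] at this
  have h2 : ∑ t ∈ triples n 1, (G X Y Z Z' t.1 t.2.1 t.2.2 + G Y Z X X' t.2.1 t.2.2 t.1
      + G Z X Y Y' t.2.2 t.1 t.2.1) = _ := Finset.sum_congr rfl fun t _ =>
    hT.fderiv_contractCoord_cyclic hw.1 (X t.1) (Y t.2.1) (Z t.2.2) (X' t.1) (Y' t.2.1) (Z' t.2.2)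
  rw [← h2]
  rw [Finset.sum_add_distrib, Finset.sum_add_distrib] at h1 ⊢
  linear_combination h1

end Coordinates

/-! ### The domain of the deformed operator -/

section Domain

variable {N : ℕ} {M : Type*} [TopologicalSpace M] [ChartedSpace (Coord N) M]
  {ω₀ : TwoTensor N M} {T : ThreeForm N M}

theorem mem_deformationDomain {ε : ℝ} {γ : Loop N M} :
    γ ∈ deformationDomain ω₀ T ε ↔ ∀ x, γ.vel x ∈ invertibleSet ω₀ T ε (γ x) := by
  constructor
  · intro h x
    obtain ⟨y, -, rfl⟩ := exists_mem_Icc_coe x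
    rw [Loop.vel_coe]
    exact h y
  · intro h x
    have := h (x : UnitAddCircle)
    rwa [Loop.vel_coe] at this

/-- Compactness of `[0, 1]`, which covers the circle: local conditions in parameter and point become
uniform in the point. -/
theorem eventually_forall_circle {E : Type*} [TopologicalSpace E] {e₀ : E}
    {Q : E → UnitAddCircle → Prop}
    (h : ∀ x : ℝ, ∀ᶠ q : E × ℝ in 𝓝 (e₀, x), Q q.1 (q.2 : UnitAddCircle)) :
    ∀ᶠ e in 𝓝 e₀, ∀ x, Q e x := by
  have h1 := isCompact_Icc.eventually_forall_of_forall_eventually (K := Set.Icc (0 : ℝ) 1)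
    (P := fun e x => Q e (x : UnitAddCircle)) fun x _ => h x
  filter_upwards [h1] with e he x
  obtain ⟨y, hy, rfl⟩ := exists_mem_Icc_coe x
  exact he y hy

variable [IsManifold (𝓡 N) ∞ M]
variable {E : Type*} [NormedAddCommGroup E] [NormedSpace ℝ E]

theorem mem_deformationDomain_iff_isUnit {ε : ℝ} {c : M} {γ : Loop N M} {x : UnitAddCircle}
    (hx : γ x ∈ (chartAt (Coord N) c).source) :
    γ.vel x ∈ invertibleSet ω₀ T ε (γ x) ↔ IsUnit (deformCoord ω₀ T ε c (loopJet c γ x)) :=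
  (isUnit_deformCoord ω₀ T ε hx _).symm

theorem isLoopOpen_deformationDomain (hω₀ : IsPoissonStructure ω₀) (hT : IsClosedThreeForm T)
    (ε : ℝ) : IsLoopOpen (deformationDomain ω₀ T ε) := by
  intro k W Γ hΓ
  have h : IsFamily W Γ := (isSmoothFamily_iff.mp hΓ).1
  rw [isOpen_iff_mem_nhds]
  rintro t ⟨ht, htd⟩
  rw [mem_deformationDomain] at htd
  have key : ∀ᶠ e in 𝓝 t, ∀ x, (Γ e).vel x ∈ invertibleSet ω₀ T ε (Γ e x) := by
    refine eventually_forall_circle fun x => ?_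
    have hq : (t, x) ∈ chartDom W Γ (Γ t (x : UnitAddCircle)) := ⟨ht, mem_chart_source _ _⟩
    have hU := (contDiffAt_jet (h.contDiffAt_inCoord hq) (0, 1)).continuousAt
    have hS : ContinuousAt (deformCoord ω₀ T ε (Γ t (x : UnitAddCircle)))
        (jet (inCoord Γ (Γ t (x : UnitAddCircle))) (0, 1) (t, x)) :=
      (contDiffAt_deformCoord hω₀ hT ε ((chartAt (Coord N) _).map_source hq.2)).continuousAt
    have h1 := (hS.comp hU).eventually (Units.isOpen.mem_nhds (by
      change IsUnit (deformCoord ω₀ T ε _ (jet (inCoord Γ _) (0, 1) (t, x)))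
      rw [h.jet_inCoord hq]
      exact (mem_deformationDomain_iff_isUnit hq.2).mp (htd x)))
    filter_upwards [h1, (h.isOpen_chartDom _).mem_nhds hq] with q hq₁ hq₂
    rw [mem_deformationDomain_iff_isUnit hq₂.2, ← h.jet_inCoord hq₂]
    exact hq₁
  filter_upwards [key, hΓ.isOpen.mem_nhds ht] with e he heW
  exact ⟨heW, mem_deformationDomain.mpr he⟩

/-- At `ε = 0` the matrix is the identity; invertible matrices form an open set, and compactness of
the circle makes the bound on ε uniform along the loop. -/
theorem eventually_mem_deformationDomain (hω₀ : IsPoissonStructure ω₀) (hT : IsClosedThreeForm T)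
    (γ : Loop N M) : ∀ᶠ ε in 𝓝 (0 : ℝ), γ ∈ deformationDomain ω₀ T ε := by
  have h : IsFamily (Set.univ : Set ℝ) (fun _ => γ) := isFamily_const γ
  have key : ∀ᶠ ε in 𝓝 (0 : ℝ), ∀ x, γ.vel x ∈ invertibleSet ω₀ T ε (γ x) := by
    refine eventually_forall_circle fun x => ?_
    set c := γ (x : UnitAddCircle) with hc
    have hq : ((0 : ℝ), x) ∈ chartDom Set.univ (fun _ : ℝ => γ) c := ⟨trivial, mem_chart_source _ _⟩
    have hU := (contDiffAt_jet (h.contDiffAt_inCoord hq) (0, 1)).continuousAt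
    have hz := (chartAt (Coord N) c).map_source hq.2
    have hB : ContinuousAt (fun z => tensorCoord ω₀ c z ∘L contractCoord T c z)
        (jet (inCoord (fun _ : ℝ => γ) c) (0, 1) (0, x)) :=
      ((hω₀.contDiffAt_tensorCoord hz).clm_comp (hT.contDiffAt_contractCoord hz)).continuousAt
    have hS : ContinuousAt (fun q : ℝ × ℝ =>
        deformCoord ω₀ T q.1 c (jet (inCoord (fun _ : ℝ => γ) c) (0, 1) q)) (0, x) :=
      continuousAt_const.add (continuousAt_fst.smul (hB.comp hU))
    have h1 := hS.eventually (Units.isOpen.mem_nhds (by simp [deformCoord]))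
    filter_upwards [h1, (h.isOpen_chartDom _).mem_nhds hq] with q hq₁ hq₂
    rw [mem_deformationDomain_iff_isUnit hq₂.2, ← h.jet_inCoord hq₂]
    exact hq₁
  filter_upwards [key] with ε hε
  exact mem_deformationDomain.mpr hε

end Domain

/-! ### The Poisson properties on the loop space -/

section Poisson

variable {N : ℕ} {M : Type*} [TopologicalSpace M] [ChartedSpace (Coord N) M]
  {ω₀ : TwoTensor N M} {T : ThreeForm N M}

theorem bracket_skew {P : MatrixOperator N M} {O : ∀ p : M, Set (Tan N p)}
    (hP : IsSmoothSkewOn O P) {γ : Loop N M} (hγ : ∀ x, γ.vel x ∈ O (γ x)) (f g : CovectorField N M) :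
    bracket P f g γ = -bracket P g f γ := by
  rw [bracket_eq_integral_density, bracket_eq_integral_density, ← intervalIntegral.integral_neg]
  exact intervalIntegral.integral_congr fun x _ => hP.skew _ _ (hγ x) _ _

variable [IsManifold (𝓡 N) ∞ M] [T2Space M] [SecondCountableTopology M]

theorem isLoopPoisson_deformedOperator (hω₀ : IsPoissonStructure ω₀) (hT : IsClosedThreeForm T)
    (ε : ℝ) : IsLoopPoisson (deformationDomain ω₀ T ε) (deformedOperator ω₀ T ε) := by
  have hP := isSmoothSkewOn_deformedOperator hω₀ hT ε
  have hVO : ∀ V ⊆ deformationDomain ω₀ T ε, ∀ γ ∈ V, ∀ x,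
      γ.vel x ∈ invertibleSet ω₀ T ε (γ x) := fun V hV γ hγ => mem_deformationDomain.mp (hV hγ)
  refine ⟨fun V hV _ I J dI dJ _ _ γ hγ => bracket_skew hP (hVO V hV γ hγ) dI dJ,
    fun V hV hVo I J dI dJ hI hJ => exists_hasVariationalDeriv_bracket hP hI hJ hVo (hVO V hV),
    fun V hV hVo I J K dI dJ dK dIJ dJK dKI hI hJ hK hIJ hJK hKI γ hγ => ?_⟩
  -- A single operator is treated as a constant sequence, with only the order zero entering the
  -- sums.
  have := sum_bracket_bracket_eq_zero hT (fun _ => hP) (fun F => by simp) (by simp)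
    (isJacobiTriple_deformedOperator hω₀ hT ε) hVo (hVO V hV) hI hJ hK (fun _ => hIJ) (fun _ => hJK)
    (fun _ => hKI) hγ
  simpa using this

theorem isFormalLoopPoisson_coeffOperator (hω₀ : IsPoissonStructure ω₀) (hT : IsClosedThreeForm T) :
    IsFormalLoopPoisson (coeffOperator ω₀ T) := by
  have hP := isSmoothSkewOn_coeffOperator hω₀ hT
  refine ⟨fun V _ I J dI dJ _ _ n γ _ => bracket_skew (hP n) (fun _ => trivial) dI dJ,
    fun V hVo I J dI dJ hI hJ n =>
      exists_hasVariationalDeriv_bracket (hP n) hI hJ hVo fun _ _ _ => trivial,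
    fun V hVo I J K dI dJ dK dIJ dJK dKI hI hJ hK hIJ hJK hKI n γ hγ => ?_⟩
  exact sum_bracket_bracket_eq_zero hT hP
    (fun F => (Finset.Nat.sum_antidiagonal_swap (f := F)).symm)
    (fun p hp => by
      rw [Finset.HasAntidiagonal.mem_antidiagonal] at hp
      omega)
    (isJacobiTriple_coeffOperator hω₀ hT n) hVo (fun _ _ _ => trivial) hI hJ hK hIJ hJK hKI hγ

end Poisson

/-! ### Convergence and homogeneity of the expansion -/

section Expansion

theorem eventually_hasSum_inverse_one_add {E : Type*} [NormedAddCommGroup E] [NormedSpace ℝ E]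
    [FiniteDimensional ℝ E] (L : Module.End ℝ E) :
    ∀ᶠ ε in 𝓝 (0 : ℝ), IsUnit (1 + ε • L) ∧ ∀ (a : Module.Dual ℝ E) (x : E),
      HasSum (fun n => ε ^ n * a (((-L) ^ n) x)) (a (Ring.inverse (1 + ε • L) x)) := by
  have : CompleteSpace E := FiniteDimensional.complete ℝ E
  -- The geometric series is summed in the normed algebra of continuous endomorphisms and then
  -- evaluated on a covector and a vector.
  let Φ : Module.End ℝ E ≃ₐ[ℝ] (E →L[ℝ] E) := Module.End.toContinuousLinearMap E
  have hc : Continuous fun ε : ℝ => ‖-(ε • Φ L)‖ := by fun_prop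
  have h0 := hc.continuousAt.eventually_lt (continuousAt_const (y := (1 : ℝ))) (x₀ := 0) (by simp)
  filter_upwards [h0] with ε hε
  have h1 := hasSum_geom_series_inverse (-(ε • Φ L)) hε
  have hΦ : 1 - -(ε • Φ L) = Φ (1 + ε • L) := by
    rw [map_add, map_one, map_smul, sub_neg_eq_add]
  have hu : IsUnit (1 + ε • L) := by
    rw [← MulEquiv.isUnit_map Φ, ← hΦ]
    exact isUnit_one_sub_of_norm_lt_one hε
  refine ⟨hu, fun a x => ?_⟩
  have hinv : Ring.inverse (Φ (1 + ε • L)) = Φ (Ring.inverse (1 + ε • L)) := by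
    obtain ⟨u, hu⟩ := hu
    rw [← hu, Ring.inverse_unit]
    exact Ring.inverse_unit (Units.map Φ.toMonoidHom u)
  rw [hΦ, hinv] at h1
  have h2 := h1.mapL ((LinearMap.toContinuousLinearMap a).comp
    (ContinuousLinearMap.apply ℝ E x))
  have h3 : ∀ n, ε ^ n * a (((-L) ^ n) x) = (LinearMap.toContinuousLinearMap a).comp
      (ContinuousLinearMap.apply ℝ E x) ((-(ε • Φ L)) ^ n) := fun n => by
    have h4 : (-(ε • Φ L)) ^ n = Φ (ε ^ n • (-L) ^ n) := by
      rw [← smul_neg, smul_pow, map_smul, map_pow, map_neg]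
    rw [h4]
    exact (map_smul a (ε ^ n) (((-L) ^ n) x)).symm
  simp only [h3]
  exact h2

variable {N : ℕ} {M : Type*} [TopologicalSpace M] [ChartedSpace (Coord N) M]
  {ω₀ : TwoTensor N M} {T : ThreeForm N M}

/-- The push-through identity `ω (-τ ω)ⁿ = (-ω τ)ⁿ ω`. It matches the coefficients, in the form
suited to skew-symmetry, with the Neumann series of `(1 + ε ω τ)⁻¹` applied to ω. -/
theorem coeffOperator_eq_pow (n : ℕ) (p : M) (v : Tan N p) (α : Cotan N p) :
    coeffOperator ω₀ T n p v α = ((-(ω₀ p ∘ₗ contract T p v)) ^ n) (ω₀ p α) := by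
  induction n with
  | zero => rfl
  | succ n ih =>
    rw [coeffOperator_succ_apply, ih, pow_succ', Module.End.mul_apply]
    rfl

/-- The map `v ↦ -τ ω` is linear, and the n-fold product of endomorphisms is multilinear in its
factors. -/
theorem coeffOperator_homogeneous (n : ℕ) (p : M) (α β : Cotan N p) :
    ∃ L : MultilinearMap ℝ (fun _ : Fin n => Tan N p) ℝ,
      ∀ v, α (coeffOperator ω₀ T n p v β) = L (fun _ => v) := by
  let ℓ : Tan N p →ₗ[ℝ] Module.End ℝ (Cotan N p) :=
    { toFun := fun v => -(contract T p v ∘ₗ ω₀ p)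
      map_add' := fun v w => by
        ext β : 1
        ext η
        change -T p ![η, ω₀ p β, v + w] = -T p ![η, ω₀ p β, v] + -T p ![η, ω₀ p β, w]
        have h (z : Tan N p) : ![η, ω₀ p β, z] = Function.update ![η, ω₀ p β, 0] 2 z := by
          ext i; fin_cases i <;> rfl
        rw [h (v + w), (T p).map_update_add, ← h, ← h, neg_add]
      map_smul' := fun r v => by
        ext β : 1
        ext η
        change -T p ![η, ω₀ p β, r • v] = r * -T p ![η, ω₀ p β, v]
        have h (z : Tan N p) : ![η, ω₀ p β, z] = Function.update ![η, ω₀ p β, 0] 2 z := by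
          ext i; fin_cases i <;> rfl
        rw [h (r • v), (T p).map_update_smul, ← h, smul_eq_mul, mul_neg] }
  let A : Module.End ℝ (Cotan N p) →ₗ[ℝ] ℝ :=
    (α ∘ₗ ω₀ p) ∘ₗ LinearMap.applyₗ β
  refine ⟨A.compMultilinearMap ((MultilinearMap.mkPiAlgebraFin ℝ n
    (Module.End ℝ (Cotan N p))).compLinearMap fun _ => ℓ), fun v => ?_⟩
  rw [LinearMap.compMultilinearMap_apply, MultilinearMap.compLinearMap_apply,
    MultilinearMap.mkPiAlgebraFin_apply_const]
  rfl

variable [IsManifold (𝓡 N) ∞ M] [T2Space M] [SecondCountableTopology M]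

theorem isGradedDeformation_coeffOperator (hω₀ : IsPoissonStructure ω₀)
    (hT : IsClosedThreeForm T) : IsGradedDeformation ω₀ (coeffOperator ω₀ T) where
  zero p v := rfl
  homogeneous := coeffOperator_homogeneous
  smooth n c a := by
    have h := (isSmoothSkewOn_coeffOperator hω₀ hT n).smooth c
    rw [opDom_univ] at h
    exact h.clm_apply (contDiffOn_const (c := LinearMap.toContinuousLinearMap a))
  poisson := isFormalLoopPoisson_coeffOperator hω₀ hT

end Expansion

end

end LoopPoisson

theorem mainTheorem3 {N : ℕ} {M : Type*} [TopologicalSpace M] [T2Space M]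
    [SecondCountableTopology M] [ChartedSpace (LoopPoisson.Coord N) M] [IsManifold (𝓡 N) ∞ M]
    (ω₀ : LoopPoisson.TwoTensor N M) (hω₀ : LoopPoisson.IsPoissonStructure ω₀)
    (T : LoopPoisson.ThreeForm N M) (hT : LoopPoisson.IsClosedThreeForm T) :
    (∀ ε : ℝ, LoopPoisson.IsLoopOpen (LoopPoisson.deformationDomain ω₀ T ε) ∧
      LoopPoisson.IsLoopPoisson (LoopPoisson.deformationDomain ω₀ T ε)
        (LoopPoisson.deformedOperator ω₀ T ε)) ∧
    (∀ γ : LoopPoisson.Loop N M, ∀ᶠ ε in 𝓝 (0 : ℝ), γ ∈ LoopPoisson.deformationDomain ω₀ T ε) ∧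
    ∃ P : ℕ → LoopPoisson.MatrixOperator N M,
      LoopPoisson.IsGradedDeformation ω₀ P ∧
      (∀ (p : M) (v : LoopPoisson.Tan N p),
        P 1 p v = -(ω₀ p ∘ₗ LoopPoisson.contract T p v ∘ₗ ω₀ p)) ∧
      (∀ (p : M) (v : LoopPoisson.Tan N p), ∀ᶠ ε in 𝓝 (0 : ℝ),
        IsUnit (LoopPoisson.deformationMatrix ω₀ T ε p v) ∧
        ∀ α β : LoopPoisson.Cotan N p,
          HasSum (fun n => ε ^ n * α (P n p v β))
            (α (LoopPoisson.deformedOperator ω₀ T ε p v β))) := by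
  refine ⟨fun ε => ⟨LoopPoisson.isLoopOpen_deformationDomain hω₀ hT ε,
    LoopPoisson.isLoopPoisson_deformedOperator hω₀ hT ε⟩,
    LoopPoisson.eventually_mem_deformationDomain hω₀ hT, LoopPoisson.coeffOperator ω₀ T,
    LoopPoisson.isGradedDeformation_coeffOperator hω₀ hT, fun p v => ?_, fun p v => ?_⟩
  · ext1 α
    exact LoopPoisson.coeffOperator_succ_apply 0 p v α
  -- The tangent space is viewed as the coordinate space, which carries the norm used for the
  -- series.
  · have h := LoopPoisson.eventually_hasSum_inverse_one_add (E := LoopPoisson.Coord N)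
      (ω₀ p ∘ₗ LoopPoisson.contract T p v : Module.End ℝ (LoopPoisson.Tan N p))
    filter_upwards [h] with ε hε
    refine ⟨hε.1, fun α β => ?_⟩
    simp only [LoopPoisson.coeffOperator_eq_pow]
    exact hε.2 α (ω₀ p β)
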